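/- Let $L^2_+(\mathbb R)$ be the Hardy space of all $f\in L^2(\mathbb R)$ whose Fourier transform vanishes a.e. on $(-\infty,0)$, let $C_+$ be the orthogonal projection of $L^2(\mathbb R)$ onto $L^2_+(\mathbb R)$, and let $q\in L^2_+(\mathbb R)$ satisfy $(1+x^2)^{s/2}q\in L^2(\mathbb R)$ for some $s>1/2$ (so that $q\in L^1(\mathbb R)$). Let $L_q=-\mathrm i\partial_x-qC_+\overline q$ in $L^2_+(\mathbb R)$ with domain $H^1(\mathbb R)\cap L^2_+(\mathbb R)$. Let $\widehat{\mathbb C}=(\mathbb C\setminus(0,\infty))\cup((0,\infty)+0\mathrm i)\cup((0,\infty)-0\mathrm i)$ be the complex plane slit along $(0,\infty)$ with two-sided boundary, with its natural topology; for $\lambda\le 0$, $\lambda\pm0\mathrm i$ means $\lambda$. For $k\in\widehat{\mathbb C}$ let $R_0(k):f\mapsto G_k*f$, where $G_k(x)=\mathrm i\mathrm e^{\mathrm ikx}\mathbf 1_{x>0}$ for $k$ in the closed upper half-plane (including $(0,\infty)+0\mathrm i$) and $G_k(x)=-\mathrm i\mathrm e^{\mathrm ikx}\mathbf 1_{x<0}$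 for $k$ in the closed lower half-plane (including $(0,\infty)-0\mathrm i$); for $k\in(-\infty,0]$ both choices agree on the integrable functions with Fourier transform vanishing on $(-\infty,0]$, to which $R_0(k)$ is applied. Let $\mathcal N$ be the set of $\lambda\ge0$ such that $1-C_+\overline qR_0(\lambda\pm0\mathrm i)qC_+$ has a nontrivial kernel in $L^2(\mathbb R)$ (the set is the same for both signs). For $k\in\widehat{\mathbb C}$ whose underlying complex number lies neither in $\mathcal N$ nor in the set of eigenvalues of $L_q$, let $$m_0(k)=R(k)q,\qquad R(k)=R_0(k)+R_0(k)qC_+\bigl(1-C_+\overline qR_0(k)qC_+\bigr)^{-1}C_+\overline qR_0(k),$$ and for $\lambda\in[0,\infty)\setminus\mathcal N$ let $$\beta(\lambda)=\mathrm i\int_{\mathbb R}q(y)\bigl([C_+\overline q\,m_0(\lambda+0\mathrm i)](y)+1\bigr)\mathrm e^{-\mathrm i\lambda y}\,\mathrm dy.$$ Then $L_q$ has finitely many eigenvalues, all real, and each has an eigenfunction $\phi$ with $\int_{\mathbb R}q\,\overline\phi\,\mathrm dx=2\pi\mathrm i$. Let $\lambda_1,\dots,\lambda_N$ be the distinct eigenvalues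 and $\phi_1,\dots,\phi_N$ corresponding eigenfunctions with this normalisation. There is a unique map $h:\widehat{\mathbb C}\to L^\infty(\mathbb R)$, continuous for the weak-$*$ topology of $L^\infty(\mathbb R)=(L^1(\mathbb R))^*$, with $$m_0(k)=-\mathrm i\sum_{j=1}^N\frac{\phi_j}{k-\lambda_j}+h(k)$$ for all $k\in\widehat{\mathbb C}$ at which $m_0(k)$ is defined, and for every $j$ there is a number $\gamma_j\in\mathbb C$ such that, for both choices of the sign $\pm$ and almost every $x\in\mathbb R$, $$h(x,\lambda_j\pm0\mathrm i)=(\gamma_j+x)\,\phi_j(x)+\mathrm i\sum_{j'\ne j}\frac{\phi_{j'}(x)}{\lambda_j-\lambda_{j'}}.$$ Moreover, $\beta$ has a unique extension to a continuous function on $[0,\infty)$, and this extension satisfies $\beta(\lambda_j)=0$ for every eigenvalue $\lambda_j\ge0$. -/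

import Mathlib

open MeasureTheory
open scoped ENNReal FourierTransform ContDiff ComplexConjugate

noncomputable section

namespace CalogeroMoser

/-- The complex Lebesgue spaces on the real line. -/
abbrev L1 : Type := Lp ℂ 1 (volume : Measure ℝ)

abbrev L2 : Type := Lp ℂ 2 (volume : Measure ℝ)

abbrev LInf : Type := Lp ℂ ∞ (volume : Measure ℝ)

/-! ### Hardy space and Szegő projection -/

/-- `f ↦ (𝓕 f)` restricted to `(-∞, 0)`. -/
def negativeFrequencies : L2 →L[ℂ] Lp ℂ 2 ((volume : Measure ℝ).restrict (Set.Iio 0)) :=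
  (LpToLpRestrictCLM ℝ ℂ ℂ volume 2 (Set.Iio 0)).comp
    (Lp.fourierTransformₗᵢ ℝ ℂ).toContinuousLinearEquiv.toContinuousLinearMap

/-- The Hardy space `L²₊(ℝ)`: the square integrable functions whose Fourier transform vanishes
almost everywhere on `(-∞, 0)`. -/
def hardySpace : Submodule ℂ L2 := negativeFrequencies.ker

instance : CompleteSpace hardySpace :=
  (ContinuousLinearMap.isClosed_ker negativeFrequencies).completeSpace_coe

/-- The Cauchy–Szegő projector `C₊`: the orthogonal projection of `L²(ℝ)` onto `L²₊(ℝ)`. -/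
def szego : L2 →L[ℂ] L2 := hardySpace.starProjection

/-- `q ∈ L²_{s,+}(ℝ)`, that is `q ∈ L²₊(ℝ)` and `(1 + x²)^{s/2} q ∈ L²(ℝ)`. -/
structure IsWeightedHardy (s : ℝ) (q : L2) : Prop where
  mem_hardy : q ∈ hardySpace
  weighted : MemLp (fun x : ℝ => (((1 + x ^ 2) ^ (s / 2) : ℝ) : ℂ) * q x) 2 volume

/-- By the Cauchy–Schwarz inequality, `L²_{s,+}(ℝ) ⊆ L¹(ℝ)` if `s > 1/2`. -/
theorem IsWeightedHardy.memLp_one {s : ℝ} {q : L2} (hq : IsWeightedHardy s q) (hs : 1 / 2 < s) :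
    MemLp q 1 (volume : Measure ℝ) := by
  have hw : MemLp (fun x : ℝ => (((1 + x ^ 2) ^ (-(s / 2)) : ℝ) : ℂ)) 2 volume := by
    have hmeas : AEStronglyMeasurable (fun x : ℝ => (((1 + x ^ 2) ^ (-(s / 2)) : ℝ) : ℂ))
        volume := by
      refine Measurable.aestronglyMeasurable ?_
      fun_prop
    rw [memLp_two_iff_integrable_sq_norm hmeas]
    have h := integrable_rpow_neg_one_add_norm_sq (E := ℝ) (μ := volume) (r := 2 * s)
      (by simpa using by linarith)
    refine h.congr (Filter.Eventually.of_forall fun x => ?_)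
    have hx : (0 : ℝ) < 1 + x ^ 2 := by positivity
    simp only [Real.norm_eq_abs, sq_abs, Complex.norm_real]
    rw [← Real.rpow_mul_natCast hx.le]
    congr 1
    push_cast
    ring
  have h := hq.weighted.mul (r := 1) hw
  refine h.ae_eq (Filter.Eventually.of_forall fun x => ?_)
  have hx : (0 : ℝ) < 1 + x ^ 2 := by positivity
  simp only [Pi.mul_apply]
  rw [← mul_assoc, ← Complex.ofReal_mul, ← Real.rpow_add hx]
  simp

/-! ### The Lax operator and its eigenvalues -/

/-- `f'` is the weak derivative of `f`. -/
def IsWeakDeriv (f f' : L2) : Prop :=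
  ∀ η : ℝ → ℂ, ContDiff ℝ ∞ η → HasCompactSupport η →
    ∫ x, deriv η x * f x = -∫ x, η x * f' x

/-- `φ` belongs to the domain `H¹₊(ℝ) = H¹(ℝ) ∩ L²₊(ℝ)` of the operator
`L_q = -i ∂ₓ - q C₊ q̄`, and `L_q φ = ψ`. Here `g` is the product `q̄ φ`, which is square
integrable since functions in `H¹(ℝ)` are bounded. -/
def LaxGraph (q φ ψ : L2) : Prop :=
  φ ∈ hardySpace ∧ ∃ φ' g : L2, IsWeakDeriv φ φ' ∧
    (g =ᵐ[volume] fun x => conj (q x) * φ x) ∧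
    (ψ =ᵐ[volume] fun x => -Complex.I * φ' x - q x * szego g x)

/-- The set of eigenvalues of `L_q`. -/
def pointSpectrum (q : L2) : Set ℂ :=
  {z | ∃ φ : L2, φ ≠ 0 ∧ LaxGraph q φ (z • φ)}

/-- `ev` lists the eigenvalues of `L_q` without repetition, and `φ j` is an eigenfunction for the
eigenvalue `ev j`, normalised by `⟨q, φ j⟩ = ∫ q \overline{φ j} = 2πi`. -/
structure IsEigenSystem (q : L2) {N : ℕ} (ev : Fin N → ℝ) (φ : Fin N → L2) : Prop where
  injective : Function.Injective ev
  range_eq : Set.range (fun j => (ev j : ℂ)) = pointSpectrum q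
  eigen : ∀ j, LaxGraph q (φ j) ((ev j : ℂ) • φ j)
  normalised : ∀ j, ∫ x, q x * conj (φ j x) = 2 * Real.pi * Complex.I

/-! ### The slit plane with two-sided boundary -/

/-- The set `(ℂ ∖ (0,∞)) ∪ ((0,∞) + 0i) ∪ ((0,∞) - 0i)`. -/
inductive CutPlane : Type
  | off (k : ℂ) (hk : ¬(0 < k.re ∧ k.im = 0)) : CutPlane
  | above (t : ℝ) (ht : 0 < t) : CutPlane
  | below (t : ℝ) (ht : 0 < t) : CutPlane

namespace CutPlane

/-- The underlying complex number. -/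
def toComplex : CutPlane → ℂ
  | off k _ => k
  | above t _ => t
  | below t _ => t

/-- Membership in the closed upper half-plane, including its side `(0,∞) + 0i` of the cut. -/
def OnUpper : CutPlane → Prop
  | off k _ => 0 ≤ k.im
  | above _ _ => True
  | below _ _ => False

/-- Membership in the closed lower half-plane, including its side `(0,∞) - 0i` of the cut. -/
def OnLower : CutPlane → Prop
  | off k _ => k.im ≤ 0
  | above _ _ => False
  | below _ _ => True

/-- `Near p ε p'`: the point `p'` lies in the basic `ε`-neighbourhood of `p`. -/
def Near : CutPlane → ℝ → CutPlane → Prop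
  | off k _, ε, p' => dist p'.toComplex k < ε
  | above t _, ε, p' => dist p'.toComplex t < ε ∧ p'.OnUpper
  | below t _, ε, p' => dist p'.toComplex t < ε ∧ p'.OnLower

theorem Near.mono {p p' : CutPlane} {ε δ : ℝ} (h : p.Near ε p') (hle : ε ≤ δ) :
    p.Near δ p' := by
  cases p with
  | off k hk => exact lt_of_lt_of_le h hle
  | above t ht => exact ⟨lt_of_lt_of_le h.1 hle, h.2⟩
  | below t ht => exact ⟨lt_of_lt_of_le h.1 hle, h.2⟩

instance : TopologicalSpace CutPlane where
  IsOpen U := ∀ p ∈ U, ∃ ε : ℝ, 0 < ε ∧ ∀ p', p.Near ε p' → p' ∈ U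
  isOpen_univ := fun _ _ => ⟨1, one_pos, fun _ _ => trivial⟩
  isOpen_inter := by
    intro U V hU hV p hp
    obtain ⟨ε, hε, h⟩ := hU p hp.1
    obtain ⟨δ, hδ, h'⟩ := hV p hp.2
    exact ⟨min ε δ, lt_min hε hδ, fun p' hp' =>
      ⟨h p' (hp'.mono (min_le_left _ _)), h' p' (hp'.mono (min_le_right _ _))⟩⟩
  isOpen_sUnion := by
    intro S hS p hp
    obtain ⟨U, hU, hpU⟩ := hp
    obtain ⟨ε, hε, h⟩ := hS U hU p hpU
    exact ⟨ε, hε, fun p' hp' => ⟨U, hU, h p' hp'⟩⟩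

/-- The point `t + 0i`, which is `t` itself if `t ≤ 0`. -/
def plus (t : ℝ) : CutPlane :=
  if h : 0 < t then above t h else off t (fun h' => h (by simpa using h'.1))

/-- The point `t - 0i`, which is `t` itself if `t ≤ 0`. -/
def minus (t : ℝ) : CutPlane :=
  if h : 0 < t then below t h else off t (fun h' => h (by simpa using h'.1))

end CutPlane

/-! ### Resolvents -/

open Classical in
/-- The kernel of the free resolvent: `G_k(x) = i e^{ikx} 1_{x > 0}` on the upper side and
`G_k(x) = -i e^{ikx} 1_{x < 0}` on the lower side. For `k ∈ (-∞, 0]` the upper choice is made;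
both choices give the same convolution with an integrable function whose Fourier transform
vanishes on `(-∞, 0]`. -/
def freeKernel (k : CutPlane) (x : ℝ) : ℂ :=
  if k.OnUpper then
    if 0 < x then Complex.I * Complex.exp (Complex.I * k.toComplex * x) else 0
  else
    if x < 0 then -Complex.I * Complex.exp (Complex.I * k.toComplex * x) else 0

theorem measurable_freeKernel (k : CutPlane) : Measurable (freeKernel k) := by
  unfold freeKernel
  split_ifs
  · exact Measurable.ite measurableSet_Ioi (by fun_prop) measurable_const
  · exact Measurable.ite measurableSet_Iio (by fun_prop) measurable_const

theorem CutPlane.im_nonneg {k : CutPlane} (h : k.OnUpper) : 0 ≤ k.toComplex.im := by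
  cases k with
  | off k hk => exact h
  | above t ht => simp [CutPlane.toComplex]
  | below t ht => exact h.elim

theorem CutPlane.im_nonpos {k : CutPlane} (h : ¬ k.OnUpper) : k.toComplex.im ≤ 0 := by
  cases k with
  | off k hk => exact (not_le.mp h).le
  | above t ht => exact (h trivial).elim
  | below t ht => simp [CutPlane.toComplex]

theorem norm_freeKernel_le (k : CutPlane) (x : ℝ) : ‖freeKernel k x‖ ≤ 1 := by
  unfold freeKernel
  split_ifs with h hx hx
  · have := mul_nonneg (CutPlane.im_nonneg h) hx.le
    simpa [Complex.norm_exp] using this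
  · simp
  · have := mul_nonneg_of_nonpos_of_nonpos (CutPlane.im_nonpos h) hx.le
    simpa [Complex.norm_exp] using this
  · simp

/-- Convolution with the kernel of the free resolvent. -/
def freeConv (k : CutPlane) (f : ℝ → ℂ) (x : ℝ) : ℂ := ∫ y, freeKernel k (x - y) * f y

theorem integrable_freeConv (k : CutPlane) {f : ℝ → ℂ} (hf : Integrable f) (x : ℝ) :
    Integrable (fun y => freeKernel k (x - y) * f y) := by
  refine hf.bdd_mul (c := 1) ?_ (Filter.Eventually.of_forall fun y => norm_freeKernel_le k _)
  exact ((measurable_freeKernel k).comp (measurable_const.sub measurable_id)).aestronglyMeasurable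

theorem norm_freeConv_le (k : CutPlane) (f : L1) (x : ℝ) : ‖freeConv k f x‖ ≤ ‖f‖ := by
  rw [L1.norm_eq_integral_norm]
  refine norm_integral_le_of_norm_le (L1.integrable_coeFn f).norm
    (Filter.Eventually.of_forall fun y => ?_)
  rw [norm_mul]
  exact mul_le_of_le_one_left (norm_nonneg _) (norm_freeKernel_le k _)

theorem memLp_freeConv (k : CutPlane) (f : L1) :
    MemLp (freeConv k f) ∞ (volume : Measure ℝ) := by
  refine memLp_top_of_bound ?_ ‖f‖ (Filter.Eventually.of_forall (norm_freeConv_le k f))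
  have h : AEStronglyMeasurable (fun p : ℝ × ℝ => freeKernel k (p.1 - p.2) * f p.2)
      ((volume : Measure ℝ).prod volume) :=
    ((measurable_freeKernel k).comp
      (measurable_fst.sub measurable_snd)).aestronglyMeasurable.mul
      (Lp.aestronglyMeasurable f).comp_snd
  exact h.integral_prod_right'

/-- The free resolvent `R₀(k)` as a bounded operator from `L¹(ℝ)` to `L^∞(ℝ)`. -/
def freeResolvent (k : CutPlane) : L1 →L[ℂ] LInf :=
  LinearMap.mkContinuous
    { toFun := fun f => (memLp_freeConv k f).toLp
      map_add' := by
        intro f g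
        rw [← MemLp.toLp_add]
        refine MemLp.toLp_congr _ _ (Filter.Eventually.of_forall fun x => ?_)
        simp only [Pi.add_apply, freeConv]
        rw [← integral_add (integrable_freeConv k (L1.integrable_coeFn f) x)
          (integrable_freeConv k (L1.integrable_coeFn g) x)]
        refine integral_congr_ae ?_
        filter_upwards [Lp.coeFn_add f g] with y hy
        rw [hy, Pi.add_apply, mul_add]
      map_smul' := by
        intro c f
        rw [RingHom.id_apply, ← MemLp.toLp_const_smul]
        refine MemLp.toLp_congr _ _ (Filter.Eventually.of_forall fun x => ?_)
        simp only [Pi.smul_apply, freeConv, smul_eq_mul]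
        rw [← integral_const_mul]
        refine integral_congr_ae ?_
        filter_upwards [Lp.coeFn_smul c f] with y hy
        rw [hy, Pi.smul_apply, smul_eq_mul]
        ring }
    1 (by
      intro f
      rw [one_mul]
      change ‖(memLp_freeConv k f).toLp‖ ≤ ‖f‖
      rw [Lp.norm_toLp, eLpNorm_exponent_top]
      exact ENNReal.toReal_le_of_le_ofReal (norm_nonneg f)
        (eLpNormEssSup_le_of_ae_bound (Filter.Eventually.of_forall (norm_freeConv_le k f))))

/-- Multiplication by `q` as a bounded operator from `L²(ℝ)` to `L¹(ℝ)`. -/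
def mulToL1 (q : L2) : L2 →L[ℂ] L1 :=
  (ContinuousLinearMap.mul ℂ ℂ).holderL volume 2 2 1 q

/-- Multiplication by `q̄` as a bounded operator from `L^∞(ℝ)` to `L²(ℝ)`. -/
def conjMulToL2 (q : L2) : LInf →L[ℂ] L2 :=
  (ContinuousLinearMap.mul ℂ ℂ).holderL volume 2 ∞ 2 (star q)

/-- The operator `C₊ q̄ R₀(k) q C₊` on `L²(ℝ)`. -/
def sandwiched (q : L2) (k : CutPlane) : L2 →L[ℂ] L2 :=
  szego ∘L conjMulToL2 q ∘L freeResolvent k ∘L mulToL1 q ∘L szego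

/-- The exceptional set `𝒩` of all `t ≥ 0` such that `1 - C₊ q̄ R₀(t ± 0i) q C₊` has a
nontrivial kernel. (The two signs give the same set.) -/
def exceptionalSet (q : L2) : Set ℝ :=
  {t | 0 ≤ t ∧ ((1 - sandwiched q (CutPlane.plus t)).ker ≠ ⊥ ∨
    (1 - sandwiched q (CutPlane.minus t)).ker ≠ ⊥)}

/-- The resolvent
`R(k) = R₀(k) + R₀(k) q C₊ (1 - C₊ q̄ R₀(k) q C₊)⁻¹ C₊ q̄ R₀(k)` from `L¹(ℝ)` to `L^∞(ℝ)`.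
It is only used on functions in `L¹` with Fourier transform vanishing on `(-∞, 0]`, and for `k`
outside the eigenvalues of `L_q` and the exceptional set, where the inverse exists. -/
def resolvent (q : L2) (k : CutPlane) : L1 →L[ℂ] LInf :=
  freeResolvent k + freeResolvent k ∘L mulToL1 q ∘L szego ∘L
    Ring.inverse (1 - sandwiched q k) ∘L szego ∘L conjMulToL2 q ∘L freeResolvent k

/-! ### The inhomogeneous Jost solution and the scattering coefficient -/

/-- The inhomogeneous Jost solution `m₀(k) = R(k) q`, for `q ∈ L²₊(ℝ) ∩ L¹(ℝ)`. -/
def jostInhom (q : L2) (hq : MemLp q 1 (volume : Measure ℝ)) (k : CutPlane) : LInf :=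
  resolvent q k hq.toLp

/-- The scattering coefficient
`β(t) = i ∫ q(y) ((C₊ q̄ m₀(t + 0i))(y) + 1) e^{-ity} dy` for `t ∈ [0,∞) ∖ 𝒩`. -/
def scatteringCoeff (q : L2) (hq : MemLp q 1 (volume : Measure ℝ)) (t : ℝ) : ℂ :=
  Complex.I * ∫ y : ℝ, q y *
    (szego (conjMulToL2 q (jostInhom q hq (CutPlane.plus t))) y + 1) *
      Complex.exp (-(Complex.I * t * y))

/-- `h` is a weak-* continuous map from the slit plane to `L^∞(ℝ)` with
`m₀(k) = -i ∑ⱼ φⱼ / (k - λⱼ) + h(k)` wherever `m₀(k)` is defined. -/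
structure IsRegularPart (q : L2) (hq : MemLp q 1 (volume : Measure ℝ)) {N : ℕ}
    (ev : Fin N → ℝ) (φ : Fin N → L2) (h : CutPlane → LInf) : Prop where
  weakStar_continuous : ∀ f : L1, Continuous fun k => ∫ x, h k x * f x
  expansion : ∀ k : CutPlane, k.toComplex ∉ pointSpectrum q →
    k.toComplex ∉ Complex.ofReal '' exceptionalSet q →
    jostInhom q hq k =ᵐ[volume] fun x =>
      -Complex.I * ∑ j, φ j x / (k.toComplex - (ev j : ℂ)) + h k x

/-- `b` is a continuous function on `[0,∞)` which coincides with `β` off the exceptional set. -/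
def IsScatteringExtension (q : L2) (hq : MemLp q 1 (volume : Measure ℝ))
    (b : C(Set.Ici (0 : ℝ), ℂ)) : Prop :=
  ∀ t : Set.Ici (0 : ℝ), (t : ℝ) ∉ exceptionalSet q → b t = scatteringCoeff q hq t

end CalogeroMoser

end

open CalogeroMoser

noncomputable section

namespace CalogeroMoser

open Filter Topology Complex

/-! ### Primitives of integrable functions and the free resolvent equation -/

/-! Everything rests on bound states: functions `φ` that vanish at both ends of the line and satisfy
`-iφ' - q f = tφ` with `t` real and `f = C₊(q̄φ)`. If `f` is in the kernel of `1 - C₊q̄R₀(t±0i)qC₊`,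
the forms `∫ R₀(t±0i)(qf) conj(qf)` both equal `‖f‖²`. Their difference is `i` times the squared
modulus of the Fourier transform of `qf` at `t`, so that transform vanishes there, the two
resolvents of `qf` agree, and `R₀(t±0i)(qf)` is a bound state (`boundState_of_sideOp_eq_self`). Off
the real axis the kernel is trivial (`eq_zero_of_sideOp_eq_self`). The weight on `q` gives bound
states enough decay to be integrable and to satisfy `xφ → 0`. Hardy's inequality gives `qf ∈ L²`
(`BoundState.memLp_mul`), so that bound states are genuine eigenfunctions; conversely every
eigenfunction is a bound state (`LaxGraph.exists_boundState`).

The algebraic core is that `C₊` commutes with multiplication by `x` up to a rank one term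
(`mul_szego`). It yields the trace identity `|∫ q̄φ|² = 2π‖φ‖²`
(`BoundState.integral_mul_conj_integral`). Hence `∫ q̄φ` determines the bound state at a given
energy, eigenvalues are simple, the normalisation in the theorem is possible and forces `‖φⱼ‖² =
2π`, and Bessel's inequality for `q` bounds the number of eigenvalues.

The regular part `h` has to solve `(L_q - k)h = q - i∑φⱼ`. By the normalisation this source is
orthogonal to every `φⱼ`. Write `h = R₀(k)F` with `F = qv + q - i∑φⱼ` and `v = C₊q̄h`, and subtract
from `C₊q̄R₀(k)` the finite rank term `∓i∑⟨R₀(k)·, φⱼ⟩fⱼ`. With this choice of sign the equation for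
`v` is of Fredholm type with trivial kernel on the whole closed half-plane, eigenvalues included
(`BoundSystem.isUnit_regular`). Its solution automatically has vanishing coefficients `⟨h, φⱼ⟩`, so
it solves the original equation as well (`BoundSystem.regularSol_iff`). Inversion is continuous, so
`F` is continuous in `L¹` and `h` is weak-* continuous. On `(-∞,0]` the two half-planes agree
because `F` has no nonpositive frequencies.

At `λⱼ` the solution is explicit: the commutator formula gives `(L_q - λⱼ)(xφⱼ) = q - iφⱼ`, the
other terms of the source are produced by multiples of `φᵢ` with `i ≠ j`, and `γⱼ` is fixed by
orthogonality to `φⱼ` (`BoundSystem.exists_eigenPart`). This function vanishes at both ends, so it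
is both the forward and the backward solution. Finally `β(t)` is `i` times the Fourier transform of
`F` at `t`, since the pole terms do not contribute. This is continuous in `t`, and it vanishes at
`λⱼ` because a source whose solution vanishes at both ends has no component at that frequency. -/

theorem intervalIntegrable_of_locallyIntegrable {p : ℝ → ℂ} (hp : LocallyIntegrable p)
    (a b : ℝ) : IntervalIntegrable p volume a b :=
  (hp.integrableOn_isCompact isCompact_uIcc).intervalIntegrable

theorem memLp_conj {p : ℝ≥0∞} {f : ℝ → ℂ} (hf : MemLp f p) : MemLp (fun x => conj (f x)) p :=
  hf.star

theorem integrable_conj {f : ℝ → ℂ} (hf : Integrable f) : Integrable (fun x => conj (f x)) :=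
  memLp_one_iff_integrable.1 (memLp_conj (memLp_one_iff_integrable.2 hf))

/-- `P` need not be differentiable at every point, so the fundamental theorem of calculus is applied
to `g` only; the term with `p` comes from exchanging the order of integration over the triangle `y ≤
x`. -/
theorem mul_primitive_sub_of_le {P p g g' : ℝ → ℂ} (hp : LocallyIntegrable p)
    (hP : ∀ a b, P b - P a = ∫ x in a..b, p x) (hg : ∀ x, HasDerivAt g (g' x) x)
    (hg' : Continuous g') {a b : ℝ} (hab : a ≤ b) :
    g b * P b - g a * P a = ∫ x in a..b, (g' x * P x + g x * p x) := by
  have hpi : ∀ a b, IntervalIntegrable p volume a b := 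
    intervalIntegrable_of_locallyIntegrable hp
  have hgc : Continuous g := continuous_iff_continuousAt.2 fun x => (hg x).continuousAt
  have hPeq : ∀ x, P x = P a + ∫ y in a..x, p y := fun x => by rw [← hP a x]; ring
  have hPc : Continuous P := by
    have : P = fun x => P a + ∫ y in a..x, p y := funext hPeq
    rw [this]
    exact continuous_const.add (intervalIntegral.continuous_primitive hpi a)
  have hgi : ∀ c d, ∫ x in c..d, g' x = g d - g c := fun c d =>
    intervalIntegral.integral_eq_sub_of_hasDerivAt (fun x _ => hg x) (hg'.intervalIntegrable _ _)
  have key : ∫ x in a..b, g' x * (∫ y in a..x, p y) = ∫ y in a..b, (g b - g y) * p y := by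
    have h1 : ∫ x in a..b, g' x * (∫ y in a..x, p y) =
        ∫ x in Set.Ioc a b, ∫ y in Set.Ioc a b,
          (Set.Iic x).indicator (fun y => g' x * p y) y := by
      rw [intervalIntegral.integral_of_le hab]
      refine setIntegral_congr_fun measurableSet_Ioc fun x hx => ?_
      rw [intervalIntegral.integral_of_le hx.1.le, setIntegral_indicator measurableSet_Iic,
        ← integral_const_mul]
      congr 2
      ext y
      simp only [Set.mem_Ioc, Set.mem_inter_iff, Set.mem_Iic]
      exact ⟨fun h => ⟨⟨h.1, h.2.trans hx.2⟩, h.2⟩, fun h => ⟨h.1.1, h.2⟩⟩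
    have h2 : ∫ y in a..b, (g b - g y) * p y =
        ∫ y in Set.Ioc a b, ∫ x in Set.Ioc a b,
          (Set.Iic x).indicator (fun y => g' x * p y) y := by
      rw [intervalIntegral.integral_of_le hab]
      refine setIntegral_congr_fun measurableSet_Ioc fun y hy => ?_
      have : ∀ x, (Set.Iic x).indicator (fun y => g' x * p y) y =
          (Set.Ici y).indicator (fun x => g' x * p y) x := by
        intro x
        by_cases h : y ≤ x <;> simp [Set.indicator, h]
      simp_rw [this]
      rw [setIntegral_indicator measurableSet_Ici, integral_mul_const, ← hgi y b,
        intervalIntegral.integral_of_le hy.2]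
      congr 1
      have : Set.Ioc a b ∩ Set.Ici y = Set.Icc y b := by
        ext x
        simp only [Set.mem_Ioc, Set.mem_inter_iff, Set.mem_Ici, Set.mem_Icc]
        exact ⟨fun h => ⟨h.2, h.1.2⟩, fun h => ⟨⟨hy.1.trans_le h.1, h.2⟩, h.1⟩⟩
      rw [this, integral_Icc_eq_integral_Ioc]
    rw [h1, h2, integral_integral_swap]
    have hi : Integrable (fun z : ℝ × ℝ => g' z.1 * p z.2)
        ((volume.restrict (Set.Ioc a b)).prod (volume.restrict (Set.Ioc a b))) :=
      Integrable.mul_prod ((hg'.integrableOn_Icc).mono_set Set.Ioc_subset_Icc_self)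
        ((intervalIntegrable_iff_integrableOn_Ioc_of_le hab).1 (hpi a b))
    have hm : MeasurableSet {z : ℝ × ℝ | z.2 ≤ z.1} := measurableSet_le measurable_snd measurable_fst
    refine (hi.indicator hm).congr (Eventually.of_forall fun z => ?_)
    simp [Function.uncurry, Set.indicator]
  have hsplit : ∫ x in a..b, (g' x * P x + g x * p x) =
      (∫ x in a..b, g' x * P a) + (∫ x in a..b, g' x * (∫ y in a..x, p y)) +
        ∫ x in a..b, g x * p x := by
    rw [← intervalIntegral.integral_add, ← intervalIntegral.integral_add]
    · refine intervalIntegral.integral_congr fun x _ => ?_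
      rw [hPeq x]; ring
    · exact ((hg'.mul continuous_const).add
        (hg'.mul (intervalIntegral.continuous_primitive hpi a))).intervalIntegrable _ _
    · exact (hpi a b).continuousOn_mul hgc.continuousOn
    · exact (hg'.mul continuous_const).intervalIntegrable _ _
    · exact (hg'.mul (intervalIntegral.continuous_primitive hpi a)).intervalIntegrable _ _
  rw [hsplit, key, intervalIntegral.integral_mul_const, hgi]
  have : ∫ y in a..b, (g b - g y) * p y = g b * (∫ y in a..b, p y) - ∫ y in a..b, g y * p y := by
    rw [← intervalIntegral.integral_const_mul, ← intervalIntegral.integral_sub]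
    · simp_rw [sub_mul]
    · exact (hpi a b).const_mul _
    · exact (hpi a b).continuousOn_mul hgc.continuousOn
  rw [this, ← hP a b]
  ring

/-- The product rule for a continuously differentiable function and a primitive. -/
theorem mul_primitive_sub {P p g g' : ℝ → ℂ} (hp : LocallyIntegrable p)
    (hP : ∀ a b, P b - P a = ∫ x in a..b, p x) (hg : ∀ x, HasDerivAt g (g' x) x)
    (hg' : Continuous g') (a b : ℝ) :
    g b * P b - g a * P a = ∫ x in a..b, (g' x * P x + g x * p x) := by
  rcases le_total a b with h | h
  · exact mul_primitive_sub_of_le hp hP hg hg' h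
  · rw [intervalIntegral.integral_symm, ← mul_primitive_sub_of_le hp hP hg hg' h]
    ring

/-- `-i φ' - k φ = F`, in integrated form. -/
def FreeEq (k : ℂ) (φ F : ℝ → ℂ) : Prop :=
  ∀ a b : ℝ, exp (-(I * k * b)) * φ b - exp (-(I * k * a)) * φ a =
    I * ∫ y in a..b, exp (-(I * k * y)) * F y

theorem hasDerivAt_expMul (c : ℂ) (x : ℝ) :
    HasDerivAt (fun x : ℝ => exp (c * x)) (c * exp (c * x)) x := by
  have h : HasDerivAt (fun x : ℝ => c * (x : ℂ)) (c * 1) x :=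
    (Complex.ofRealCLM.hasDerivAt (x := x)).const_mul c
  have := h.cexp
  rwa [mul_one, mul_comm (exp _)] at this

theorem locallyIntegrable_exp_mul {F : ℝ → ℂ} (hF : LocallyIntegrable F) (c : ℂ) :
    LocallyIntegrable (fun y : ℝ => exp (c * y) * F y) :=
  locallyIntegrableOn_univ.1 <|
    (locallyIntegrableOn_univ.2 hF).continuousOn_mul (by fun_prop) isOpen_univ.isLocallyClosed

theorem FreeEq.continuous {k : ℂ} {φ F : ℝ → ℂ} (h : FreeEq k φ F) (hF : LocallyIntegrable F) :
    Continuous φ := by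
  have : φ = fun b : ℝ => exp (I * k * b) *
      (exp (-(I * k * (0 : ℝ))) * φ 0 + I * ∫ y in (0 : ℝ)..b, exp (-(I * k * y)) * F y) := by
    funext b
    rw [← h 0 b, add_sub_cancel, ← mul_assoc, ← Complex.exp_add]
    simp
  rw [this]
  have h2 := intervalIntegral.continuous_primitive (μ := volume)
    (f := fun y : ℝ => exp (-(I * k * y)) * F y)
    (fun a b => by
      have := intervalIntegrable_of_locallyIntegrable (locallyIntegrable_exp_mul hF (-(I * k))) a b
      simpa [neg_mul] using this) 0
  fun_prop

/-- Multiplying the equation by a continuously differentiable function. -/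
theorem FreeEq.mul {k : ℂ} {φ F g g' : ℝ → ℂ} (h : FreeEq k φ F) (hF : LocallyIntegrable F)
    (hg : ∀ x, HasDerivAt g (g' x) x) (hg' : Continuous g') :
    FreeEq k (fun x => g x * φ x) (fun x => g x * F x - I * g' x * φ x) := by
  intro a b
  have hl : LocallyIntegrable (fun y : ℝ => I * (exp (-(I * k * y)) * F y)) := by
    have := (locallyIntegrable_exp_mul hF (-(I * k))).smul I
    simpa [neg_mul, Pi.smul_def] using this
  have := mul_primitive_sub (P := fun x : ℝ => exp (-(I * k * x)) * φ x) hl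
    (fun a b => by rw [h a b, intervalIntegral.integral_const_mul]) hg hg' a b
  rw [← intervalIntegral.integral_const_mul]
  calc _ = g b * (exp (-(I * k * b)) * φ b) - g a * (exp (-(I * k * a)) * φ a) := by ring
    _ = _ := by
      rw [this]
      refine intervalIntegral.integral_congr fun x _ => ?_
      simp only
      linear_combination (g' x * φ x * exp (-(I * k * x))) * I_mul_I

theorem FreeEq.mul_id {k : ℂ} {φ F : ℝ → ℂ} (h : FreeEq k φ F) (hF : LocallyIntegrable F) :
    FreeEq k (fun x => x * φ x) (fun x => x * F x - I * φ x) := by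
  have := h.mul hF (g := fun x => (x : ℂ)) (g' := fun _ => 1)
    (fun x => Complex.ofRealCLM.hasDerivAt) continuous_const
  simpa using this

/-- The multiplier is `e^{i(k-l)x}`. This plays the role of the resolvent identity: it lets a
solution at one energy be represented by `R₀` at another, in particular at nonreal ones. -/
theorem FreeEq.shift {k : ℂ} {φ F : ℝ → ℂ} (h : FreeEq k φ F) (hF : LocallyIntegrable F)
    (l : ℂ) : FreeEq l φ (fun x => F x + (k - l) * φ x) := by
  intro a b
  have h2 := h.mul hF (g := fun x : ℝ => exp ((I * (k - l)) * x))
    (fun x => hasDerivAt_expMul _ x) (by fun_prop) a b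
  have e3 : ∀ x : ℝ, exp (-(I * k * x)) * exp ((I * (k - l)) * x) = exp (-(I * l * x)) := by
    intro x; rw [← Complex.exp_add]; congr 1; ring
  simp only [← mul_assoc, e3] at h2
  rw [h2]
  congr 1
  refine intervalIntegral.integral_congr fun x _ => ?_
  simp only
  rw [← e3 x]
  linear_combination (-(k - l) * φ x * exp (-(I * k * x)) * exp ((I * (k - l)) * x)) * I_mul_I

theorem FreeEq.add {k : ℂ} {φ F φ' F' : ℝ → ℂ} (h : FreeEq k φ F) (h' : FreeEq k φ' F')
    (hF : LocallyIntegrable F) (hF' : LocallyIntegrable F') :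
    FreeEq k (fun x => φ x + φ' x) (fun x => F x + F' x) := by
  intro a b
  have i1 := intervalIntegrable_of_locallyIntegrable (locallyIntegrable_exp_mul hF (-(I * k))) a b
  have i2 := intervalIntegrable_of_locallyIntegrable (locallyIntegrable_exp_mul hF' (-(I * k))) a b
  simp only [neg_mul] at i1 i2
  simp only [mul_add]
  rw [intervalIntegral.integral_add i1 i2]
  linear_combination h a b + h' a b

theorem FreeEq.const_mul {k : ℂ} {φ F : ℝ → ℂ} (h : FreeEq k φ F) (c : ℂ) :
    FreeEq k (fun x => c * φ x) (fun x => c * F x) := by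
  intro a b
  have : ∀ y : ℝ, exp (-(I * k * y)) * (c * F y) = c * (exp (-(I * k * y)) * F y) := by
    intro y; ring
  simp only [this]
  rw [intervalIntegral.integral_const_mul]
  linear_combination c * h a b

theorem FreeEq.congr {k : ℂ} {φ F G : ℝ → ℂ} (h : FreeEq k φ F) (hFG : F =ᵐ[volume] G) :
    FreeEq k φ G := by
  intro a b
  rw [h a b]
  congr 1
  refine intervalIntegral.integral_congr_ae ?_
  filter_upwards [hFG] with x hx _
  rw [hx]

/-! ### The two resolvent kernels -/

/-- The forward (`b = true`) and backward (`b = false`) kernels of the free resolvent. -/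
def sideKernel (b : Bool) (z : ℂ) (x : ℝ) : ℂ :=
  if b then if 0 < x then I * exp (I * z * x) else 0
  else if x < 0 then -I * exp (I * z * x) else 0

/-- The closed half-plane belonging to a kernel. -/
def halfPlane (b : Bool) : Set ℂ := {z | if b then 0 ≤ z.im else z.im ≤ 0}

theorem ofReal_mem_halfPlane (b : Bool) (t : ℝ) : (t : ℂ) ∈ halfPlane b := by
  cases b <;> simp [halfPlane]

theorem conj_mem_halfPlane {b : Bool} {z : ℂ} (hz : z ∈ halfPlane b) :
    conj z ∈ halfPlane (!b) := by
  cases b <;> simpa [halfPlane] using hz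

theorem measurable_sideKernel (b : Bool) (z : ℂ) : Measurable (sideKernel b z) := by
  unfold sideKernel
  cases b <;> simp only [Bool.false_eq_true, if_false, if_true]
  · exact Measurable.ite measurableSet_Iio (by fun_prop) measurable_const
  · exact Measurable.ite measurableSet_Ioi (by fun_prop) measurable_const

theorem norm_sideKernel_le {b : Bool} {z : ℂ} (hz : z ∈ halfPlane b) (x : ℝ) :
    ‖sideKernel b z x‖ ≤ 1 := by
  unfold sideKernel
  cases b
  · simp only [halfPlane, Bool.false_eq_true, if_false, Set.mem_ofPred_eq] at hz ⊢
    split_ifs with h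
    · have := mul_nonneg_of_nonpos_of_nonpos hz h.le
      simpa [Complex.norm_exp] using this
    · simp
  · simp only [halfPlane, if_true, Set.mem_ofPred_eq] at hz ⊢
    split_ifs with h
    · have := mul_nonneg hz h.le
      simpa [Complex.norm_exp] using this
    · simp

theorem conj_sideKernel (b : Bool) (z : ℂ) (x : ℝ) :
    conj (sideKernel b z x) = sideKernel (!b) (conj z) (-x) := by
  cases b <;> simp only [sideKernel, Bool.not_false, Bool.not_true, if_true, Bool.false_eq_true,
    if_false, Left.neg_neg_iff, Left.neg_pos_iff] <;> split_ifs <;>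
    simp [← Complex.exp_conj]

theorem continuous_sideKernel (b : Bool) (x : ℝ) : Continuous fun z => sideKernel b z x := by
  unfold sideKernel
  cases b
  · by_cases h : x < 0 <;> simp only [h, if_true, if_false, Bool.false_eq_true] <;> fun_prop
  · by_cases h : 0 < x <;> simp only [h, if_true, if_false] <;> fun_prop

/-- Convolution with the kernels of the free resolvent. -/
def sideConv (b : Bool) (z : ℂ) (F : ℝ → ℂ) (x : ℝ) : ℂ := ∫ y, sideKernel b z (x - y) * F y

theorem integrable_sideConv {b : Bool} {z : ℂ} (hz : z ∈ halfPlane b) {F : ℝ → ℂ}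
    (hF : Integrable F) (x : ℝ) : Integrable (fun y => sideKernel b z (x - y) * F y) := by
  refine hF.bdd_mul (c := 1) ?_ (Eventually.of_forall fun y => norm_sideKernel_le hz _)
  exact ((measurable_sideKernel b z).comp
    (measurable_const.sub measurable_id)).aestronglyMeasurable

theorem norm_sideConv_le {b : Bool} {z : ℂ} (hz : z ∈ halfPlane b) {F : ℝ → ℂ}
    (hF : Integrable F) (x : ℝ) : ‖sideConv b z F x‖ ≤ ∫ y, ‖F y‖ := by
  refine norm_integral_le_of_norm_le hF.norm (Eventually.of_forall fun y => ?_)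
  rw [norm_mul]
  exact mul_le_of_le_one_left (norm_nonneg _) (norm_sideKernel_le hz _)

theorem sideConv_congr {b : Bool} {z : ℂ} {F G : ℝ → ℂ} (h : F =ᵐ[volume] G) :
    sideConv b z F = sideConv b z G := by
  funext x
  refine integral_congr_ae ?_
  filter_upwards [h] with y hy
  rw [hy]

theorem sideConv_true_eq (z : ℂ) (F : ℝ → ℂ) (x : ℝ) :
    sideConv true z F x = I * exp (I * z * x) * ∫ y in Set.Iio x, exp (-(I * z * y)) * F y := by
  rw [← integral_const_mul, ← integral_indicator measurableSet_Iio]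
  refine integral_congr_ae (Eventually.of_forall fun y => ?_)
  by_cases h : y < x
  · simp only [sideKernel, if_true, sub_pos, h, Set.indicator, Set.mem_Iio]
    have : exp (I * z * ((x - y : ℝ) : ℂ)) = exp (I * z * x) * exp (-(I * z * y)) := by
      rw [← Complex.exp_add]; congr 1; push_cast; ring
    rw [this]; ring
  · simp [sideKernel, h]

theorem sideConv_false_eq (z : ℂ) (F : ℝ → ℂ) (x : ℝ) :
    sideConv false z F x =
      -I * exp (I * z * x) * ∫ y in Set.Ioi x, exp (-(I * z * y)) * F y := by
  rw [← integral_const_mul, ← integral_indicator measurableSet_Ioi]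
  refine integral_congr_ae (Eventually.of_forall fun y => ?_)
  by_cases h : x < y
  · simp only [sideKernel, Bool.false_eq_true, if_false, sub_neg, h, Set.indicator, Set.mem_Ioi,
      if_true]
    have : exp (I * z * ((x - y : ℝ) : ℂ)) = exp (I * z * x) * exp (-(I * z * y)) := by
      rw [← Complex.exp_add]; congr 1; push_cast; ring
    rw [this]; ring
  · simp [sideKernel, h]

theorem integrableOn_exp_mul_Iio {z : ℂ} (hz : z ∈ halfPlane true) {F : ℝ → ℂ}
    (hF : Integrable F) (x : ℝ) :
    IntegrableOn (fun y : ℝ => exp (-(I * z * y)) * F y) (Set.Iio x) := by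
  refine hF.integrableOn.bdd_mul (c := Real.exp (z.im * x)) (by fun_prop) ?_
  filter_upwards [ae_restrict_mem measurableSet_Iio] with y hy
  have hz' : 0 ≤ z.im := by simpa [halfPlane] using hz
  have := mul_le_mul_of_nonneg_left (le_of_lt hy) hz'
  simpa [Complex.norm_exp] using this

theorem integrableOn_exp_mul_Ioi {z : ℂ} (hz : z ∈ halfPlane false) {F : ℝ → ℂ}
    (hF : Integrable F) (x : ℝ) :
    IntegrableOn (fun y : ℝ => exp (-(I * z * y)) * F y) (Set.Ioi x) := by
  refine hF.integrableOn.bdd_mul (c := Real.exp (z.im * x)) (by fun_prop) ?_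
  filter_upwards [ae_restrict_mem measurableSet_Ioi] with y hy
  have hz' : z.im ≤ 0 := by simpa [halfPlane] using hz
  have := mul_le_mul_of_nonpos_left (le_of_lt hy) hz'
  simpa [Complex.norm_exp] using this

theorem exp_mul_exp_neg (w : ℂ) : exp w * exp (-w) = 1 := by
  rw [← Complex.exp_add]; simp

theorem freeEq_sideConv {b : Bool} {z : ℂ} (hz : z ∈ halfPlane b) {F : ℝ → ℂ}
    (hF : Integrable F) : FreeEq z (sideConv b z F) F := by
  intro a c
  cases b
  · have key : ∀ x : ℝ, exp (-(I * z * x)) * sideConv false z F x =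
        -I * ∫ y in Set.Ioi x, exp (-(I * z * y)) * F y := by
      intro x
      rw [sideConv_false_eq]
      linear_combination (-I * ∫ y in Set.Ioi x, exp (-(I * z * y)) * F y) *
        exp_mul_exp_neg (I * z * x)
    rw [key, key, ← intervalIntegral.integral_Ioi_sub_Ioi'
      (integrableOn_exp_mul_Ioi hz hF a) (integrableOn_exp_mul_Ioi hz hF c)]
    ring
  · have key : ∀ x : ℝ, exp (-(I * z * x)) * sideConv true z F x =
        I * ∫ y in Set.Iic x, exp (-(I * z * y)) * F y := by
      intro x
      rw [sideConv_true_eq, integral_Iic_eq_integral_Iio]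
      linear_combination (I * ∫ y in Set.Iio x, exp (-(I * z * y)) * F y) *
        exp_mul_exp_neg (I * z * x)
    have hI : ∀ x, IntegrableOn (fun y : ℝ => exp (-(I * z * y)) * F y) (Set.Iic x) := fun x =>
      (integrableOn_Iic_iff_integrableOn_Iio).2 (integrableOn_exp_mul_Iio hz hF x)
    rw [key, key, ← intervalIntegral.integral_Iic_sub_Iic (hI a) (hI c)]
    ring

/-- The end of the real line at which solutions given by a kernel start. -/
def sideEnd (b : Bool) : Filter ℝ := if b then atBot else atTop

instance sideEnd_neBot (b : Bool) : (sideEnd b).NeBot := by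
  cases b <;> simp only [sideEnd, Bool.false_eq_true, if_false, if_true] <;> infer_instance

instance sideEnd_isCountablyGenerated (b : Bool) : (sideEnd b).IsCountablyGenerated := by
  cases b <;> simp only [sideEnd, Bool.false_eq_true, if_false, if_true] <;> infer_instance

/-- The integrated equation between `a` and `x` becomes the resolvent formula as `a` runs to the end
of the line. A filter `l` finer than the end suffices, which matters for square integrable solutions
not yet known to decay. -/
theorem FreeEq.eq_sideConv {b : Bool} {z : ℂ} (hz : z ∈ halfPlane b) {φ F : ℝ → ℂ}
    (h : FreeEq z φ F) (hF : Integrable F) {l : Filter ℝ} [l.NeBot]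
    [l.IsCountablyGenerated] (hl : l ≤ sideEnd b)
    (h0 : Tendsto (fun a : ℝ => exp (-(I * z * a)) * φ a) l (𝓝 0)) :
    φ = sideConv b z F := by
  funext x
  have hlim : Tendsto (fun a : ℝ => I * ∫ y in a..x, exp (-(I * z * y)) * F y) l
      (𝓝 (exp (-(I * z * x)) * φ x - 0)) := by
    simp_rw [← h _ x]
    exact tendsto_const_nhds.sub h0
  have e := exp_mul_exp_neg (I * z * x)
  cases b
  · have h2 : Tendsto (fun a : ℝ => I * ∫ y in a..x, exp (-(I * z * y)) * F y) l
        (𝓝 (-(I * ∫ y in Set.Ioi x, exp (-(I * z * y)) * F y))) := by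
      have := (intervalIntegral_tendsto_integral_Ioi x (integrableOn_exp_mul_Ioi hz hF x)
        (tendsto_id.mono_left (show l ≤ atTop from hl))).const_mul I
      refine this.neg.congr fun a => ?_
      rw [id, intervalIntegral.integral_symm]; ring
    have := tendsto_nhds_unique hlim h2
    rw [sideConv_false_eq]
    linear_combination exp (I * z * x) * this - φ x * e
  · have h2 : Tendsto (fun a : ℝ => I * ∫ y in a..x, exp (-(I * z * y)) * F y) l
        (𝓝 (I * ∫ y in Set.Iic x, exp (-(I * z * y)) * F y)) :=
      (intervalIntegral_tendsto_integral_Iic x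
        ((integrableOn_Iic_iff_integrableOn_Iio).2 (integrableOn_exp_mul_Iio hz hF x))
        (tendsto_id.mono_left (show l ≤ atBot from hl))).const_mul I
    have := tendsto_nhds_unique hlim h2
    rw [sideConv_true_eq, ← integral_Iic_eq_integral_Iio]
    linear_combination exp (I * z * x) * this - φ x * e

theorem tendsto_exp_mul_of_tendsto {t : ℝ} {φ : ℝ → ℂ} {l : Filter ℝ} (h : Tendsto φ l (𝓝 0)) :
    Tendsto (fun a : ℝ => exp (-(I * t * a)) * φ a) l (𝓝 0) := by
  rw [tendsto_zero_iff_norm_tendsto_zero] at h ⊢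
  refine h.congr fun a => ?_
  simp [Complex.norm_exp]

theorem FreeEq.eq_sideConv_real {b : Bool} {t : ℝ} {φ F : ℝ → ℂ} (h : FreeEq t φ F)
    (hF : Integrable F) (h0 : Tendsto φ (sideEnd b) (𝓝 0)) : φ = sideConv b t F :=
  h.eq_sideConv (ofReal_mem_halfPlane b t) hF le_rfl (tendsto_exp_mul_of_tendsto h0)

/-- Both boundary terms of the integrated equation disappear. This mechanism makes `β` vanish at the
eigenvalues and removes the pole terms from `β`. -/
theorem FreeEq.integral_eq_zero {t : ℝ} {φ F : ℝ → ℂ} (h : FreeEq t φ F) (hF : Integrable F)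
    (h0 : Tendsto φ atBot (𝓝 0)) (h1 : Tendsto φ atTop (𝓝 0)) :
    ∫ y : ℝ, exp (-(I * t * y)) * F y = 0 := by
  have hi : Integrable (fun y : ℝ => exp (-(I * t * y)) * F y) := by
    refine hF.bdd_mul (c := 1) (by fun_prop) (Eventually.of_forall fun y => ?_)
    simp [Complex.norm_exp]
  have h2 := ((intervalIntegral_tendsto_integral hi (tendsto_neg_atTop_atBot (G := ℝ))
    tendsto_id).const_mul I)
  have h3 : Tendsto (fun a : ℝ => I * ∫ y in (-a)..(id a), exp (-(I * t * y)) * F y) atTop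
      (𝓝 (0 - 0)) := by
    exact ((tendsto_exp_mul_of_tendsto h1).sub
      ((tendsto_exp_mul_of_tendsto h0).comp tendsto_neg_atTop_atBot)).congr fun a => h (-a) a
  have := tendsto_nhds_unique h2 h3
  simpa using this

/-- The jump of the free resolvent across the real axis sees only the frequency `t` of the source.
It serves both to identify the kernel on the axis and to glue the two half-planes along `(-∞,0]`. -/
theorem sideConv_true_sub_false {t : ℝ} {F : ℝ → ℂ} (hF : Integrable F) (x : ℝ) :
    sideConv true t F x - sideConv false t F x =
      I * exp (I * t * x) * ∫ y : ℝ, exp (-(I * t * y)) * F y := by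
  have hi : Integrable (fun y : ℝ => exp (-(I * t * y)) * F y) := by
    refine hF.bdd_mul (c := 1) (by fun_prop) (Eventually.of_forall fun y => ?_)
    simp [Complex.norm_exp]
  rw [sideConv_true_eq, sideConv_false_eq, ← integral_Iic_eq_integral_Iio,
    ← intervalIntegral.integral_Iic_add_Ioi (b := x) hi.integrableOn hi.integrableOn]
  ring

theorem tendsto_sideConv_real {b : Bool} {t : ℝ} {F : ℝ → ℂ} (hF : Integrable F) :
    Tendsto (sideConv b t F) (sideEnd b) (𝓝 0) := by
  have hlim : ∀ y, Tendsto (fun x : ℝ => sideKernel b t (x - y) * F y) (sideEnd b) (𝓝 0) := by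
    intro y
    refine tendsto_const_nhds.congr' ?_
    cases b
    · filter_upwards [(eventually_ge_atTop y : ∀ᶠ x in sideEnd false, y ≤ x)] with x hx
      simp [sideKernel, not_lt.2 hx]
    · filter_upwards [(eventually_le_atBot y : ∀ᶠ x in sideEnd true, x ≤ y)] with x hx
      simp [sideKernel, not_lt.2 hx]
  have := tendsto_integral_filter_of_dominated_convergence (μ := volume)
    (F := fun x y => sideKernel b t (x - y) * F y) (f := fun _ => 0) (fun y => ‖F y‖)
    (Eventually.of_forall fun x =>
      (integrable_sideConv (ofReal_mem_halfPlane b t) hF x).aestronglyMeasurable)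
    (Eventually.of_forall fun x => Eventually.of_forall fun y => by
      rw [norm_mul]
      exact mul_le_of_le_one_left (norm_nonneg _)
        (norm_sideKernel_le (ofReal_mem_halfPlane b t) _)) hF.norm
    (Eventually.of_forall hlim)
  rw [integral_zero] at this
  exact this

/-- The adjoint of the forward resolvent is the backward resolvent. -/
theorem integral_sideConv_mul_conj {b : Bool} {z : ℂ} (hz : z ∈ halfPlane b) {F G : ℝ → ℂ}
    (hF : Integrable F) (hG : Integrable G) :
    ∫ x, sideConv b z F x * conj (G x) = ∫ y, F y * conj (sideConv (!b) (conj z) G y) := by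
  have hGc := integrable_conj hG
  have h1 : ∀ x, sideConv b z F x * conj (G x) =
      ∫ y, sideKernel b z (x - y) * (conj (G x) * F y) := by
    intro x
    rw [sideConv, ← integral_mul_const]
    congr 1; funext y; ring
  have h2 : ∀ y, F y * conj (sideConv (!b) (conj z) G y) =
      ∫ x, sideKernel b z (x - y) * (conj (G x) * F y) := by
    intro y
    rw [sideConv, ← integral_conj, ← integral_const_mul]
    congr 1; funext x
    rw [map_mul, conj_sideKernel]
    simp only [Bool.not_not, Complex.conj_conj, neg_sub]
    ring
  simp_rw [h1, h2]
  refine integral_integral_swap ?_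
  refine (hGc.mul_prod hF).bdd_mul (c := 1) ?_
    (Eventually.of_forall fun p => norm_sideKernel_le hz _)
  exact ((measurable_sideKernel b z).comp
    (measurable_fst.sub measurable_snd)).aestronglyMeasurable

/-! ### The Fourier transform on `L²` -/

theorem integral_mul_fourier (f : L2) (θ : SchwartzMap ℝ ℂ) :
    ∫ x, θ x * (𝓕 f : L2) x = ∫ x, (𝓕 θ : SchwartzMap ℝ ℂ) x * f x := by
  have h := congrArg (fun T : TemperedDistribution ℝ ℂ => T θ)
    (Lp.fourier_toTemperedDistribution_eq f)
  simpa [TemperedDistribution.fourier_apply] using h.symm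

theorem locallyIntegrable_L2 (f : L2) : LocallyIntegrable f volume :=
  (Lp.memLp f).locallyIntegrable (by norm_num)

/-- A locally integrable function is determined by its integrals against Schwartz functions. -/
theorem ae_eq_of_forall_schwartz {f g : ℝ → ℂ} (hf : LocallyIntegrable f)
    (hg : LocallyIntegrable g)
    (h : ∀ θ : SchwartzMap ℝ ℂ, HasCompactSupport θ → ∫ x, θ x * f x = ∫ x, θ x * g x) :
    f =ᵐ[volume] g := by
  refine ae_eq_of_integral_contDiff_smul_eq hf hg fun η hη hc => ?_
  have hg₁ : HasCompactSupport (Complex.ofRealCLM ∘ η) := hc.comp_left rfl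
  have hg₂ : ContDiff ℝ ∞ (Complex.ofRealCLM ∘ η) := by fun_prop
  simpa using h (hg₁.toSchwartzMap hg₂) (hg₁)

/-- The `L²` transform is reached by duality with Schwartz functions; the formulas for integrable
functions, modulations and conjugates are all verified through this criterion. -/
theorem fourier_ae_eq {f : L2} {g : ℝ → ℂ} (hg : LocallyIntegrable g)
    (h : ∀ θ : SchwartzMap ℝ ℂ, HasCompactSupport θ →
      ∫ x, (𝓕 θ : SchwartzMap ℝ ℂ) x * f x = ∫ x, θ x * g x) :
    (𝓕 f : L2) =ᵐ[volume] g :=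
  ae_eq_of_forall_schwartz (locallyIntegrable_L2 _) hg fun θ hθ => by
    rw [integral_mul_fourier, h θ hθ]

theorem fourier_schwartz_apply (θ : SchwartzMap ℝ ℂ) (x : ℝ) :
    (𝓕 θ : SchwartzMap ℝ ℂ) x = ∫ y : ℝ, exp (-(2 * Real.pi * I * x * y)) * θ y := by
  rw [SchwartzMap.fourier_coe, Real.fourier_real_eq_integral_exp_smul]
  congr 1; funext y; rw [smul_eq_mul]; congr 2; push_cast; ring

theorem continuous_fourierIntegral {f : ℝ → ℂ} (hf : Integrable f) :
    Continuous fun ξ : ℝ => ∫ x : ℝ, exp (-(2 * Real.pi * I * ξ * x)) * f x := by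
  refine continuous_of_dominated (bound := fun x => ‖f x‖) (fun ξ => ?_) (fun ξ => ?_) hf.norm ?_
  · exact (by fun_prop : Continuous fun x : ℝ =>
      exp (-(2 * Real.pi * I * ξ * x))).aestronglyMeasurable.mul hf.aestronglyMeasurable
  · refine Eventually.of_forall fun x => ?_
    simp [Complex.norm_exp]
  · exact Eventually.of_forall fun x => by fun_prop

/-- The two definitions of the Fourier transform agree on `L¹ ∩ L²`. -/
theorem fourier_toLp_ae_eq {f : ℝ → ℂ} (hf : Integrable f) (hf2 : MemLp f 2) :
    (𝓕 (hf2.toLp f) : L2) =ᵐ[volume] fun ξ : ℝ => ∫ x : ℝ, exp (-(2 * Real.pi * I * ξ * x)) * f x := by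
  refine fourier_ae_eq (continuous_fourierIntegral hf).locallyIntegrable fun θ _ => ?_
  have h1 : ∫ x, (𝓕 θ : SchwartzMap ℝ ℂ) x * (hf2.toLp f) x =
      ∫ x, (𝓕 θ : SchwartzMap ℝ ℂ) x * f x := by
    refine integral_congr_ae ?_
    filter_upwards [hf2.coeFn_toLp] with x hx
    rw [hx]
  rw [h1]
  simp_rw [fourier_schwartz_apply, ← integral_mul_const, ← integral_const_mul]
  rw [integral_integral_swap]
  · congr 1; funext y; congr 1; funext x
    have : exp (-(2 * Real.pi * I * x * y)) = exp (-(2 * Real.pi * I * y * x)) := by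
      congr 1; ring
    rw [this]; ring
  · have := (hf.mul_prod (θ.integrable (μ := volume))).bdd_mul (c := 1)
      (f := fun p : ℝ × ℝ => exp (-(2 * Real.pi * I * p.1 * p.2)))
      (by fun_prop)
      (Eventually.of_forall fun p => by simp [Complex.norm_exp])
    refine this.congr (Eventually.of_forall fun p => ?_)
    simp [Function.uncurry]; ring

theorem memLp_expMul {p : ℝ≥0∞} {f : ℝ → ℂ} (hf : MemLp f p) (t : ℝ) :
    MemLp (fun x : ℝ => exp (I * t * x) * f x) p := by
  refine hf.of_le ((by fun_prop : Continuous fun x : ℝ =>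
      exp (I * t * x)).aestronglyMeasurable.mul hf.1) (Eventually.of_forall fun x => ?_)
  simp [Complex.norm_exp]

theorem inner_eq_integral (f g : L2) : inner ℂ f g = ∫ x, conj (f x) * g x := by
  rw [L2.inner_def]
  congr 1; funext x; simp [mul_comm]

/-- The Fourier transform of a modulation. -/
theorem fourier_modulation (q : L2) (ξ : ℝ) :
    (𝓕 ((memLp_expMul (Lp.memLp q) (2 * Real.pi * ξ)).toLp _) : L2) =ᵐ[volume]
      fun η => (𝓕 q : L2) (η - ξ) := by
  have hmp : MeasurePreserving (fun η : ℝ => η - ξ) volume volume :=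
    measurePreserving_sub_right volume ξ
  refine fourier_ae_eq (((Lp.memLp (𝓕 q : L2)).comp_measurePreserving hmp).locallyIntegrable
    (by norm_num)) fun θ hθ => ?_
  have hc : HasCompactSupport fun y => θ (y + ξ) :=
    hθ.comp_homeomorph (Homeomorph.addRight ξ)
  have hs : ContDiff ℝ ∞ fun y => θ (y + ξ) := θ.smooth'.comp (by fun_prop)
  have h1 := integral_mul_fourier q (hc.toSchwartzMap hs)
  have h2 : ∫ η, θ η * (𝓕 q : L2) (η - ξ) = ∫ η, θ (η + ξ) * (𝓕 q : L2) η := by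
    rw [← integral_add_right_eq_self _ ξ]
    simp
  rw [h2]
  refine Eq.trans ?_ h1.symm
  refine integral_congr_ae ?_
  filter_upwards [(memLp_expMul (Lp.memLp q) (2 * Real.pi * ξ)).coeFn_toLp] with x hx
  rw [hx, fourier_schwartz_apply, fourier_schwartz_apply, ← mul_assoc, ← integral_mul_const]
  congr 1
  rw [← integral_add_right_eq_self _ ξ]
  congr 1; funext y
  have : exp (-(2 * Real.pi * I * x * ((y + ξ : ℝ) : ℂ))) * exp (I * ((2 * Real.pi * ξ : ℝ) : ℂ) * x)
      = exp (-(2 * Real.pi * I * x * y)) := by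
    rw [← Complex.exp_add]; congr 1; push_cast; ring
  simp only [HasCompactSupport.toSchwartzMap_toFun]
  rw [← this]; ring

/-- The Fourier transform of the complex conjugate. -/
theorem fourier_conj (q : L2) :
    (𝓕 ((memLp_conj (Lp.memLp q)).toLp _) : L2) =ᵐ[volume]
      fun η => conj ((𝓕 q : L2) (-η)) := by
  have hmp : MeasurePreserving (fun η : ℝ => -η) volume volume :=
    Measure.measurePreserving_neg volume
  refine fourier_ae_eq ((memLp_conj ((Lp.memLp (𝓕 q : L2)).comp_measurePreserving
    hmp)).locallyIntegrable (by norm_num)) fun θ hθ => ?_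
  have hc : HasCompactSupport fun y => conj (θ (-y)) :=
    (hθ.comp_homeomorph (Homeomorph.neg ℝ)).comp_left (g := fun z : ℂ => conj z) (map_zero _)
  have hs : ContDiff ℝ ∞ fun y => conj (θ (-y)) :=
    Complex.conjCLE.contDiff.comp (θ.smooth'.comp contDiff_neg)
  have h1 := congrArg conj (integral_mul_fourier q (hc.toSchwartzMap hs))
  rw [← integral_conj, ← integral_conj] at h1
  have h2 : ∫ η, θ η * conj ((𝓕 q : L2) (-η)) =
      ∫ η, θ (-η) * conj ((𝓕 q : L2) η) := by
    rw [← integral_neg_eq_self]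
    simp
  rw [h2]
  refine Eq.trans ?_ (h1.symm.trans ?_)
  · refine integral_congr_ae ?_
    filter_upwards [(memLp_conj (Lp.memLp q)).coeFn_toLp] with x hx
    rw [hx, fourier_schwartz_apply, fourier_schwartz_apply, map_mul]
    congr 1
    rw [← integral_conj, ← integral_neg_eq_self]
    congr 1; funext y
    simp [← Complex.exp_conj, Complex.conj_ofNat]
  · congr 1; funext y
    simp

/-! ### The Hardy space -/

theorem mem_hardySpace_iff {f : L2} :
    f ∈ hardySpace ↔ ∀ᵐ ξ : ℝ, ξ < 0 → (𝓕 f : L2) ξ = 0 := by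
  have h1 : f ∈ hardySpace ↔ negativeFrequencies f = 0 := Iff.rfl
  have h2 : negativeFrequencies f =ᵐ[volume.restrict (Set.Iio 0)] (𝓕 f : L2) :=
    LpToLpRestrictCLM_coeFn ℂ (Set.Iio 0) (𝓕 f : L2)
  rw [h1, Lp.eq_zero_iff_ae_eq_zero]
  have h3 : (∀ᵐ ξ : ℝ, ξ < 0 → (𝓕 f : L2) ξ = 0) ↔
      (𝓕 f : L2) =ᵐ[volume.restrict (Set.Iio 0)] 0 :=
    (ae_restrict_iff' measurableSet_Iio).symm
  rw [h3]
  exact ⟨fun h => h2.symm.trans h, fun h => h2.trans h⟩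

theorem memLp_indicator_fourier (g : L2) :
    MemLp ((Set.Ici (0 : ℝ)).indicator (𝓕 g : L2)) 2 volume :=
  (Lp.memLp (𝓕 g : L2)).indicator measurableSet_Ici

/-- By Plancherel, truncating the transform to `[0,∞)` leaves a remainder with frequencies in
`(-∞,0)`, hence orthogonal to the Hardy space. -/
theorem szego_eq (g : L2) : szego g = 𝓕⁻ ((memLp_indicator_fourier g).toLp _) := by
  set p : L2 := 𝓕⁻ ((memLp_indicator_fourier g).toLp _) with hp
  have hFp : (𝓕 p : L2) =ᵐ[volume] (Set.Ici (0 : ℝ)).indicator (𝓕 g : L2) := by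
    rw [hp, FourierTransform.fourier_fourierInv_eq]
    exact (memLp_indicator_fourier g).coeFn_toLp
  refine Submodule.eq_starProjection_of_mem_of_inner_eq_zero (K := hardySpace) ?_ ?_
  · rw [mem_hardySpace_iff]
    filter_upwards [hFp] with ξ hξ h0
    rw [hξ, Set.indicator_of_notMem (by simpa using h0)]
  · intro w hw
    rw [← Lp.inner_fourier_eq, inner_eq_integral]
    refine integral_eq_zero_of_ae ?_
    have hsub : (𝓕 (g - p) : L2) = 𝓕 g - 𝓕 p :=
      (Lp.fourierTransformₗᵢ ℝ ℂ).map_sub g p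
    rw [hsub]
    filter_upwards [hFp, mem_hardySpace_iff.1 hw, Lp.coeFn_sub (𝓕 g : L2) (𝓕 p : L2)]
      with ξ h1 h2 h3
    rw [h3, Pi.sub_apply, h1]
    by_cases h : ξ < 0
    · simp [h2 h]
    · rw [Set.indicator_of_mem (by simpa using h)]; simp

theorem fourier_szego (g : L2) :
    (𝓕 (szego g) : L2) =ᵐ[volume] (Set.Ici (0 : ℝ)).indicator (𝓕 g : L2) := by
  rw [szego_eq, FourierTransform.fourier_fourierInv_eq]
  exact (memLp_indicator_fourier g).coeFn_toLp

theorem szego_mem (g : L2) : szego g ∈ hardySpace :=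
  Submodule.starProjection_apply_mem _ _

theorem szego_of_mem {g : L2} (hg : g ∈ hardySpace) : szego g = g :=
  Submodule.starProjection_eq_self_iff.2 hg

theorem inner_szego_left (f g : L2) : inner ℂ (szego f) g = inner ℂ f (szego g) :=
  Submodule.inner_starProjection_left_eq_right _ _ _

theorem norm_szego_le (f : L2) : ‖szego f‖ ≤ ‖f‖ :=
  Submodule.norm_starProjection_apply_le _ _

/-- Integrable elements of the Hardy space have no nonpositive frequencies. -/
theorem integral_exp_mul_eq_zero {f : L2} (hf : f ∈ hardySpace) (hf1 : Integrable f) {t : ℝ}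
    (ht : t ≤ 0) : ∫ x : ℝ, exp (-(I * t * x)) * f x = 0 := by
  have h := fourier_toLp_ae_eq hf1 (Lp.memLp f)
  rw [Lp.toLp_coeFn] at h
  set G : ℝ → ℂ := fun ξ : ℝ => ∫ x : ℝ, exp (-(2 * Real.pi * I * ξ * x)) * f x with hG
  have hGc : Continuous G := continuous_fourierIntegral hf1
  have h0 : ∀ᵐ ξ ∂(volume.restrict (Set.Iio (0 : ℝ))), G ξ = (fun _ => (0 : ℂ)) ξ := by
    rw [ae_restrict_iff' measurableSet_Iio]
    filter_upwards [h, mem_hardySpace_iff.1 hf] with ξ h1 h2 h3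
    rw [← h1, h2 h3]
  have h1 : Set.EqOn G (fun _ => (0 : ℂ)) (Set.Iio 0) :=
    Measure.eqOn_open_of_ae_eq h0 isOpen_Iio hGc.continuousOn continuousOn_const
  -- Continuity of the transform extends the vanishing to the endpoint `0`, where the two resolvents
  -- must also agree.
  have h2 : Set.EqOn G (fun _ => (0 : ℂ)) (Set.Iic 0) := by
    have := h1.closure hGc continuous_const
    rwa [closure_Iio] at this
  have h3 : t / (2 * Real.pi) ∈ Set.Iic (0 : ℝ) :=
    div_nonpos_of_nonpos_of_nonneg ht (by positivity)
  have := h2 h3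
  refine Eq.trans ?_ this
  rw [hG]
  congr 1; funext x; congr 2
  push_cast
  have : (Real.pi : ℂ) ≠ 0 := by exact_mod_cast Real.pi_ne_zero
  field_simp

theorem mem_hardySpace_of_integral {f : L2} (hf1 : Integrable f)
    (h : ∀ᵐ t : ℝ, t < 0 → ∫ x : ℝ, exp (-(2 * Real.pi * I * t * x)) * f x = 0) :
    f ∈ hardySpace := by
  have h1 := fourier_toLp_ae_eq hf1 (Lp.memLp f)
  rw [Lp.toLp_coeFn] at h1
  rw [mem_hardySpace_iff]
  filter_upwards [h1, h] with ξ h2 h3 h4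
  rw [h2, h3 h4]

/-- Products of two elements of the Hardy space have no nonpositive frequencies. -/
theorem integral_exp_mul_mul_eq_zero {f q : L2} (hf : f ∈ hardySpace) (hq : q ∈ hardySpace)
    {t : ℝ} (ht : t ≤ 0) : ∫ x : ℝ, exp (-(I * t * x)) * (q x * f x) = 0 := by
  set ξ : ℝ := t / (2 * Real.pi) with hξ
  have hξ0 : ξ ≤ 0 := div_nonpos_of_nonpos_of_nonneg ht (by positivity)
  have hξt : 2 * Real.pi * ξ = t := by rw [hξ]; field_simp
  set qc : L2 := (memLp_conj (Lp.memLp q)).toLp _ with hqc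
  set a : L2 := (memLp_expMul (Lp.memLp qc) (2 * Real.pi * ξ)).toLp _ with ha
  have e1 : ∫ x : ℝ, exp (-(I * t * x)) * (q x * f x) = inner ℂ a f := by
    rw [inner_eq_integral]
    refine integral_congr_ae ?_
    filter_upwards [(memLp_expMul (Lp.memLp qc) (2 * Real.pi * ξ)).coeFn_toLp,
      (memLp_conj (Lp.memLp q)).coeFn_toLp] with x h1 h2
    rw [ha, h1, hqc, h2, map_mul, Complex.conj_conj, ← Complex.exp_conj, hξt]
    simp only [map_mul, conj_I, conj_ofReal]
    ring_nf
  -- By Plancherel the supports decide: the transform of `a` lives on `η ≤ ξ ≤ 0` and that of `f` on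
  -- `η ≥ 0`, so they share at most one point.
  rw [e1, ← Lp.inner_fourier_eq, inner_eq_integral]
  refine integral_eq_zero_of_ae ?_
  have hmp : MeasurePreserving (fun η : ℝ => η - ξ) volume volume :=
    measurePreserving_sub_right volume ξ
  have hmn : MeasurePreserving (fun η : ℝ => -η) volume volume :=
    Measure.measurePreserving_neg volume
  filter_upwards [fourier_modulation qc ξ, mem_hardySpace_iff.1 hf,
    hmp.quasiMeasurePreserving.ae (fourier_conj q),
    (hmn.comp hmp).quasiMeasurePreserving.ae (mem_hardySpace_iff.1 hq),
    compl_mem_ae_iff.2 (measure_singleton (μ := volume) ξ)] with η h1 h2 h3 h4 h5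
  rw [ha, h1, h3]
  by_cases h : η < 0
  · rw [h2 h]; simp
  · have h6 : η ≠ ξ := h5
    have h7 : ξ < η := lt_of_le_of_ne (hξ0.trans (not_lt.1 h)) (Ne.symm h6)
    have h8 := h4 (show -(η - ξ) < 0 by linarith)
    simp only [Function.comp_apply] at h8
    rw [h8]; simp

/-! ### The commutator of the Szegő projection with multiplication by `x` -/

theorem integrable_mul_of_memLp_two {f g : ℝ → ℂ} (hf : MemLp f 2) (hg : MemLp g 2) :
    Integrable fun x => f x * g x :=
  memLp_one_iff_integrable.1 (hg.mul (r := 1) hf)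

theorem integral_mul_eq_inner (f g : L2) :
    ∫ x, f x * g x = inner ℂ ((memLp_conj (Lp.memLp f)).toLp _) g := by
  rw [inner_eq_integral]
  refine integral_congr_ae ?_
  filter_upwards [(memLp_conj (Lp.memLp f)).coeFn_toLp] with x hx
  rw [hx, Complex.conj_conj]

theorem integral_mul_fourier_L2 (f g : L2) :
    ∫ x, f x * (𝓕 g : L2) x = ∫ x, (𝓕 f : L2) x * g x := by
  have key : ∀ f : L2, inner ℂ ((memLp_conj (Lp.memLp (𝓕 g : L2))).toLp _) f =
      inner ℂ ((memLp_conj (Lp.memLp g)).toLp _) (𝓕 f : L2) := by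
    intro f
    refine DenseRange.induction_on (SchwartzMap.denseRange_toLpCLM (F := ℂ) (p := 2)
      (μ := (volume : Measure ℝ)) ENNReal.ofNat_ne_top) f ?_ ?_
    · exact isClosed_eq (by fun_prop)
        (Continuous.inner continuous_const (Lp.fourierTransformₗᵢ ℝ ℂ).continuous)
    · intro θ
      have h := integral_mul_fourier g θ
      rw [SchwartzMap.toLpCLM_apply, SchwartzMap.toLp_fourier_eq, ← integral_mul_eq_inner,
        ← integral_mul_eq_inner]
      calc _ = ∫ x, θ x * (𝓕 g : L2) x := by
            refine integral_congr_ae ?_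
            filter_upwards [θ.coeFn_toLp 2 volume] with x hx
            rw [hx, mul_comm]
        _ = _ := by
            rw [h]
            refine integral_congr_ae ?_
            filter_upwards [(𝓕 θ : SchwartzMap ℝ ℂ).coeFn_toLp 2 volume] with x hx
            rw [hx, mul_comm]
  have := key f
  rw [← integral_mul_eq_inner, ← integral_mul_eq_inner] at this
  simpa only [mul_comm] using this

/-- Since `xg` is only square integrable, the transform of `g` cannot be differentiated under the
integral. Pairing the transform of `xg` with the indicator of `(a, b]`, whose own transform is
explicit, gives the integrated form directly. -/
theorem fourierIntegral_sub_of_le {g G : L2} (hG : G =ᵐ[volume] fun x : ℝ => (x : ℂ) * g x)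
    (hg : Integrable g) {a b : ℝ} (hab : a ≤ b) :
    (∫ x : ℝ, exp (-(2 * Real.pi * I * b * x)) * g x) -
      ∫ x : ℝ, exp (-(2 * Real.pi * I * a * x)) * g x =
      ∫ ξ in a..b, (-(2 * Real.pi * I)) * (𝓕 G : L2) ξ := by
  have hE2 : MemLp ((Set.Ioc a b).indicator fun _ => (1 : ℂ)) 2 volume :=
    memLp_indicator_const 2 measurableSet_Ioc 1 (Or.inr (by simp))
  have hE1 : Integrable ((Set.Ioc a b).indicator fun _ => (1 : ℂ)) :=
    (integrable_indicator_iff measurableSet_Ioc).2 (by simp)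
  have hFE := fourier_toLp_ae_eq hE1 hE2
  rw [intervalIntegral.integral_const_mul, intervalIntegral.integral_of_le hab,
    ← integral_indicator measurableSet_Ioc]
  have e1 : ∫ ξ, (Set.Ioc a b).indicator (𝓕 G : L2) ξ = ∫ ξ, (hE2.toLp _) ξ * (𝓕 G : L2) ξ := by
    refine integral_congr_ae ?_
    filter_upwards [hE2.coeFn_toLp] with x hx
    rw [hx]
    by_cases h : x ∈ Set.Ioc a b <;> simp [h]
  have hint : ∀ c : ℝ, Integrable fun x : ℝ => exp (-(2 * Real.pi * I * c * x)) * g x := by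
    intro c
    refine hg.bdd_mul (c := 1) (by fun_prop) (Eventually.of_forall fun y => ?_)
    simp [Complex.norm_exp]
  rw [e1, integral_mul_fourier_L2, ← integral_const_mul, ← integral_sub (hint b) (hint a)]
  refine integral_congr_ae ?_
  filter_upwards [hFE, hG] with x h1 h2
  rw [h1, h2]
  have h3 : ∫ y : ℝ, exp (-(2 * Real.pi * I * x * y)) * (Set.Ioc a b).indicator (fun _ => (1 : ℂ)) y
      = ∫ y in a..b, exp ((-(2 * Real.pi * I * x)) * y) := by
    rw [intervalIntegral.integral_of_le hab, ← integral_indicator measurableSet_Ioc]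
    congr 1; funext y
    by_cases h : y ∈ Set.Ioc a b <;> simp [h]
  have h4 : ∫ y in a..b, (-(2 * Real.pi * I * x)) * exp ((-(2 * Real.pi * I * x)) * y) =
      exp ((-(2 * Real.pi * I * x)) * b) - exp ((-(2 * Real.pi * I * x)) * a) :=
    intervalIntegral.integral_eq_sub_of_hasDerivAt (fun y _ => hasDerivAt_expMul _ y)
      ((by fun_prop : Continuous fun y : ℝ => (-(2 * Real.pi * I * x)) *
        exp ((-(2 * Real.pi * I * x)) * y)).intervalIntegrable _ _)
  rw [intervalIntegral.integral_const_mul] at h4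
  rw [h3]
  have e5 : ∀ c : ℝ, exp (-(2 * Real.pi * I * c * x)) = exp ((-(2 * Real.pi * I * x)) * c) := by
    intro c; congr 1; ring
  rw [e5, e5]
  linear_combination (-g x) * h4

theorem fourierIntegral_sub {g G : L2} (hG : G =ᵐ[volume] fun x : ℝ => (x : ℂ) * g x)
    (hg : Integrable g) (a b : ℝ) :
    (∫ x : ℝ, exp (-(2 * Real.pi * I * b * x)) * g x) -
      ∫ x : ℝ, exp (-(2 * Real.pi * I * a * x)) * g x =
      ∫ ξ in a..b, (-(2 * Real.pi * I)) * (𝓕 G : L2) ξ := by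
  rcases le_total a b with h | h
  · exact fourierIntegral_sub_of_le hG hg h
  · rw [intervalIntegral.integral_symm, ← fourierIntegral_sub_of_le hG hg h]; ring

/-- On the Fourier side multiplication by `x` is differentiation and `C₊` is truncation to `[0,∞)`.
Differentiating the truncated transform produces a jump at frequency `0` of height `∫ g`; that
boundary term is the constant. The trace identity and the explicit solution at an eigenvalue both
come from it. -/
theorem mul_szego {g G : L2} (hG : G =ᵐ[volume] fun x : ℝ => (x : ℂ) * g x)
    (hg : Integrable g) :
    ∀ᵐ x : ℝ, (x : ℂ) * szego g x = szego G x + I / (2 * Real.pi) * ∫ y, g y := by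
  have hpi : (2 * Real.pi * I : ℂ) ≠ 0 := by simp [Real.pi_ne_zero]
  set gh : ℝ → ℂ := fun ξ => ∫ x : ℝ, exp (-(2 * Real.pi * I * ξ * x)) * g x with hgh
  have hgF : (𝓕 g : L2) =ᵐ[volume] gh := by
    have := fourier_toLp_ae_eq hg (Lp.memLp g)
    rwa [Lp.toLp_coeFn] at this
  have hghc : Continuous gh := continuous_fourierIntegral hg
  have hghb : ∀ ξ, ‖gh ξ‖ ≤ ∫ x, ‖g x‖ := fun ξ =>
    norm_integral_le_of_norm_le hg.norm (Eventually.of_forall fun x => by simp [Complex.norm_exp])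
  have hl1 : LocallyIntegrable fun x : ℝ => (x : ℂ) * szego g x :=
    locallyIntegrableOn_univ.1 <| (locallyIntegrableOn_univ.2
      (locallyIntegrable_L2 (szego g))).continuousOn_mul (by fun_prop) isOpen_univ.isLocallyClosed
  refine ae_eq_of_forall_schwartz hl1
    ((locallyIntegrable_L2 _).add continuous_const.locallyIntegrable) fun θ hθ => ?_
  set Θ : SchwartzMap ℝ ℂ := 𝓕⁻ θ with hΘ
  have hθΘ : 𝓕 Θ = θ := FourierTransform.fourier_fourierInv_eq θ
  set D : SchwartzMap ℝ ℂ := SchwartzMap.derivCLM ℂ ℂ Θ with hD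
  have hDx : ∀ x, D x = deriv Θ x := fun x => SchwartzMap.derivCLM_apply ℂ Θ x
  have hFD : ∀ x : ℝ, (𝓕 D : SchwartzMap ℝ ℂ) x = (2 * Real.pi * I) * (x * θ x) := by
    intro x
    have h1 : (D : ℝ → ℂ) = deriv Θ := funext hDx
    rw [SchwartzMap.fourier_coe, h1, Real.fourier_deriv Θ.integrable Θ.differentiable
      (h1 ▸ D.integrable), ← SchwartzMap.fourier_coe, hθΘ]
    simp only [smul_eq_mul]
    ring
  have hΘ0 : Θ 0 = ∫ x, θ x := by
    rw [hΘ, SchwartzMap.fourierInv_coe, Real.fourierInv_eq]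
    simp
  -- the left-hand side on the Fourier side
  have eL : ∫ x, θ x * ((x : ℂ) * szego g x) =
      (2 * Real.pi * I)⁻¹ * ∫ ξ in Set.Ioi (0 : ℝ), D ξ * gh ξ := by
    have h1 : ∫ x, θ x * ((x : ℂ) * szego g x) =
        (2 * Real.pi * I)⁻¹ * ∫ x, (𝓕 D : SchwartzMap ℝ ℂ) x * szego g x := by
      rw [← integral_const_mul]
      congr 1; funext x
      rw [hFD]; field_simp
    rw [h1, ← integral_mul_fourier, ← integral_Ici_eq_integral_Ioi,
      ← integral_indicator measurableSet_Ici]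
    congr 1
    refine integral_congr_ae ?_
    filter_upwards [fourier_szego g, hgF] with ξ h2 h3
    rw [h2]
    by_cases h : ξ ∈ Set.Ici (0 : ℝ) <;> simp only [Set.indicator_of_mem,
      Set.indicator_of_notMem, h, not_false_eq_true, h3, mul_zero]
  have eR : ∫ x, θ x * szego G x = ∫ ξ in Set.Ioi (0 : ℝ), Θ ξ * (𝓕 G : L2) ξ := by
    conv_lhs => rw [← hθΘ]
    rw [← integral_mul_fourier, ← integral_Ici_eq_integral_Ioi,
      ← integral_indicator measurableSet_Ici]
    refine integral_congr_ae ?_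
    filter_upwards [fourier_szego G] with ξ h2
    rw [h2]
    by_cases h : ξ ∈ Set.Ici (0 : ℝ) <;> simp only [Set.indicator_of_mem,
      Set.indicator_of_notMem, h, not_false_eq_true, mul_zero]
  have hDi : Integrable fun ξ => D ξ * gh ξ :=
    D.integrable.mul_bdd (c := ∫ x, ‖g x‖) hghc.aestronglyMeasurable (Eventually.of_forall hghb)
  have hΘi : Integrable fun ξ => Θ ξ * (𝓕 G : L2) ξ :=
    integrable_mul_of_memLp_two (Θ.memLp 2) (Lp.memLp _)
  -- integration by parts
  have parts : ∫ ξ in Set.Ioi (0 : ℝ), D ξ * gh ξ =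
      (2 * Real.pi * I) * (∫ ξ in Set.Ioi (0 : ℝ), Θ ξ * (𝓕 G : L2) ξ) - Θ 0 * gh 0 := by
    have hfin : ∀ b : ℝ, Θ b * gh b - Θ 0 * gh 0 =
        (∫ ξ in (0 : ℝ)..b, D ξ * gh ξ) -
          (2 * Real.pi * I) * ∫ ξ in (0 : ℝ)..b, Θ ξ * (𝓕 G : L2) ξ := by
      intro b
      rw [mul_primitive_sub (P := gh) (p := fun ξ => (-(2 * Real.pi * I)) * (𝓕 G : L2) ξ)
        ((locallyIntegrable_L2 (𝓕 G : L2)).smul (-(2 * Real.pi * I : ℂ)))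
        (fun a b => fourierIntegral_sub hG hg a b) (g := Θ) (g' := D)
        (fun x => by rw [hDx]; exact Θ.differentiable.differentiableAt.hasDerivAt)
        D.continuous 0 b, ← intervalIntegral.integral_const_mul, ← intervalIntegral.integral_sub]
      · refine intervalIntegral.integral_congr fun x _ => ?_
        ring
      · exact hDi.intervalIntegrable
      · exact (hΘi.const_mul _).intervalIntegrable
    have t1 := (intervalIntegral_tendsto_integral_Ioi 0 hDi.integrableOn tendsto_id)
    have t2 := (intervalIntegral_tendsto_integral_Ioi 0 hΘi.integrableOn
      tendsto_id).const_mul (2 * Real.pi * I : ℂ)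
    have t3 := t1.sub t2
    have t4 : Tendsto (fun b : ℝ => Θ b * gh b - Θ 0 * gh 0) atTop (𝓝 (0 - Θ 0 * gh 0)) := by
      refine Tendsto.sub_const ?_ _
      have hz : Tendsto Θ atTop (𝓝 0) :=
        (zero_at_infty Θ).mono_left (by rw [cocompact_eq_atBot_atTop]; exact le_sup_right)
      refine hz.zero_mul_isBoundedUnder_le ?_
      exact isBoundedUnder_of ⟨_, hghb⟩
    have := tendsto_nhds_unique t4 (t3.congr fun b => (hfin b).symm)
    linear_combination -this
  have hgh0 : gh 0 = ∫ y, g y := by simp [hgh]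
  rw [eL, parts, ← eR]
  have hsplit : ∫ x, θ x * (szego G x + I / (2 * Real.pi) * ∫ y, g y) =
      (∫ x, θ x * szego G x) + (∫ x, θ x) * (I / (2 * Real.pi) * ∫ y, g y) := by
    rw [← integral_mul_const, ← integral_add]
    · simp_rw [mul_add]
    · exact integrable_mul_of_memLp_two (θ.memLp 2) (Lp.memLp _)
    · exact θ.integrable.mul_const _
  rw [hsplit, hΘ0, hgh0, mul_sub, inv_mul_cancel_left₀ hpi]
  have hI : (2 * Real.pi * I : ℂ)⁻¹ = -(I / (2 * Real.pi)) := by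
    have : (Real.pi : ℂ) ≠ 0 := by exact_mod_cast Real.pi_ne_zero
    field_simp
    rw [I_sq]; norm_num
  rw [hI]; ring

/-! ### Hardy's inequality and boundedness of `C₊ q̄ (L₀ - iκ)⁻¹` -/

theorem lintegral_comp_mul {B : ℝ → ℝ≥0∞} (hB : Measurable B) {c : ℝ} (hc : 0 < c) :
    ∫⁻ x, B x = ENNReal.ofReal c * ∫⁻ s, B (c * s) := by
  have h := Real.smul_map_volume_mul_left hc.ne'
  rw [abs_of_pos hc] at h
  conv_lhs => rw [← h]
  rw [lintegral_smul_measure, lintegral_map hB (measurable_const_mul c), smul_eq_mul]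

theorem lintegral_rpow_neg_half : ∫⁻ s in Set.Ioc (0 : ℝ) 1, ENNReal.ofReal s ^ (-(1 / 2) : ℝ) = 2 := by
  have h1 : ∫⁻ s in Set.Ioc (0 : ℝ) 1, ENNReal.ofReal s ^ (-(1 / 2) : ℝ) =
      ∫⁻ s in Set.Ioc (0 : ℝ) 1, ENNReal.ofReal (s ^ (-(1 / 2) : ℝ)) :=
    setLIntegral_congr_fun measurableSet_Ioc fun s hs => ENNReal.ofReal_rpow_of_pos hs.1
  have hi : IntervalIntegrable (fun s : ℝ => s ^ (-(1 / 2) : ℝ)) volume 0 1 :=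
    intervalIntegral.intervalIntegrable_rpow' (by norm_num)
  rw [h1, ← ofReal_integral_eq_lintegral_ofReal
    ((intervalIntegrable_iff_integrableOn_Ioc_of_le zero_le_one).1 hi)
    ((ae_restrict_iff' measurableSet_Ioc).2 (Eventually.of_forall fun s hs =>
      Real.rpow_nonneg hs.1.le _)),
    ← intervalIntegral.integral_of_le zero_le_one, integral_rpow (Or.inl (by norm_num))]
  norm_num

/-- Hardy's inequality in bilinear form. -/
theorem lintegral_hardy {a b : ℝ → ℝ≥0∞} (ha : Measurable a) (hb : Measurable b) :
    ∫⁻ η in Set.Ioi (0 : ℝ), a η * ((ENNReal.ofReal η)⁻¹ * ∫⁻ ζ in Set.Ioc 0 η, b ζ) ≤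
      2 * ((∫⁻ η, a η ^ (2 : ℝ)) ^ (1 / 2 : ℝ) * (∫⁻ η, b η ^ (2 : ℝ)) ^ (1 / 2 : ℝ)) := by
  -- The substitution `ζ = sη` writes the average of `b` over `(0, η]` as an average of its dilates
  -- over `s ∈ (0, 1]`.
  have h1 : ∀ η ∈ Set.Ioi (0 : ℝ), a η * ((ENNReal.ofReal η)⁻¹ * ∫⁻ ζ in Set.Ioc 0 η, b ζ) =
      ∫⁻ s in Set.Ioc (0 : ℝ) 1, a η * b (s * η) := by
    intro η hη
    have hη' : (0 : ℝ) < η := hη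
    rw [lintegral_const_mul (a η) (f := fun s => b (s * η)) (by fun_prop),
      ← lintegral_indicator measurableSet_Ioc,
      lintegral_comp_mul (hb.indicator measurableSet_Ioc) hη', ← mul_assoc (ENNReal.ofReal η)⁻¹,
      ENNReal.inv_mul_cancel (by simpa using hη') ENNReal.ofReal_ne_top, one_mul,
      ← lintegral_indicator measurableSet_Ioc]
    congr 2; funext s
    have : η * s ∈ Set.Ioc 0 η ↔ s ∈ Set.Ioc (0 : ℝ) 1 := by
      constructor
      · rintro ⟨h1, h2⟩
        exact ⟨pos_of_mul_pos_right h1 hη'.le, by nlinarith⟩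
      · rintro ⟨h1, h2⟩
        exact ⟨mul_pos hη' h1, by nlinarith⟩
    by_cases h : s ∈ Set.Ioc (0 : ℝ) 1
    · rw [Set.indicator_of_mem h, Set.indicator_of_mem (this.2 h), mul_comm]
    · rw [Set.indicator_of_notMem h, Set.indicator_of_notMem (fun h' => h (this.1 h'))]
  rw [setLIntegral_congr_fun measurableSet_Ioi h1, lintegral_lintegral_swap
    (by fun_prop)]
  -- Cauchy–Schwarz for each `s`; the dilation costs `s^{-1/2}`, whose integral over `(0, 1]` is the
  -- constant `2`.
  have h2 : ∀ s ∈ Set.Ioc (0 : ℝ) 1, ∫⁻ η in Set.Ioi (0 : ℝ), a η * b (s * η) ≤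
      ENNReal.ofReal s ^ (-(1 / 2) : ℝ) *
        ((∫⁻ η, a η ^ (2 : ℝ)) ^ (1 / 2 : ℝ) * (∫⁻ η, b η ^ (2 : ℝ)) ^ (1 / 2 : ℝ)) := by
    intro s hs
    refine (setLIntegral_le_lintegral _ _).trans ?_
    refine (ENNReal.lintegral_mul_le_Lp_mul_Lq volume Real.HolderConjugate.two_two
      ha.aemeasurable (hb.comp (measurable_const_mul s)).aemeasurable).trans_eq ?_
    have h3 : ∫⁻ η, b (s * η) ^ (2 : ℝ) = (ENNReal.ofReal s)⁻¹ * ∫⁻ η, b η ^ (2 : ℝ) := by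
      rw [lintegral_comp_mul (hb.pow_const (2 : ℝ)) hs.1, ← mul_assoc,
        ENNReal.inv_mul_cancel (by simpa using hs.1) ENNReal.ofReal_ne_top, one_mul]
    simp only [Function.comp_apply]
    rw [h3, ENNReal.mul_rpow_of_nonneg _ _ (by norm_num), ENNReal.inv_rpow, ← ENNReal.rpow_neg]
    ring
  refine (setLIntegral_mono' measurableSet_Ioc h2).trans_eq ?_
  rw [lintegral_mul_const _ (by fun_prop), lintegral_rpow_neg_half]

theorem integrable_sideKernel {b : Bool} {z : ℂ} (hz : z ∈ halfPlane b) (hz' : z.im ≠ 0) :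
    Integrable (sideKernel b z) := by
  cases b
  · have h0 : z.im < 0 := lt_of_le_of_ne (by simpa [halfPlane] using hz) hz'
    have h := ((integrableOn_exp_mul_complex_Iic (a := I * z) (by simpa using h0) 0).mono_set
      Set.Iio_subset_Iic_self).const_mul (-I)
    refine ((integrable_indicator_iff measurableSet_Iio).2 h).congr
      (Eventually.of_forall fun x => ?_)
    by_cases hx : x < 0 <;> simp [sideKernel, hx]
  · have h0 : 0 < z.im := lt_of_le_of_ne (by simpa [halfPlane] using hz) hz'.symm
    have h := (integrableOn_exp_mul_complex_Ioi (a := I * z) (by simpa using h0) 0).const_mul I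
    refine ((integrable_indicator_iff measurableSet_Ioi).2 h).congr
      (Eventually.of_forall fun x => ?_)
    by_cases hx : 0 < x <;> simp [sideKernel, hx]

theorem integrable_sideConv_of_im {b : Bool} {z : ℂ} (hz : z ∈ halfPlane b) (hz' : z.im ≠ 0)
    {F : ℝ → ℂ} (hF : Integrable F) : Integrable (sideConv b z F) := by
  have := hF.integrable_convolution (ContinuousLinearMap.mul ℂ ℂ) (integrable_sideKernel hz hz')
  refine this.congr (Eventually.of_forall fun x => ?_)
  simp only [convolution_def, sideConv, ContinuousLinearMap.mul_apply']
  congr 1; funext y; ring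

theorem memLp_two_of_integrable_of_bound {f : ℝ → ℂ} (hf : Integrable f) {C : ℝ}
    (hC : ∀ x, ‖f x‖ ≤ C) : MemLp f 2 := by
  rw [memLp_two_iff_integrable_sq_norm hf.aestronglyMeasurable]
  refine (hf.norm.const_mul C).mono' (hf.aestronglyMeasurable.norm.pow 2)
    (Eventually.of_forall fun x => ?_)
  rw [Real.norm_of_nonneg (by positivity), sq]
  exact mul_le_mul_of_nonneg_right (hC x) (norm_nonneg _)

/-- A solution of the free equation which belongs to some `L^p` vanishes at infinity. -/
theorem FreeEq.tendsto_zero {t : ℝ} {φ F : ℝ → ℂ} (h : FreeEq t φ F) (hF : Integrable F)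
    {p : ℝ≥0∞} (hp0 : p ≠ 0) (hp : p ≠ ⊤) (hφ : MemLp φ p) :
    Tendsto φ atBot (𝓝 0) ∧ Tendsto φ atTop (𝓝 0) := by
  have hi : Integrable (fun y : ℝ => exp (-(I * t * y)) * F y) := by
    refine hF.bdd_mul (c := 1) (by fun_prop) (Eventually.of_forall fun y => ?_)
    simp [Complex.norm_exp]
  have hnorm : ∀ x : ℝ, ‖exp (-(I * t * x)) * φ x‖ = ‖φ x‖ := fun x => by
    simp [Complex.norm_exp]
  have hmeas : ∀ {c : ℝ} (hc : 0 < c), volume {x : ℝ | c ≤ ‖φ x‖} < ⊤ := by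
    intro c hc
    have := hφ.meas_ge_lt_top hp0 hp (ε := ⟨c, hc.le⟩) (by
      intro h; exact hc.ne' (congrArg NNReal.toReal h))
    exact this
  -- As `F` is integrable, the demodulated solution has a limit at each end. A nonzero limit would
  -- keep `‖φ‖` above a positive constant on a set of infinite measure, which membership in `L^p`
  -- forbids.
  have main : ∀ (l : Filter ℝ) (L : ℂ), Tendsto (fun x : ℝ => exp (-(I * t * x)) * φ x) l (𝓝 L) →
      (∀ s ∈ l, volume s = ⊤) → Tendsto φ l (𝓝 0) := by
    intro l L hL hs
    have hL0 : L = 0 := by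
      by_contra hne
      have hpos : 0 < ‖L‖ / 2 := by positivity
      have h1 : ∀ᶠ x in l, ‖L‖ / 2 ≤ ‖φ x‖ := by
        have := hL.norm.eventually (lt_mem_nhds (half_lt_self (norm_pos_iff.2 hne)))
        filter_upwards [this] with x hx
        rw [hnorm] at hx
        exact hx.le
      have h2 := hs _ h1
      have h3 := hmeas hpos
      exact absurd h2 h3.ne
    rw [hL0, tendsto_zero_iff_norm_tendsto_zero] at hL
    rw [tendsto_zero_iff_norm_tendsto_zero]
    exact hL.congr hnorm
  constructor
  · refine main atBot (exp (-(I * t * (0 : ℝ))) * φ 0 -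
      I * ∫ y in Set.Iic (0 : ℝ), exp (-(I * t * y)) * F y) ?_ ?_
    · refine (tendsto_const_nhds.sub ((intervalIntegral_tendsto_integral_Iic 0 hi.integrableOn
        tendsto_id).const_mul I)).congr fun a => ?_
      rw [id, ← h a 0]; ring
    · intro s hs
      obtain ⟨a, ha⟩ := mem_atBot_sets.1 hs
      exact top_unique (Real.volume_Iic (a := a) ▸ measure_mono ha)
  · refine main atTop (exp (-(I * t * (0 : ℝ))) * φ 0 +
      I * ∫ y in Set.Ioi (0 : ℝ), exp (-(I * t * y)) * F y) ?_ ?_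
    · refine (tendsto_const_nhds.add ((intervalIntegral_tendsto_integral_Ioi 0 hi.integrableOn
        tendsto_id).const_mul I)).congr fun a => ?_
      rw [id, ← h 0 a]; ring
    · intro s hs
      obtain ⟨a, ha⟩ := mem_atTop_sets.1 hs
      exact top_unique (Real.volume_Ici (a := a) ▸ measure_mono ha)

/-- After a shift to the real energy `2πξ` the solution still vanishes at both ends, so its new
source has no component at that frequency. Real `z` is allowed, as the Hardy property of bound
states requires. -/
theorem FreeEq.fourierIntegral_mul {z : ℂ} {φ F : ℝ → ℂ} (h : FreeEq z φ F) (hF : Integrable F)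
    (hφ : Integrable φ) (ξ : ℝ) :
    (2 * Real.pi * ξ - z) * ∫ x : ℝ, exp (-(2 * Real.pi * I * ξ * x)) * φ x =
      ∫ x : ℝ, exp (-(2 * Real.pi * I * ξ * x)) * F x := by
  have h1 := h.shift hF.locallyIntegrable ((2 * Real.pi * ξ : ℝ) : ℂ)
  have hi := hF.add (hφ.const_mul (z - ((2 * Real.pi * ξ : ℝ) : ℂ)))
  obtain ⟨h2, h3⟩ := h1.tendsto_zero hi one_ne_zero ENNReal.one_ne_top
    (memLp_one_iff_integrable.2 hφ)
  have h4 := h1.integral_eq_zero hi h2 h3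
  have hint : ∀ {f : ℝ → ℂ}, Integrable f →
      Integrable fun x : ℝ => exp (-(2 * Real.pi * I * ξ * x)) * f x := by
    intro f hf
    refine hf.bdd_mul (c := 1) (by fun_prop) (Eventually.of_forall fun y => ?_)
    simp [Complex.norm_exp]
  have h5 : ∫ x : ℝ, exp (-(I * ((2 * Real.pi * ξ : ℝ) : ℂ) * x)) *
      (F x + (z - ((2 * Real.pi * ξ : ℝ) : ℂ)) * φ x) =
      (∫ x : ℝ, exp (-(2 * Real.pi * I * ξ * x)) * F x) + (z - 2 * Real.pi * ξ) *
        ∫ x : ℝ, exp (-(2 * Real.pi * I * ξ * x)) * φ x := by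
    rw [← integral_const_mul, ← integral_add (hint hF) ((hint hφ).const_mul _)]
    congr 1; funext x
    have : exp (-(I * ((2 * Real.pi * ξ : ℝ) : ℂ) * x)) = exp (-(2 * Real.pi * I * ξ * x)) := by
      congr 1; push_cast; ring
    rw [this]; push_cast; ring
  rw [h5] at h4
  linear_combination -h4

/-- Functions with integrable Fourier transform are bounded. -/
theorem norm_le_of_integrable_fourier {f : L2} (hf : Integrable (𝓕 f : L2)) :
    ∀ᵐ x : ℝ, ‖f x‖ ≤ ∫ ξ, ‖(𝓕 f : L2) ξ‖ := by
  have hc : Continuous fun x : ℝ => ∫ ξ : ℝ, exp (2 * Real.pi * I * x * ξ) * (𝓕 f : L2) ξ := by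
    have := (continuous_fourierIntegral hf).comp continuous_neg
    refine this.congr fun x => ?_
    simp
  have h : f =ᵐ[volume] fun x : ℝ => ∫ ξ : ℝ, exp (2 * Real.pi * I * x * ξ) * (𝓕 f : L2) ξ := by
    refine ae_eq_of_forall_schwartz (locallyIntegrable_L2 f) hc.locallyIntegrable fun θ _ => ?_
    set Θ : SchwartzMap ℝ ℂ := 𝓕⁻ θ with hΘ
    have hθΘ : 𝓕 Θ = θ := FourierTransform.fourier_fourierInv_eq θ
    have hΘx : ∀ ξ : ℝ, Θ ξ = ∫ x : ℝ, exp (2 * Real.pi * I * x * ξ) * θ x := by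
      intro ξ
      rw [hΘ, SchwartzMap.fourierInv_coe, Real.fourierInv_eq']
      congr 1; funext x
      rw [smul_eq_mul]; congr 2; simp; ring
    conv_lhs => rw [← hθΘ]
    rw [← integral_mul_fourier]
    simp_rw [hΘx, ← integral_mul_const, ← integral_const_mul]
    rw [integral_integral_swap]
    · congr 1; funext y; congr 1; funext x
      ring
    · have := (hf.mul_prod (θ.integrable (μ := volume))).bdd_mul (c := 1)
        (f := fun p : ℝ × ℝ => exp (2 * Real.pi * I * p.2 * p.1))
        (by fun_prop)
        (Eventually.of_forall fun p => by simp [Complex.norm_exp])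
      refine this.congr (Eventually.of_forall fun p => ?_)
      simp [Function.uncurry]; ring
  filter_upwards [h] with x hx
  rw [hx]
  exact norm_integral_le_of_norm_le hf.norm
    (Eventually.of_forall fun ξ => by simp [Complex.norm_exp])

theorem eLpNorm_two_eq (f : ℝ → ℂ) :
    eLpNorm f 2 volume = (∫⁻ x, ‖f x‖ₑ ^ (2 : ℝ)) ^ (1 / 2 : ℝ) := by
  rw [eLpNorm_eq_lintegral_rpow_enorm_toReal (by norm_num) (by norm_num)]
  simp

theorem eLpNorm_fourier (f : L2) : eLpNorm (𝓕 f : L2) 2 volume = eLpNorm f 2 volume := by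
  have := Lp.norm_fourier_eq f
  rw [Lp.norm_def, Lp.norm_def] at this
  exact (ENNReal.toReal_eq_toReal_iff' (Lp.eLpNorm_ne_top _) (Lp.eLpNorm_ne_top _)).1 this

/-- The transform of `q̄ψ` at `ξ` is the inner product of `ψ` with `q` modulated by frequency `ξ`;
Plancherel turns it into a correlation of transforms. -/
theorem aemeasurable_integral_bound {q ψ g : L2} (hg : g =ᵐ[volume] fun x => conj (q x) * ψ x)
    (hg1 : Integrable g) :
    ∀ᵐ ξ : ℝ, ‖(𝓕 g : L2) ξ‖ₑ ≤ ∫⁻ η : ℝ, ‖(𝓕 q : L2) (η - ξ)‖ₑ * ‖(𝓕 ψ : L2) η‖ₑ := by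
  have h := fourier_toLp_ae_eq hg1 (Lp.memLp g)
  rw [Lp.toLp_coeFn] at h
  filter_upwards [h] with ξ hξ
  set a : L2 := (memLp_expMul (Lp.memLp q) (2 * Real.pi * ξ)).toLp _ with ha
  have e1 : ∫ x : ℝ, exp (-(2 * Real.pi * I * ξ * x)) * g x = inner ℂ a ψ := by
    rw [inner_eq_integral]
    refine integral_congr_ae ?_
    filter_upwards [(memLp_expMul (Lp.memLp q) (2 * Real.pi * ξ)).coeFn_toLp, hg] with x h1 h2
    rw [ha, h1, h2, map_mul, ← Complex.exp_conj]
    have : conj (I * ((2 * Real.pi * ξ : ℝ) : ℂ) * x) = -(2 * Real.pi * I * ξ * x) := by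
      simp only [map_mul, conj_I, conj_ofReal]; push_cast; ring
    rw [this]; ring
  rw [hξ, e1, ← Lp.inner_fourier_eq, inner_eq_integral]
  refine (enorm_integral_le_lintegral_enorm _).trans (lintegral_mono_ae ?_)
  filter_upwards [fourier_modulation q ξ] with η h1
  rw [ha, h1, enorm_mul]
  simp

/-- `C₊ q̄ (L₀ - iκ)⁻¹` maps `L²` to `L^∞`. -/
theorem norm_szego_le_of_hardy {q : L2} (hq : q ∈ hardySpace) {κ : ℝ} (hκ : 0 < κ) {χ : ℝ → ℂ}
    (hχ1 : Integrable χ) (hχ2 : MemLp χ 2) {g : L2}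
    (hg : g =ᵐ[volume] fun x => conj (q x) * sideConv true (I * κ) χ x) :
    ∀ᵐ x : ℝ, ‖szego g x‖ₑ ≤ 2 * (eLpNorm χ 2 volume * eLpNorm q 2 volume) := by
  have hz : I * κ ∈ halfPlane true := by simpa [halfPlane] using hκ.le
  have hz' : (I * κ : ℂ).im ≠ 0 := by simpa using hκ.ne'
  set ψ := sideConv true (I * κ) χ with hψ
  have hψ1 : Integrable ψ := integrable_sideConv_of_im hz hz' hχ1
  have hψ2 : MemLp ψ 2 :=
    memLp_two_of_integrable_of_bound hψ1 (norm_sideConv_le hz hχ1)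
  have hg1 : Integrable g :=
    (integrable_mul_of_memLp_two (memLp_conj (Lp.memLp q)) hψ2).congr hg.symm
  have hψL := fourier_toLp_ae_eq hψ1 hψ2
  have hχL := fourier_toLp_ae_eq hχ1 hχ2
  -- The symbol of `L₀ - iκ` satisfies `|2πη - iκ| ≥ 2πη ≥ η`, which supplies the factor `1/η` of
  -- Hardy's inequality.
  have hψχ : ∀ᵐ η : ℝ, 0 < η → ‖(𝓕 (hψ2.toLp ψ) : L2) η‖ₑ ≤
      ‖(𝓕 (hχ2.toLp χ) : L2) η‖ₑ * (ENNReal.ofReal η)⁻¹ := by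
    filter_upwards [hψL, hχL] with η h1 h2 hη
    have h3 := (freeEq_sideConv hz hχ1).fourierIntegral_mul hχ1 hψ1 η
    rw [← h1, ← h2] at h3
    rw [← h3, enorm_mul, ← div_eq_mul_inv, ENNReal.le_div_iff_mul_le
      (Or.inl (by simpa using hη)) (Or.inl ENNReal.ofReal_ne_top), mul_comm]
    gcongr
    rw [← ofReal_norm]
    refine ENNReal.ofReal_le_ofReal ?_
    have h4 := Complex.abs_re_le_norm (2 * Real.pi * η - I * κ : ℂ)
    have h5 : (2 * Real.pi * η - I * κ : ℂ).re = 2 * Real.pi * η := by simp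
    rw [h5, abs_of_pos (by positivity)] at h4
    nlinarith [Real.pi_gt_three]
  have hgb := aemeasurable_integral_bound (q := q) (ψ := hψ2.toLp ψ) (g := g)
    (by
      filter_upwards [hg, hψ2.coeFn_toLp] with x h1 h2
      rw [h1, h2]) hg1
  set a : ℝ → ℝ≥0∞ := fun η => ‖(𝓕 (hχ2.toLp χ) : L2) η‖ₑ with ha
  set b : ℝ → ℝ≥0∞ := fun η => ‖(𝓕 q : L2) η‖ₑ with hb
  set c : ℝ → ℝ≥0∞ := fun η => ‖(𝓕 (hψ2.toLp ψ) : L2) η‖ₑ with hc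
  have ham : Measurable a := (Lp.stronglyMeasurable _).measurable.enorm
  have hbm : Measurable b := (Lp.stronglyMeasurable _).measurable.enorm
  have hcm : Measurable c := (Lp.stronglyMeasurable _).measurable.enorm
  have hb0 : ∀ᵐ ζ : ℝ, ζ < 0 → b ζ = 0 := by
    filter_upwards [mem_hardySpace_iff.1 hq] with ζ h1 h2
    simp [hb, h1 h2]
  have hB : ∀ η, ∫⁻ ζ in Set.Iic η, b ζ = ∫⁻ ζ in Set.Ioc 0 η, b ζ := by
    intro η
    rw [← lintegral_indicator measurableSet_Iic, ← lintegral_indicator measurableSet_Ioc]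
    refine lintegral_congr_ae ?_
    filter_upwards [hb0, compl_mem_ae_iff.2 (measure_singleton (μ := volume) (0 : ℝ))] with ζ h1 h2
    have h2' : ζ ≠ 0 := h2
    by_cases h : ζ < 0
    · simp [Set.indicator, h1 h]
    · have : 0 < ζ := lt_of_le_of_ne (not_lt.1 h) (Ne.symm h2')
      simp [Set.indicator, this]
  -- The sup norm is controlled by the `L¹` norm of the transform. After Tonelli, `ζ = η - ξ` with
  -- `ξ ≥ 0` ranges over `ζ ≤ η`, and the Hardy property of `q` leaves only `0 < ζ ≤ η`.
  have hF : ∫⁻ ξ, ‖(𝓕 (szego g) : L2) ξ‖ₑ ≤ 2 * (eLpNorm χ 2 volume * eLpNorm q 2 volume) := by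
    calc ∫⁻ ξ, ‖(𝓕 (szego g) : L2) ξ‖ₑ = ∫⁻ ξ in Set.Ici (0 : ℝ), ‖(𝓕 g : L2) ξ‖ₑ := by
          rw [← lintegral_indicator measurableSet_Ici]
          refine lintegral_congr_ae ?_
          filter_upwards [fourier_szego g] with ξ h1
          rw [h1]
          by_cases h : ξ ∈ Set.Ici (0 : ℝ) <;> simp only [Set.indicator_of_mem,
            Set.indicator_of_notMem, h, not_false_eq_true, enorm_zero]
      _ ≤ ∫⁻ ξ in Set.Ici (0 : ℝ), ∫⁻ η : ℝ, b (η - ξ) * c η :=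
          lintegral_mono_ae (ae_restrict_of_ae hgb)
      _ = ∫⁻ η : ℝ, ∫⁻ ξ in Set.Ici (0 : ℝ), b (η - ξ) * c η := by
          rw [lintegral_lintegral_swap (by fun_prop)]
      _ = ∫⁻ η : ℝ, c η * ∫⁻ ζ in Set.Ioc 0 η, b ζ := by
          congr 1; funext η
          rw [lintegral_mul_const (c η) (f := fun ξ => b (η - ξ)) (by fun_prop), mul_comm, ← hB,
            ← lintegral_indicator measurableSet_Ici, ← lintegral_indicator measurableSet_Iic,
            ← lintegral_sub_left_eq_self ((Set.Iic η).indicator b) η]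
          congr 2; funext ξ
          simp [Set.indicator]
      _ = ∫⁻ η in Set.Ioi (0 : ℝ), c η * ∫⁻ ζ in Set.Ioc 0 η, b ζ := by
          rw [← lintegral_indicator measurableSet_Ioi]
          congr 1; funext η
          by_cases h : 0 < η
          · simp [Set.indicator, h]
          · simp [Set.indicator, h]
      _ ≤ ∫⁻ η in Set.Ioi (0 : ℝ), a η * ((ENNReal.ofReal η)⁻¹ * ∫⁻ ζ in Set.Ioc 0 η, b ζ) := by
          refine lintegral_mono_ae ((ae_restrict_iff' measurableSet_Ioi).2 ?_)
          filter_upwards [hψχ] with η h1 h2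
          rw [← mul_assoc]
          exact mul_le_mul_left (h1 h2) _
      _ ≤ _ := by
          refine (lintegral_hardy ham hbm).trans_eq ?_
          rw [← eLpNorm_two_eq, ← eLpNorm_two_eq, eLpNorm_fourier, eLpNorm_fourier,
            eLpNorm_congr_ae hχ2.coeFn_toLp]
  have htop : 2 * (eLpNorm χ 2 volume * eLpNorm q 2 volume) < ⊤ :=
    ENNReal.mul_lt_top (by norm_num) (ENNReal.mul_lt_top hχ2.2 (Lp.eLpNorm_lt_top q))
  have hFi : Integrable (𝓕 (szego g) : L2) :=
    ⟨Lp.aestronglyMeasurable _, hF.trans_lt htop⟩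
  filter_upwards [norm_le_of_integrable_fourier hFi] with x hx
  refine le_trans ?_ hF
  rw [← ofReal_integral_norm_eq_lintegral_enorm hFi, ← ofReal_norm]
  exact ENNReal.ofReal_le_ofReal hx

theorem lintegral_sq_sideKernel {κ : ℝ} (hκ : 0 < κ) :
    ∫⁻ x, ‖sideKernel true (I * κ) x‖ₑ ^ (2 : ℝ) = ENNReal.ofReal (1 / (2 * κ)) := by
  have h1 : ∀ x : ℝ, ‖sideKernel true (I * κ) x‖ₑ ^ (2 : ℝ) =
      (Set.Ioi (0 : ℝ)).indicator (fun x => ENNReal.ofReal (Real.exp (-(2 * κ) * x))) x := by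
    intro x
    by_cases hx : 0 < x
    · have : (I * (I * κ) * x : ℂ) = ((-κ * x : ℝ) : ℂ) := by
        push_cast; linear_combination (κ * x : ℂ) * I_mul_I
      simp only [sideKernel, hx, if_true, Set.indicator, Set.mem_Ioi]
      rw [this, enorm_mul, ← ofReal_norm (I), norm_I, ENNReal.ofReal_one, one_mul,
        ← ofReal_norm, Complex.norm_exp, ofReal_re, ENNReal.ofReal_rpow_of_pos (Real.exp_pos _),
        ← Real.exp_mul]
      congr 2; ring
    · simp [sideKernel, hx]
  simp_rw [h1]
  rw [lintegral_indicator measurableSet_Ioi, ← ofReal_integral_eq_lintegral_ofReal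
    (_root_.integrableOn_exp_mul_Ioi (a := -(2 * κ)) (by linarith) 0) (Eventually.of_forall fun x => (Real.exp_pos _).le),
    integral_exp_mul_Ioi (a := -(2 * κ)) (by linarith) 0]
  congr 1
  simp
  
theorem enorm_sideConv_le_eLpNorm {κ : ℝ} (hκ : 0 < κ) {χ : ℝ → ℂ} (hχ : MemLp χ 2) (x : ℝ) :
    ‖sideConv true (I * κ) χ x‖ₑ ≤
      ENNReal.ofReal (1 / (2 * κ)) ^ (1 / 2 : ℝ) * eLpNorm χ 2 volume := by
  refine (enorm_integral_le_lintegral_enorm _).trans ?_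
  simp_rw [enorm_mul]
  refine (ENNReal.lintegral_mul_le_Lp_mul_Lq volume Real.HolderConjugate.two_two
    (((measurable_sideKernel _ _).comp (measurable_const.sub measurable_id)).enorm.aemeasurable)
    hχ.1.enorm).trans_eq ?_
  rw [← eLpNorm_two_eq χ]
  congr 2
  rw [← lintegral_sq_sideKernel hκ]
  exact lintegral_sub_left_eq_self (μ := volume) (fun y => ‖sideKernel true (I * κ) y‖ₑ ^ (2 : ℝ)) x

theorem eLpNorm_szego_le (g : L2) : eLpNorm (szego g) 2 volume ≤ eLpNorm g 2 volume := by
  have := norm_szego_le g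
  rw [Lp.norm_def, Lp.norm_def] at this
  exact (ENNReal.toReal_le_toReal (Lp.eLpNorm_ne_top _) (Lp.eLpNorm_ne_top _)).1 this

/-- For large `κ` the operator `q C₊ q̄ (L₀ - iκ)⁻¹` is a contraction on `L²`. -/
theorem eventually_eLpNorm_le {q : L2} (hq : q ∈ hardySpace) :
    ∀ᶠ κ : ℝ in atTop, 0 < κ ∧ ∀ χ : ℝ → ℂ, Integrable χ → MemLp χ 2 → ∀ g : L2,
      g =ᵐ[volume] (fun x => conj (q x) * sideConv true (I * κ) χ x) →
      eLpNorm (fun x => q x * szego g x) 2 volume ≤ 2⁻¹ * eLpNorm χ 2 volume := by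
  set Q := eLpNorm q 2 volume with hQ
  have hQt : Q ≠ ⊤ := Lp.eLpNorm_ne_top q
  -- Split `q` at height `M`. Its large part has small `L²` norm and meets the sup bound for `C₊g`;
  -- the constant is chosen so that `2Q / (8(Q + 1)) ≤ 1/4`. Its bounded part meets the `L²` norm of
  -- `C₊g`, which is small for large `κ`.
  obtain ⟨M, hM0, hM⟩ := (Lp.memLp q).eLpNorm_indicator_norm_ge_pos_le (Lp.stronglyMeasurable q)
    (ε := 1 / (8 * (Q.toReal + 1))) (by positivity)
  -- The factor `(2κ)^{-1/2}` is the `L²` norm of the resolvent kernel at energy `iκ`.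
  have hsm : ∀ᶠ κ : ℝ in atTop, ENNReal.ofReal M *
      (ENNReal.ofReal (1 / (2 * κ)) ^ (1 / 2 : ℝ) * Q) < 4⁻¹ := by
    have h1 : Tendsto (fun κ : ℝ => 1 / (2 * κ)) atTop (𝓝 0) :=
      tendsto_const_nhds.div_atTop (tendsto_id.const_mul_atTop (by norm_num : (0 : ℝ) < 2))
    have h2 : Tendsto (fun κ : ℝ => ENNReal.ofReal (1 / (2 * κ)) ^ (1 / 2 : ℝ)) atTop (𝓝 0) := by
      have := (ENNReal.continuous_rpow_const (y := (1 / 2 : ℝ))).tendsto 0 |>.comp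
        (ENNReal.tendsto_ofReal h1 |>.trans_eq (by simp))
      simpa [Function.comp_def] using this
    have h3 : Tendsto (fun κ : ℝ => ENNReal.ofReal M *
        (ENNReal.ofReal (1 / (2 * κ)) ^ (1 / 2 : ℝ) * Q)) atTop (𝓝 0) := by
      have := ENNReal.Tendsto.const_mul (a := ENNReal.ofReal M)
        (ENNReal.Tendsto.mul_const (b := Q) h2 (Or.inr hQt)) (Or.inr ENNReal.ofReal_ne_top)
      simpa using this
    exact h3.eventually (gt_mem_nhds (by simp))
  filter_upwards [hsm, eventually_gt_atTop 0] with κ hκ hκ0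
  refine ⟨hκ0, fun χ hχ1 hχ2 g hg => ?_⟩
  set X := eLpNorm χ 2 volume with hX
  set S : Set ℝ := {x | M ≤ ‖q x‖₊} with hS
  have hinf := norm_szego_le_of_hardy hq hκ0 hχ1 hχ2 hg
  have hg2 : eLpNorm g 2 volume ≤ ENNReal.ofReal (1 / (2 * κ)) ^ (1 / 2 : ℝ) * X * Q := by
    rw [eLpNorm_congr_ae hg]
    refine eLpNorm_le_mul_eLpNorm_of_ae_le_mul'' 2 (Lp.aestronglyMeasurable q)
      (Eventually.of_forall fun x => ?_)
    rw [enorm_mul, mul_comm, RCLike.enorm_conj]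
    exact mul_le_mul_left (enorm_sideConv_le_eLpNorm hκ0 hχ2 x) _
  have hSm : MeasurableSet S :=
    measurableSet_le measurable_const (Lp.stronglyMeasurable q).norm.measurable
  have e : (fun x => q x * szego g x) =
      (fun x => S.indicator q x * szego g x) + fun x => Sᶜ.indicator q x * szego g x := by
    funext x
    by_cases h : x ∈ S <;> simp [h]
  have hfm := Lp.aestronglyMeasurable (szego g)
  have hq1 := (Lp.aestronglyMeasurable q).indicator hSm
  have hq2 := (Lp.aestronglyMeasurable q).indicator hSm.compl
  have b1 : eLpNorm (fun x => S.indicator q x * szego g x) 2 volume ≤ 4⁻¹ * X := by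
    refine (eLpNorm_le_mul_eLpNorm_of_ae_le_mul'' (c := 2 * (X * Q)) 2 hq1 ?_).trans ?_
    · filter_upwards [hinf] with x hx
      rw [enorm_mul, mul_comm]
      exact mul_le_mul_left hx _
    · calc 2 * (X * Q) * eLpNorm (S.indicator q) 2 volume
          ≤ 2 * (X * Q) * ENNReal.ofReal (1 / (8 * (Q.toReal + 1))) := mul_le_mul_right hM _
        _ = (2 * Q * ENNReal.ofReal (1 / (8 * (Q.toReal + 1)))) * X := by ring
        _ ≤ 4⁻¹ * X := by
          refine mul_le_mul_left ?_ _
          have hQ0 : 0 ≤ Q.toReal := ENNReal.toReal_nonneg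
          rw [← ENNReal.ofReal_toReal hQt, show (2 : ℝ≥0∞) = ENNReal.ofReal 2 by simp,
            ← ENNReal.ofReal_mul (by norm_num), ENNReal.toReal_ofReal hQ0,
            ← ENNReal.ofReal_mul (by positivity),
            show (4⁻¹ : ℝ≥0∞) = ENNReal.ofReal 4⁻¹ by
              rw [ENNReal.ofReal_inv_of_pos (by norm_num)]; simp]
          refine ENNReal.ofReal_le_ofReal ?_
          rw [mul_one_div, div_le_iff₀ (by positivity)]
          linarith
  have b2 : eLpNorm (fun x => Sᶜ.indicator q x * szego g x) 2 volume ≤ 4⁻¹ * X := by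
    refine (eLpNorm_le_mul_eLpNorm_of_ae_le_mul'' (c := ENNReal.ofReal M) 2 hfm
      (Eventually.of_forall fun x => ?_)).trans ?_
    · rw [enorm_mul]
      refine mul_le_mul_left ?_ _
      by_cases h : x ∈ S
      · simp [h]
      · rw [Set.indicator_of_mem (by simpa using h), ← ofReal_norm]
        refine ENNReal.ofReal_le_ofReal ?_
        have : ¬ M ≤ ‖q x‖ := h
        exact (not_le.1 this).le
    · calc ENNReal.ofReal M * eLpNorm (szego g) 2 volume
          ≤ ENNReal.ofReal M * (ENNReal.ofReal (1 / (2 * κ)) ^ (1 / 2 : ℝ) * X * Q) :=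
            mul_le_mul_right ((eLpNorm_szego_le g).trans hg2) _
        _ = (ENNReal.ofReal M * (ENNReal.ofReal (1 / (2 * κ)) ^ (1 / 2 : ℝ) * Q)) * X := by ring
        _ ≤ 4⁻¹ * X := mul_le_mul_left hκ.le _
  rw [e]
  refine (eLpNorm_add_le (hq1.mul hfm) (hq2.mul hfm) (by norm_num)).trans ((add_le_add b1 b2).trans_eq ?_)
  rw [← add_mul]
  congr 1
  have : (4⁻¹ : ℝ≥0∞) = 2⁻¹ * 2⁻¹ := by
    rw [← ENNReal.mul_inv (by simp) (by simp)]; norm_num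
  rw [this, ← mul_add, ENNReal.inv_two_add_inv_two, mul_one]

/-! ### Integral operators with bounded kernels -/

theorem coeFn_mulToL1 (q f : L2) : mulToL1 q f =ᵐ[volume] fun x => q x * f x :=
  ContinuousLinearMap.coeFn_holder _ q f

theorem coeFn_conjMulToL2 (q : L2) (φ : LInf) :
    conjMulToL2 q φ =ᵐ[volume] fun x => conj (q x) * φ x := by
  have h := ContinuousLinearMap.coeFn_holder (r := 2) (ContinuousLinearMap.mul ℂ ℂ)
    (star q) φ
  have h2 : ((star q : L2) : ℝ → ℂ) =ᵐ[volume] fun x => conj (q x) := Lp.coeFn_star q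
  refine h.trans ?_
  filter_upwards [h2] with x hx
  rw [hx]; rfl

/-- Jointly measurable kernels bounded by one. -/
structure IsBoundedKernel (K : ℝ → ℝ → ℂ) : Prop where
  measurable : Measurable (Function.uncurry K)
  norm_le : ∀ x y, ‖K x y‖ ≤ 1

/-- The integral of `f` against the kernel `K`. -/
def kernelConv (K : ℝ → ℝ → ℂ) (f : ℝ → ℂ) (x : ℝ) : ℂ := ∫ y, K x y * f y

theorem IsBoundedKernel.integrable {K : ℝ → ℝ → ℂ} (hK : IsBoundedKernel K) {f : ℝ → ℂ}
    (hf : Integrable f) (x : ℝ) : Integrable (fun y => K x y * f y) :=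
  hf.bdd_mul (c := 1) (hK.measurable.comp measurable_prodMk_left).aestronglyMeasurable
    (Eventually.of_forall fun y => hK.norm_le x y)

theorem IsBoundedKernel.norm_kernelConv_le {K : ℝ → ℝ → ℂ} (hK : IsBoundedKernel K) (f : L1)
    (x : ℝ) : ‖kernelConv K f x‖ ≤ ‖f‖ := by
  rw [L1.norm_eq_integral_norm]
  refine norm_integral_le_of_norm_le (L1.integrable_coeFn f).norm
    (Eventually.of_forall fun y => ?_)
  rw [norm_mul]
  exact mul_le_of_le_one_left (norm_nonneg _) (hK.norm_le _ _)

theorem IsBoundedKernel.memLp_kernelConv {K : ℝ → ℝ → ℂ} (hK : IsBoundedKernel K) (f : L1) :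
    MemLp (kernelConv K f) ∞ (volume : Measure ℝ) := by
  refine memLp_top_of_bound ?_ ‖f‖ (Eventually.of_forall (hK.norm_kernelConv_le f))
  have h : AEStronglyMeasurable (fun p : ℝ × ℝ => Function.uncurry K p * f p.2)
      ((volume : Measure ℝ).prod volume) :=
    hK.measurable.aestronglyMeasurable.mul (Lp.aestronglyMeasurable f).comp_snd
  exact h.integral_prod_right'

/-- The integral operator from `L¹` to `L^∞` with a bounded kernel. -/
def IsBoundedKernel.op {K : ℝ → ℝ → ℂ} (hK : IsBoundedKernel K) : L1 →L[ℂ] LInf :=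
  LinearMap.mkContinuous
    { toFun := fun f => (hK.memLp_kernelConv f).toLp
      map_add' := by
        intro f g
        rw [← MemLp.toLp_add]
        refine MemLp.toLp_congr _ _ (Eventually.of_forall fun x => ?_)
        simp only [Pi.add_apply, kernelConv]
        rw [← integral_add (hK.integrable (L1.integrable_coeFn f) x)
          (hK.integrable (L1.integrable_coeFn g) x)]
        refine integral_congr_ae ?_
        filter_upwards [Lp.coeFn_add f g] with y hy
        rw [hy, Pi.add_apply, mul_add]
      map_smul' := by
        intro c f
        rw [RingHom.id_apply, ← MemLp.toLp_const_smul]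
        refine MemLp.toLp_congr _ _ (Eventually.of_forall fun x => ?_)
        simp only [Pi.smul_apply, kernelConv, smul_eq_mul]
        rw [← integral_const_mul]
        refine integral_congr_ae ?_
        filter_upwards [Lp.coeFn_smul c f] with y hy
        rw [hy, Pi.smul_apply, smul_eq_mul]
        ring }
    1 (by
      intro f
      rw [one_mul]
      change ‖(hK.memLp_kernelConv f).toLp‖ ≤ ‖f‖
      rw [Lp.norm_toLp, eLpNorm_exponent_top]
      exact ENNReal.toReal_le_of_le_ofReal (norm_nonneg f)
        (eLpNormEssSup_le_of_ae_bound (Eventually.of_forall (hK.norm_kernelConv_le f))))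

theorem IsBoundedKernel.coeFn_op {K : ℝ → ℝ → ℂ} (hK : IsBoundedKernel K) (f : L1) :
    hK.op f =ᵐ[volume] kernelConv K f :=
  (hK.memLp_kernelConv f).coeFn_toLp

/-- The operator `C₊ q̄ M q C₊`. -/
def sandwich (q : L2) (M : L1 →L[ℂ] LInf) : L2 →L[ℂ] L2 :=
  szego ∘L conjMulToL2 q ∘L M ∘L mulToL1 q ∘L szego

/-- The square of the Hilbert–Schmidt norm of `q̄ K q`. -/
def hsSq (q : L2) (K : ℝ → ℝ → ℂ) : ℝ≥0∞ :=
  ∫⁻ x, ‖q x‖ₑ ^ (2 : ℝ) * ∫⁻ y, ‖K x y‖ₑ ^ (2 : ℝ) * ‖q y‖ₑ ^ (2 : ℝ)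

theorem enorm_integral_mul_le {K : ℝ → ℝ → ℂ} (hK : Measurable (Function.uncurry K)) (q g : L2)
    (x : ℝ) : ‖∫ y, K x y * (q y * g y)‖ₑ ^ (2 : ℝ) ≤
      (∫⁻ y, ‖K x y‖ₑ ^ (2 : ℝ) * ‖q y‖ₑ ^ (2 : ℝ)) * eLpNorm g 2 volume ^ (2 : ℝ) := by
  have h1 : ‖∫ y, K x y * (q y * g y)‖ₑ ≤
      (∫⁻ y, ‖K x y‖ₑ ^ (2 : ℝ) * ‖q y‖ₑ ^ (2 : ℝ)) ^ (1 / 2 : ℝ) * eLpNorm g 2 volume := by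
    refine (enorm_integral_le_lintegral_enorm _).trans ?_
    simp_rw [← mul_assoc, enorm_mul]
    refine (ENNReal.lintegral_mul_le_Lp_mul_Lq volume Real.HolderConjugate.two_two
      (f := fun y => ‖K x y‖ₑ * ‖q y‖ₑ)
      ((hK.comp measurable_prodMk_left).enorm.aemeasurable.mul
        (Lp.aestronglyMeasurable q).enorm) (Lp.aestronglyMeasurable g).enorm).trans_eq ?_
    rw [← eLpNorm_two_eq]
    simp_rw [ENNReal.mul_rpow_of_nonneg _ _ (zero_le_two : (0 : ℝ) ≤ 2)]
  refine (ENNReal.rpow_le_rpow h1 zero_le_two).trans_eq ?_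
  rw [ENNReal.mul_rpow_of_nonneg _ _ zero_le_two, ← ENNReal.rpow_mul]
  norm_num

/-- The projections are contractions, so the Hilbert–Schmidt norm of `q̄(K - K')q` dominates. The
two factors `q` make this finite for bounded kernels and turn pointwise convergence of kernels into
norm convergence. -/
theorem norm_sandwich_sub_le {q : L2} {K K' : ℝ → ℝ → ℂ} (hK : IsBoundedKernel K)
    (hK' : IsBoundedKernel K') (hfin : hsSq q (fun x y => K x y - K' x y) ≠ ⊤) :
    ‖sandwich q hK.op - sandwich q hK'.op‖ ≤
      (hsSq q (fun x y => K x y - K' x y) ^ (1 / 2 : ℝ)).toReal := by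
  refine ContinuousLinearMap.opNorm_le_bound _ ENNReal.toReal_nonneg fun f => ?_
  set g : L2 := szego f with hg
  set u : L1 := mulToL1 q g with hu
  have e : (sandwich q hK.op - sandwich q hK'.op) f =
      szego (conjMulToL2 q (hK.op u) - conjMulToL2 q (hK'.op u)) := by
    rw [map_sub]; rfl
  rw [e]
  refine (norm_szego_le _).trans ?_
  have hui : Integrable u := L1.integrable_coeFn u
  have hcoe : (conjMulToL2 q (hK.op u) - conjMulToL2 q (hK'.op u) : L2) =ᵐ[volume]
      fun x => conj (q x) * ∫ y, (K x y - K' x y) * (q y * g y) := by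
    filter_upwards [Lp.coeFn_sub (conjMulToL2 q (hK.op u)) (conjMulToL2 q (hK'.op u)),
      coeFn_conjMulToL2 q (hK.op u), coeFn_conjMulToL2 q (hK'.op u), hK.coeFn_op u,
      hK'.coeFn_op u] with x h1 h2 h3 h4 h5
    rw [h1, Pi.sub_apply, h2, h3, h4, h5, ← mul_sub]
    congr 1
    rw [kernelConv, kernelConv, ← integral_sub (hK.integrable hui x) (hK'.integrable hui x)]
    refine integral_congr_ae ?_
    filter_upwards [coeFn_mulToL1 q g] with y hy
    rw [hu, hy]; ring
  have hD : Measurable (Function.uncurry fun x y => K x y - K' x y) :=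
    hK.measurable.sub hK'.measurable
  have hle : eLpNorm (conjMulToL2 q (hK.op u) - conjMulToL2 q (hK'.op u) : L2) 2 volume ≤
      hsSq q (fun x y => K x y - K' x y) ^ (1 / 2 : ℝ) * eLpNorm g 2 volume := by
    rw [eLpNorm_congr_ae hcoe, eLpNorm_two_eq]
    calc _ ≤ (∫⁻ x, (‖q x‖ₑ ^ (2 : ℝ) * ∫⁻ y, ‖K x y - K' x y‖ₑ ^ (2 : ℝ) * ‖q y‖ₑ ^ (2 : ℝ)) *
          eLpNorm g 2 volume ^ (2 : ℝ)) ^ (1 / 2 : ℝ) := by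
          refine ENNReal.rpow_le_rpow (lintegral_mono fun x => ?_) (by norm_num)
          rw [enorm_mul, RCLike.enorm_conj, ENNReal.mul_rpow_of_nonneg _ _ zero_le_two, mul_assoc]
          exact mul_le_mul_right (enorm_integral_mul_le hD q g x) _
      _ = _ := by
          rw [lintegral_mul_const' _ _ (ENNReal.rpow_ne_top_of_nonneg zero_le_two
            (Lp.eLpNorm_ne_top g)), ENNReal.mul_rpow_of_nonneg _ _ (by norm_num),
            ← ENNReal.rpow_mul]
          norm_num [hsSq]
  have hne : hsSq q (fun x y => K x y - K' x y) ^ (1 / 2 : ℝ) ≠ ⊤ :=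
    ENNReal.rpow_ne_top_of_nonneg (by norm_num) hfin
  rw [Lp.norm_def]
  refine (ENNReal.toReal_mono (ENNReal.mul_ne_top hne (Lp.eLpNorm_ne_top g)) hle).trans ?_
  rw [ENNReal.toReal_mul, ← Lp.norm_def]
  exact mul_le_mul_of_nonneg_left (norm_szego_le f) ENNReal.toReal_nonneg

theorem lintegral_sq_ne_top (q : L2) : ∫⁻ y, ‖q y‖ₑ ^ (2 : ℝ) ≠ ⊤ := by
  intro h
  have := eLpNorm_two_eq q
  rw [h] at this
  exact Lp.eLpNorm_ne_top q (by rw [this]; simp)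

theorem enorm_rpow_two_le_four {w : ℂ} (hw : ‖w‖ ≤ 2) : ‖w‖ₑ ^ (2 : ℝ) ≤ 4 := by
  have h : ‖w‖ₑ ≤ 2 := by
    rw [← ofReal_norm]
    exact (ENNReal.ofReal_le_ofReal hw).trans_eq (by simp)
  refine (ENNReal.rpow_le_rpow h zero_le_two).trans_eq ?_
  rw [show (2 : ℝ) = ((2 : ℕ) : ℝ) by norm_num, ENNReal.rpow_natCast]
  norm_num

/-- Dominated convergence for the kernels gives convergence in operator norm. -/
theorem tendsto_hsSq {ι : Type*} {l : Filter ι} [l.IsCountablyGenerated] (q : L2)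
    {D : ι → ℝ → ℝ → ℂ} (hm : ∀ᶠ i in l, Measurable (Function.uncurry (D i)))
    (hb : ∀ᶠ i in l, ∀ x y, ‖D i x y‖ ≤ 2)
    (h : ∀ x, ∀ᵐ y, Tendsto (fun i => D i x y) l (𝓝 0)) :
    Tendsto (fun i => hsSq q (D i)) l (𝓝 0) := by
  have hqm : Measurable fun y => ‖q y‖ₑ ^ (2 : ℝ) :=
    (Lp.stronglyMeasurable q).measurable.enorm.pow_const _
  have hmi : ∀ᶠ i in l, Measurable fun p : ℝ × ℝ =>
      ‖D i p.1 p.2‖ₑ ^ (2 : ℝ) * ‖q p.2‖ₑ ^ (2 : ℝ) := by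
    filter_upwards [hm] with i hi
    exact (hi.enorm.pow_const _).mul (hqm.comp measurable_snd)
  have hbi : ∀ᶠ i in l, ∀ x y, ‖D i x y‖ₑ ^ (2 : ℝ) * ‖q y‖ₑ ^ (2 : ℝ) ≤
      4 * ‖q y‖ₑ ^ (2 : ℝ) := by
    filter_upwards [hb] with i hi x y
    exact mul_le_mul_left (enorm_rpow_two_le_four (hi x y)) _
  have hQ : ∫⁻ y, 4 * ‖q y‖ₑ ^ (2 : ℝ) ≠ ⊤ := by
    rw [lintegral_const_mul _ hqm]
    exact ENNReal.mul_ne_top (by norm_num) (lintegral_sq_ne_top q)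
  have hz : Tendsto (fun w : ℂ => ‖w‖ₑ ^ (2 : ℝ)) (𝓝 0) (𝓝 0) := by
    have := ((ENNReal.continuous_rpow_const (y := (2 : ℝ))).comp continuous_enorm).tendsto (0 : ℂ)
    simpa [Function.comp_def] using this
  have inner : ∀ x, Tendsto (fun i => ∫⁻ y, ‖D i x y‖ₑ ^ (2 : ℝ) * ‖q y‖ₑ ^ (2 : ℝ)) l (𝓝 0) := by
    intro x
    have := tendsto_lintegral_filter_of_dominated_convergence (μ := volume) (l := l)
      (F := fun i y => ‖D i x y‖ₑ ^ (2 : ℝ) * ‖q y‖ₑ ^ (2 : ℝ)) (f := fun _ => 0)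
      (fun y => 4 * ‖q y‖ₑ ^ (2 : ℝ)) (hmi.mono fun i hi => hi.comp measurable_prodMk_left)
      (hbi.mono fun i hi => Eventually.of_forall fun y => hi x y) hQ ?_
    · simpa using this
    · filter_upwards [h x] with y hy
      have := ENNReal.Tendsto.mul_const (b := ‖q y‖ₑ ^ (2 : ℝ)) (hz.comp hy)
        (Or.inr (ENNReal.rpow_ne_top_of_nonneg zero_le_two enorm_ne_top))
      simpa [Function.comp_def] using this
  have := tendsto_lintegral_filter_of_dominated_convergence (μ := volume) (l := l)
    (F := fun i x => ‖q x‖ₑ ^ (2 : ℝ) * ∫⁻ y, ‖D i x y‖ₑ ^ (2 : ℝ) * ‖q y‖ₑ ^ (2 : ℝ))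
    (f := fun _ => 0) (fun x => ‖q x‖ₑ ^ (2 : ℝ) * ∫⁻ y, 4 * ‖q y‖ₑ ^ (2 : ℝ))
    (hmi.mono fun i hi => hqm.mul hi.lintegral_prod_right')
    (hbi.mono fun i hi => Eventually.of_forall fun x =>
      mul_le_mul_right (lintegral_mono fun y => hi x y) _) ?_ ?_
  · simpa [hsSq] using this
  · rw [lintegral_mul_const _ hqm]
    exact ENNReal.mul_ne_top (lintegral_sq_ne_top q) hQ
  · refine Eventually.of_forall fun x => ?_
    have := ENNReal.Tendsto.const_mul (a := ‖q x‖ₑ ^ (2 : ℝ)) (inner x)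
      (Or.inr (ENNReal.rpow_ne_top_of_nonneg zero_le_two enorm_ne_top))
    simpa using this

theorem tendsto_sandwich {ι : Type*} {l : Filter ι} [l.IsCountablyGenerated] (q : L2)
    {K : ι → ℝ → ℝ → ℂ} {K₀ : ℝ → ℝ → ℂ} (hK : ∀ i, IsBoundedKernel (K i))
    (hK₀ : IsBoundedKernel K₀)
    (h : ∀ x, ∀ᵐ y, Tendsto (fun i => K i x y) l (𝓝 (K₀ x y))) :
    Tendsto (fun i => sandwich q (hK i).op) l (𝓝 (sandwich q hK₀.op)) := by
  have h1 : Tendsto (fun i => hsSq q fun x y => K i x y - K₀ x y) l (𝓝 0) := by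
    refine tendsto_hsSq q (Eventually.of_forall fun i => (hK i).measurable.sub hK₀.measurable)
      (Eventually.of_forall fun i x y => ?_) fun x => ?_
    · exact (norm_sub_le _ _).trans (by linarith [(hK i).norm_le x y, hK₀.norm_le x y])
    · filter_upwards [h x] with y hy
      simpa using hy.sub_const (K₀ x y)
  have h2 : Tendsto (fun i => ((hsSq q fun x y => K i x y - K₀ x y) ^ (1 / 2 : ℝ)).toReal) l
      (𝓝 0) := by
    have := ((ENNReal.continuous_rpow_const (y := (1 / 2 : ℝ))).tendsto 0).comp h1
    have h3 := (ENNReal.tendsto_toReal (a := (0 : ℝ≥0∞) ^ (1 / 2 : ℝ)) (by simp)).comp this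
    simpa [Function.comp_def] using h3
  rw [tendsto_iff_norm_sub_tendsto_zero]
  refine squeeze_zero' (Eventually.of_forall fun _ => norm_nonneg _) ?_ h2
  filter_upwards [h1.eventually (gt_mem_nhds (ENNReal.zero_lt_top))] with i hi
  exact norm_sandwich_sub_le (hK i) hK₀ hi.ne

/-! ### Compactness -/

theorem isCompactOperator_sum {ι : Type*} (s : Finset ι) {E F : Type*} [NormedAddCommGroup E]
    [NormedSpace ℂ E] [NormedAddCommGroup F] [NormedSpace ℂ F] {T : ι → E →L[ℂ] F}
    (h : ∀ i ∈ s, IsCompactOperator (T i)) : IsCompactOperator (∑ i ∈ s, T i : E →L[ℂ] F) := by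
  classical
  induction s using Finset.induction_on with
  | empty => simpa using isCompactOperator_zero
  | insert a s ha ih =>
    rw [Finset.sum_insert ha]
    exact (h a (Finset.mem_insert_self a s)).add
      (ih fun i hi => h i (Finset.mem_insert_of_mem hi))

theorem isCompactOperator_smulRight {E F : Type*} [NormedAddCommGroup E] [NormedSpace ℂ E]
    [NormedAddCommGroup F] [NormedSpace ℂ F] (ℓ : E →L[ℂ] ℂ) (a : F) :
    IsCompactOperator (ℓ.smulRight a) := by
  exact (isCompactOperator_of_locallyCompactSpace_rng
    (ContinuousLinearMap.toSpanSingleton ℂ a)).comp_clm ℓ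

/-- The functional `f ↦ ∫_S f` on `L¹`. -/
def setIntegralL1 (S : Set ℝ) : L1 →L[ℂ] ℂ :=
  LinearMap.mkContinuous
    { toFun := fun f => ∫ y in S, f y
      map_add' := by
        intro f g
        rw [← integral_add (L1.integrable_coeFn f).integrableOn (L1.integrable_coeFn g).integrableOn]
        refine integral_congr_ae (ae_restrict_of_ae ?_)
        filter_upwards [Lp.coeFn_add f g] with y hy
        rw [hy, Pi.add_apply]
      map_smul' := by
        intro c f
        rw [RingHom.id_apply, smul_eq_mul, ← integral_const_mul]
        refine integral_congr_ae (ae_restrict_of_ae ?_)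
        filter_upwards [Lp.coeFn_smul c f] with y hy
        rw [hy, Pi.smul_apply, smul_eq_mul] }
    1 (by
      intro f
      rw [one_mul, L1.norm_eq_integral_norm]
      refine (norm_integral_le_integral_norm _).trans ?_
      exact setIntegral_le_integral (L1.integrable_coeFn f).norm
        (Eventually.of_forall fun _ => norm_nonneg _))

/-- The convolution kernel `G (x - y)` with `y` rounded down to the grid of width `1 / (n + 1)` and
cut off. -/
def gridKernel (G : ℝ → ℂ) (n : ℕ) (x y : ℝ) : ℂ :=
  ∑ j ∈ Finset.Ico (-((n + 1 : ℤ) ^ 2)) ((n + 1 : ℤ) ^ 2),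
    G (x - j / (n + 1)) * (if ⌊(n + 1) * y⌋ = j then 1 else 0)

theorem gridKernel_eq (G : ℝ → ℂ) (n : ℕ) (x y : ℝ) :
    gridKernel G n x y =
      if ⌊((n : ℝ) + 1) * y⌋ ∈ Finset.Ico (-((n + 1 : ℤ) ^ 2)) ((n + 1 : ℤ) ^ 2) then
        G (x - ⌊((n : ℝ) + 1) * y⌋ / (n + 1)) else 0 := by
  simp [gridKernel, Finset.sum_ite_eq]

theorem measurableSet_floor_eq (n : ℕ) (j : ℤ) :
    MeasurableSet {y : ℝ | ⌊((n : ℝ) + 1) * y⌋ = j} := by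
  have h : Measurable fun y : ℝ => ((n : ℝ) + 1) * y := by fun_prop
  exact (h.floor : Measurable fun y : ℝ => ⌊((n : ℝ) + 1) * y⌋) (measurableSet_singleton j)

theorem isBoundedKernel_gridKernel {G : ℝ → ℂ} (hG : Measurable G) (hb : ∀ x, ‖G x‖ ≤ 1) (n : ℕ) :
    IsBoundedKernel (gridKernel G n) where
  measurable := by
    have h : ∀ j : ℤ, Measurable fun p : ℝ × ℝ =>
        G (p.1 - j / (n + 1)) * (if ⌊((n : ℝ) + 1) * p.2⌋ = j then 1 else 0) := fun j =>
      (hG.comp (measurable_fst.sub_const _)).mul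
        (Measurable.ite (measurable_snd (measurableSet_floor_eq n j)) measurable_const
          measurable_const)
    exact Finset.measurable_fun_sum (Finset.Ico (-((n + 1 : ℤ) ^ 2)) ((n + 1 : ℤ) ^ 2))
      fun j _ => h j
  norm_le := by
    intro x y
    rw [gridKernel_eq]
    split_ifs
    · exact hb _
    · simp

theorem isBoundedKernel_conv {G : ℝ → ℂ} (hG : Measurable G) (hb : ∀ x, ‖G x‖ ≤ 1) :
    IsBoundedKernel fun x y => G (x - y) where
  measurable := hG.comp (measurable_fst.sub measurable_snd)
  norm_le := fun _ _ => hb _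

/-- Freezing `y` on each cell separates the variables: the operator is a finite sum of rank one
operators, each integrating over one cell. -/
theorem isCompactOperator_gridKernel {G : ℝ → ℂ} (hG : Measurable G) (hb : ∀ x, ‖G x‖ ≤ 1)
    (n : ℕ) : IsCompactOperator (isBoundedKernel_gridKernel hG hb n).op := by
  have hmem : ∀ j : ℤ, MemLp (fun x : ℝ => G (x - j / (n + 1))) ∞ (volume : Measure ℝ) := fun j =>
    memLp_top_of_bound (hG.comp (measurable_sub_const _)).aestronglyMeasurable 1
      (Eventually.of_forall fun x => hb _)
  have e : (isBoundedKernel_gridKernel hG hb n).op =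
      ∑ j ∈ Finset.Ico (-((n + 1 : ℤ) ^ 2)) ((n + 1 : ℤ) ^ 2),
        (setIntegralL1 {y : ℝ | ⌊((n : ℝ) + 1) * y⌋ = j}).smulRight ((hmem j).toLp _) := by
    ext1 f
    refine Lp.ext ?_
    rw [_root_.sum_apply]
    have h1 : (∑ j ∈ Finset.Ico (-((n + 1 : ℤ) ^ 2)) ((n + 1 : ℤ) ^ 2),
        ((setIntegralL1 {y : ℝ | ⌊((n : ℝ) + 1) * y⌋ = j}).smulRight ((hmem j).toLp _)) f : LInf)
        =ᵐ[volume] fun x => ∑ j ∈ Finset.Ico (-((n + 1 : ℤ) ^ 2)) ((n + 1 : ℤ) ^ 2),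
          (∫ y in {y : ℝ | ⌊((n : ℝ) + 1) * y⌋ = j}, f y) * G (x - j / (n + 1)) := by
      refine (Lp.coeFn_finsetSum _ _).trans ?_
      have : ∀ j ∈ Finset.Ico (-((n + 1 : ℤ) ^ 2)) ((n + 1 : ℤ) ^ 2), ∀ᵐ x : ℝ,
          (((setIntegralL1 {y : ℝ | ⌊((n : ℝ) + 1) * y⌋ = j}).smulRight ((hmem j).toLp _)) f : LInf)
            x = (∫ y in {y : ℝ | ⌊((n : ℝ) + 1) * y⌋ = j}, f y) * G (x - j / (n + 1)) := by
        intro j _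
        filter_upwards [Lp.coeFn_smul (setIntegralL1 {y : ℝ | ⌊((n : ℝ) + 1) * y⌋ = j} f)
          ((hmem j).toLp _), (hmem j).coeFn_toLp] with x h1 h2
        rw [ContinuousLinearMap.smulRight_apply, h1, Pi.smul_apply, h2]
        rfl
      filter_upwards [(ae_ball_iff (Finset.countable_toSet _)).2 this] with x hx
      rw [Finset.sum_apply]
      exact Finset.sum_congr rfl fun j hj => hx j hj
    refine ((isBoundedKernel_gridKernel hG hb n).coeFn_op f).trans (EventuallyEq.trans ?_ h1.symm)
    refine Eventually.of_forall fun x => ?_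
    have hfi := L1.integrable_coeFn f
    simp only [kernelConv, gridKernel, Finset.sum_mul]
    rw [integral_finsetSum]
    · refine Finset.sum_congr rfl fun j _ => ?_
      rw [← integral_indicator (measurableSet_floor_eq n j), mul_comm, ← integral_const_mul]
      congr 1; funext y
      by_cases h : ⌊((n : ℝ) + 1) * y⌋ = j <;> simp [Set.indicator, h]
    · intro j _
      refine ((hfi.indicator (measurableSet_floor_eq n j)).const_mul (G (x - j / (n + 1)))).congr
        (Eventually.of_forall fun y => ?_)
      by_cases h : ⌊((n : ℝ) + 1) * y⌋ = j <;> simp [Set.indicator, h]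
  rw [e]
  exact isCompactOperator_sum (E := L1) (F := LInf) _ fun j _ =>
    isCompactOperator_smulRight (setIntegralL1 {y : ℝ | ⌊((n : ℝ) + 1) * y⌋ = j}) ((hmem j).toLp _)

theorem tendsto_floor_grid (y : ℝ) :
    Tendsto (fun n : ℕ => (⌊((n : ℝ) + 1) * y⌋ : ℝ) / (n + 1)) atTop (𝓝 y) := by
  have h1 : Tendsto (fun n : ℕ => (1 : ℝ) / ((n : ℝ) + 1)) atTop (𝓝 0) :=
    tendsto_one_div_add_atTop_nhds_zero_nat
  have h2 : Tendsto (fun n : ℕ => y - 1 / ((n : ℝ) + 1)) atTop (𝓝 y) := by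
    simpa using tendsto_const_nhds.sub h1
  refine tendsto_of_tendsto_of_tendsto_of_le_of_le h2 tendsto_const_nhds (fun n => ?_) fun n => ?_
  · have hn : (0 : ℝ) < n + 1 := by positivity
    have := Int.sub_one_lt_floor (((n : ℝ) + 1) * y)
    simp only
    rw [le_div_iff₀ hn, sub_mul, one_div_mul_cancel hn.ne']
    linarith
  · have hn : (0 : ℝ) < n + 1 := by positivity
    have := Int.floor_le (((n : ℝ) + 1) * y)
    simp only
    rw [div_le_iff₀ hn]
    linarith

/-- A norm limit of finite rank operators. The possible jump of `G` at `0` only concerns the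
diagonal `y = x`, a null set for each `x`. -/
theorem isCompactOperator_sandwich_conv {G : ℝ → ℂ} (hG : Measurable G) (hb : ∀ x, ‖G x‖ ≤ 1)
    (hc : ∀ x, x ≠ 0 → ContinuousAt G x) (q : L2) :
    IsCompactOperator (sandwich q (isBoundedKernel_conv hG hb).op) := by
  refine isCompactOperator_of_tendsto (l := atTop)
    (F := fun n : ℕ => sandwich q (isBoundedKernel_gridKernel hG hb n).op) ?_
    (Eventually.of_forall fun n => ?_)
  · refine tendsto_sandwich q _ _ fun x => ?_
    filter_upwards [compl_mem_ae_iff.2 (measure_singleton (μ := volume) x)] with y hy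
    have hy' : y ≠ x := hy
    have h1 : Tendsto (fun n : ℕ => G (x - (⌊((n : ℝ) + 1) * y⌋ : ℝ) / (n + 1))) atTop
        (𝓝 (G (x - y))) :=
      (hc (x - y) (sub_ne_zero.2 hy'.symm)).tendsto.comp
        (tendsto_const_nhds.sub (tendsto_floor_grid y))
    refine h1.congr' ?_
    -- The cut-off on the cell index is quadratic in `n + 1` because the index of the cell
    -- containing `y` grows like `(n + 1)y`.
    have hbig : ∀ᶠ n : ℕ in atTop, |y| + 1 ≤ (n : ℝ) :=
      tendsto_natCast_atTop_atTop.eventually_ge_atTop _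
    filter_upwards [hbig] with n hn
    rw [gridKernel_eq, if_pos]
    rw [Finset.mem_Ico]
    have hn0 : (0 : ℝ) < n + 1 := by positivity
    obtain ⟨h2, h3⟩ := abs_le.1 (show |y| ≤ n by linarith [abs_nonneg y])
    constructor
    · rw [Int.le_floor]; push_cast; nlinarith
    · rw [Int.floor_lt]; push_cast; nlinarith
  · exact (((isCompactOperator_gridKernel hG hb n).comp_clm
      (mulToL1 q ∘L szego)).clm_comp (szego ∘L conjMulToL2 q))

/-! ### The two families of free resolvents -/

open Classical in
/-- The free resolvent with kernel `sideKernel b z`, set to zero off the closed half-plane. -/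
def sideRes (b : Bool) (z : ℂ) : L1 →L[ℂ] LInf :=
  if h : z ∈ halfPlane b then
    (isBoundedKernel_conv (measurable_sideKernel b z) (norm_sideKernel_le h)).op
  else 0

theorem sideRes_of_mem {b : Bool} {z : ℂ} (h : z ∈ halfPlane b) : sideRes b z =
    (isBoundedKernel_conv (measurable_sideKernel b z) (norm_sideKernel_le h)).op :=
  dif_pos h

theorem coeFn_sideRes {b : Bool} {z : ℂ} (h : z ∈ halfPlane b) (f : L1) :
    sideRes b z f =ᵐ[volume] sideConv b z f := by
  rw [sideRes_of_mem h]
  exact IsBoundedKernel.coeFn_op _ f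

open Classical in
/-- The side on which a point of the slit plane lies. -/
def CutPlane.side (k : CutPlane) : Bool := decide k.OnUpper

theorem CutPlane.mem_halfPlane_side (k : CutPlane) : k.toComplex ∈ halfPlane k.side := by
  by_cases h : k.OnUpper
  · simpa [side, h, halfPlane] using CutPlane.im_nonneg h
  · simpa [side, h, halfPlane] using CutPlane.im_nonpos h

theorem freeKernel_eq (k : CutPlane) : freeKernel k = sideKernel k.side k.toComplex := by
  funext x
  by_cases h : k.OnUpper <;> simp [freeKernel, sideKernel, CutPlane.side, h]

theorem freeResolvent_eq (k : CutPlane) : freeResolvent k = sideRes k.side k.toComplex := by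
  ext1 f
  refine Lp.ext ((MemLp.coeFn_toLp (memLp_freeConv k f)).trans
    (EventuallyEq.trans (Eventually.of_forall fun x => ?_)
      (coeFn_sideRes k.mem_halfPlane_side f).symm))
  rw [freeConv, sideConv, freeKernel_eq]

/-- The operator `C₊ q̄ R q C₊` for the free resolvent `sideRes b z`. -/
def sideOp (q : L2) (b : Bool) (z : ℂ) : L2 →L[ℂ] L2 := sandwich q (sideRes b z)

theorem sandwiched_eq (q : L2) (k : CutPlane) : sandwiched q k = sideOp q k.side k.toComplex := by
  rw [sandwiched, freeResolvent_eq]; rfl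

theorem continuousAt_sideKernel {b : Bool} {z : ℂ} {x : ℝ} (hx : x ≠ 0) :
    ContinuousAt (sideKernel b z) x := by
  cases b
  · rcases lt_or_gt_of_ne hx with h | h
    · have : ContinuousAt (fun x : ℝ => -I * exp (I * z * x)) x := by fun_prop
      refine this.congr ?_
      filter_upwards [Iio_mem_nhds h] with y hy
      simp [sideKernel, Set.mem_Iio.1 hy]
    · refine (continuousAt_const (y := (0 : ℂ))).congr ?_
      filter_upwards [Ioi_mem_nhds h] with y hy
      simp [sideKernel, not_lt.2 (Set.mem_Ioi.1 hy).le]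
  · rcases lt_or_gt_of_ne hx with h | h
    · refine (continuousAt_const (y := (0 : ℂ))).congr ?_
      filter_upwards [Iio_mem_nhds h] with y hy
      simp [sideKernel, not_lt.2 (Set.mem_Iio.1 hy).le]
    · have : ContinuousAt (fun x : ℝ => I * exp (I * z * x)) x := by fun_prop
      refine this.congr ?_
      filter_upwards [Ioi_mem_nhds h] with y hy
      simp [sideKernel, Set.mem_Ioi.1 hy]

theorem isCompactOperator_sideOp (q : L2) {b : Bool} {z : ℂ} (hz : z ∈ halfPlane b) :
    IsCompactOperator (sideOp q b z) := by
  rw [sideOp, sideRes_of_mem hz]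
  exact isCompactOperator_sandwich_conv (measurable_sideKernel b z) (norm_sideKernel_le hz)
    (fun x hx => continuousAt_sideKernel hx) q

theorem continuousOn_sideOp (q : L2) (b : Bool) : ContinuousOn (sideOp q b) (halfPlane b) := by
  rw [continuousOn_iff_continuous_domRestrict, continuous_iff_continuousAt]
  intro z₀
  have h := tendsto_sandwich (l := 𝓝 z₀) q
    (fun z : halfPlane b =>
      isBoundedKernel_conv (measurable_sideKernel b z) (norm_sideKernel_le z.2))
    (isBoundedKernel_conv (measurable_sideKernel b z₀) (norm_sideKernel_le z₀.2))
    (fun x => Eventually.of_forall fun y =>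
      (((continuous_sideKernel b (x - y)).comp continuous_subtype_val).tendsto z₀))
  simp only [← sideRes_of_mem (Subtype.coe_prop _)] at h
  exact h

/-- The kernel decays pointwise as `κ → ∞`. This supplies an energy at which the fixed point
equation for a bound state is solved by iteration. -/
theorem tendsto_sideOp_imaginary (q : L2) :
    Tendsto (fun κ : ℝ => sideOp q true (I * κ)) atTop (𝓝 0) := by
  have hmem : ∀ κ : ℝ, I * (|κ| : ℝ) ∈ halfPlane true := by
    intro κ; simp [halfPlane]
  have h0 : IsBoundedKernel fun _ _ => 0 := ⟨measurable_const, by simp⟩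
  have hz : sandwich q h0.op = 0 := by
    have : h0.op = 0 := by
      ext1 f
      refine Lp.ext ((h0.coeFn_op f).trans ?_)
      refine EventuallyEq.trans ?_ (Lp.coeFn_zero ℂ _ _).symm
      exact Eventually.of_forall fun x => by simp [kernelConv]
    rw [this, sandwich]; ext1; simp
  have h := tendsto_sandwich (l := atTop) q
    (fun κ : ℝ => isBoundedKernel_conv (measurable_sideKernel true (I * (|κ| : ℝ)))
      (norm_sideKernel_le (hmem κ))) h0 (fun x => Eventually.of_forall fun y => ?_)
  · rw [hz] at h
    refine h.congr' ?_
    filter_upwards [eventually_ge_atTop (0 : ℝ)] with κ hκ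
    rw [← sideRes_of_mem (hmem κ), abs_of_nonneg hκ, sideOp]
  · by_cases hxy : 0 < x - y
    · simp only [sideKernel, if_true, hxy]
      rw [tendsto_zero_iff_norm_tendsto_zero]
      have : Tendsto (fun κ : ℝ => Real.exp (-(κ * (x - y)))) atTop (𝓝 0) :=
        Real.tendsto_exp_neg_atTop_nhds_zero.comp (tendsto_id.atTop_mul_const hxy)
      refine this.congr' ?_
      filter_upwards [eventually_ge_atTop (0 : ℝ)] with κ hκ
      simp [Complex.norm_exp, abs_of_nonneg hκ]
    · simp only [sideKernel, if_true, hxy, if_false]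
      exact tendsto_const_nhds

/-- The Fredholm alternative. -/
theorem isUnit_one_sub_of_injective {T : L2 →L[ℂ] L2} (hT : IsCompactOperator T)
    (h : ∀ v, T v = v → v = 0) : IsUnit (1 - T) := by
  rcases hT.hasEigenvalue_or_mem_resolventSet (one_ne_zero (α := ℂ)) with h1 | h1
  · obtain ⟨v, hv⟩ := h1.exists_hasEigenvector
    exact (hv.2 (h v (by simpa using hv.apply_eq_smul))).elim
  · rw [spectrum.mem_resolventSet_iff] at h1
    simpa using h1

/-! ### Continuity of the free resolvents -/

theorem tendsto_sideConv {ι : Type*} {l : Filter ι} [l.IsCountablyGenerated] {b : Bool}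
    {z : ι → ℂ} {z₀ : ℂ} (hz : ∀ i, z i ∈ halfPlane b) (h : Tendsto z l (𝓝 z₀)) {F : ℝ → ℂ}
    (hF : Integrable F) (x : ℝ) :
    Tendsto (fun i => sideConv b (z i) F x) l (𝓝 (sideConv b z₀ F x)) :=
  tendsto_integral_filter_of_dominated_convergence (fun y => ‖F y‖)
    (Eventually.of_forall fun i => (integrable_sideConv (hz i) hF x).aestronglyMeasurable)
    (Eventually.of_forall fun i => Eventually.of_forall fun y => by
      rw [norm_mul]
      exact mul_le_of_le_one_left (norm_nonneg _) (norm_sideKernel_le (hz i) _)) hF.norm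
    (Eventually.of_forall fun y =>
      (((continuous_sideKernel b (x - y)).tendsto z₀).comp h).mul_const _)

/-- `R₀(z)u` is uniformly bounded and converges pointwise; the square integrable factor `q̄` makes
dominated convergence available and upgrades this to norm convergence. -/
theorem continuousOn_conjMul_sideRes (q : L2) (b : Bool) (u : L1) :
    ContinuousOn (fun z => conjMulToL2 q (sideRes b z u)) (halfPlane b) := by
  rw [continuousOn_iff_continuous_domRestrict, continuous_iff_continuousAt]
  intro z₀
  have hu := L1.integrable_coeFn u
  rw [ContinuousAt, Lp.tendsto_Lp_iff_tendsto_eLpNorm']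
  have hqm : Measurable fun y => ‖q y‖ₑ ^ (2 : ℝ) :=
    (Lp.stronglyMeasurable q).measurable.enorm.pow_const _
  have hm : ∀ z : halfPlane b, AEMeasurable (fun x => sideConv b z u x) volume := fun z =>
    (Lp.aestronglyMeasurable (sideRes b z u)).aemeasurable.congr (coeFn_sideRes z.2 u)
  have h1 : Tendsto (fun z : halfPlane b => ∫⁻ x, ‖q x‖ₑ ^ (2 : ℝ) *
      ‖sideConv b z u x - sideConv b z₀ u x‖ₑ ^ (2 : ℝ)) (𝓝 z₀) (𝓝 (∫⁻ _ : ℝ, 0)) := by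
    refine tendsto_lintegral_filter_of_dominated_convergence'
      (fun x => ‖q x‖ₑ ^ (2 : ℝ) * ENNReal.ofReal (2 * ‖u‖) ^ (2 : ℝ)) ?_ ?_ ?_ ?_
    · exact Eventually.of_forall fun z =>
        hqm.aemeasurable.mul (((hm z).sub (hm z₀)).enorm.pow_const _)
    · refine Eventually.of_forall fun z => Eventually.of_forall fun x => ?_
      refine mul_le_mul_right (ENNReal.rpow_le_rpow ?_ zero_le_two) _
      rw [← ofReal_norm]
      refine ENNReal.ofReal_le_ofReal ((norm_sub_le _ _).trans ?_)
      have := norm_sideConv_le z.2 hu x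
      have := norm_sideConv_le z₀.2 hu x
      rw [L1.norm_eq_integral_norm]
      linarith
    · rw [lintegral_mul_const _ hqm]
      exact ENNReal.mul_ne_top (lintegral_sq_ne_top q)
        (ENNReal.rpow_ne_top_of_nonneg zero_le_two ENNReal.ofReal_ne_top)
    · refine Eventually.of_forall fun x => ?_
      have h2 := (tendsto_sideConv (l := 𝓝 z₀) (fun z : halfPlane b => z.2)
        (continuous_subtype_val.tendsto z₀) hu x).sub_const (sideConv b z₀ u x)
      rw [sub_self] at h2
      have h3 : Tendsto (fun w : ℂ => ‖w‖ₑ ^ (2 : ℝ)) (𝓝 0) (𝓝 0) := by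
        have := ((ENNReal.continuous_rpow_const (y := (2 : ℝ))).comp
          continuous_enorm).tendsto (0 : ℂ)
        simpa [Function.comp_def] using this
      have := ENNReal.Tendsto.const_mul (a := ‖q x‖ₑ ^ (2 : ℝ)) (h3.comp h2)
        (Or.inr (ENNReal.rpow_ne_top_of_nonneg zero_le_two enorm_ne_top))
      simpa using this
  have h4 := ((ENNReal.continuous_rpow_const (y := (1 / 2 : ℝ))).tendsto _).comp h1
  simp only [lintegral_zero, one_div, inv_pos, Nat.ofNat_pos, ENNReal.zero_rpow_of_pos] at h4
  refine h4.congr fun z => ?_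
  rw [Set.domRestrict_apply, Set.domRestrict_apply, eLpNorm_two_eq, Function.comp_apply, one_div]
  congr 1
  refine lintegral_congr_ae ?_
  filter_upwards [coeFn_conjMulToL2 q (sideRes b z u), coeFn_conjMulToL2 q (sideRes b z₀ u),
    coeFn_sideRes z.2 u, coeFn_sideRes z₀.2 u] with x e1 e2 e3 e4
  rw [Pi.sub_apply, e1, e2, e3, e4, ← mul_sub, enorm_mul, RCLike.enorm_conj,
    ENNReal.mul_rpow_of_nonneg _ _ zero_le_two]

theorem continuousOn_integral_sideRes_mul (b : Bool) (u : L1) {G : ℝ → ℂ} (hG : Integrable G) :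
    ContinuousOn (fun z => ∫ x, sideRes b z u x * G x) (halfPlane b) := by
  rw [continuousOn_iff_continuous_domRestrict, continuous_iff_continuousAt]
  intro z₀
  have hu := L1.integrable_coeFn u
  have e : ∀ z : halfPlane b, ∫ x, sideRes b z u x * G x = ∫ x, sideConv b z u x * G x := by
    intro z
    refine integral_congr_ae ?_
    filter_upwards [coeFn_sideRes z.2 u] with x hx
    rw [hx]
  simp only [ContinuousAt, Set.domRestrict_def]
  simp_rw [e]
  refine tendsto_integral_filter_of_dominated_convergence (fun x => ‖u‖ * ‖G x‖) ?_ ?_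
    (hG.norm.const_mul _) ?_
  · exact Eventually.of_forall fun z => ((Lp.aestronglyMeasurable (sideRes b z u)).congr
      (coeFn_sideRes z.2 u)).mul hG.aestronglyMeasurable
  · refine Eventually.of_forall fun z => Eventually.of_forall fun x => ?_
    rw [norm_mul, L1.norm_eq_integral_norm]
    exact mul_le_mul_of_nonneg_right (norm_sideConv_le z.2 hu x) (norm_nonneg _)
  · exact Eventually.of_forall fun x => (tendsto_sideConv (l := 𝓝 z₀)
      (fun z : halfPlane b => z.2) (continuous_subtype_val.tendsto z₀) hu x).mul_const _

theorem norm_sideRes_le (b : Bool) (z : ℂ) (u : L1) : ‖sideRes b z u‖ ≤ ‖u‖ := by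
  by_cases h : z ∈ halfPlane b
  · rw [Lp.norm_def, eLpNorm_congr_ae (coeFn_sideRes h u), eLpNorm_exponent_top]
    refine ENNReal.toReal_le_of_le_ofReal (norm_nonneg u)
      (eLpNormEssSup_le_of_ae_bound (Eventually.of_forall fun x => ?_))
    rw [L1.norm_eq_integral_norm]
    exact norm_sideConv_le h (L1.integrable_coeFn u) x
  · simp [sideRes, h]

/-! ### Bound states -/

theorem integrable_mul_L2 (q f : L2) : Integrable fun x => q x * f x :=
  integrable_mul_of_memLp_two (Lp.memLp q) (Lp.memLp f)

/-- On its own half-line each kernel only sees points farther from the origin than `x`, so an even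
increasing weight can be moved inside the integral. -/
theorem mul_norm_sideConv_le {b : Bool} {t : ℝ} {u : ℝ → ℂ} (hu : Integrable u) {w : ℝ → ℝ}
    (hw0 : ∀ x, 0 ≤ w x) (hw : ∀ x y, |x| ≤ |y| → w x ≤ w y)
    (hwu : Integrable fun y => w y * ‖u y‖) {x : ℝ} (hx : if b then x ≤ 0 else 0 ≤ x) :
    w x * ‖sideConv b t u x‖ ≤ ∫ y in {y | |x| ≤ |y|}, w y * ‖u y‖ := by
  have hS : MeasurableSet {y : ℝ | |x| ≤ |y|} := measurableSet_le measurable_const (by fun_prop)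
  rw [← integral_indicator hS]
  have h0 : ‖sideConv b t u x‖ ≤ ∫ y, {y : ℝ | |x| ≤ |y|}.indicator (fun y => ‖u y‖) y := by
    refine norm_integral_le_of_norm_le (hu.norm.indicator hS) (Eventually.of_forall fun y => ?_)
    by_cases hy : |x| ≤ |y|
    · rw [Set.indicator_of_mem (show y ∈ {y : ℝ | |x| ≤ |y|} from hy), norm_mul]
      exact mul_le_of_le_one_left (norm_nonneg _)
        (norm_sideKernel_le (ofReal_mem_halfPlane b t) _)
    · rw [Set.indicator_of_notMem (show y ∉ {y : ℝ | |x| ≤ |y|} from hy)]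
      have : sideKernel b t (x - y) = 0 := by
        rw [not_le] at hy
        cases b
        · simp only [Bool.false_eq_true, if_false] at hx
          rw [abs_of_nonneg hx] at hy
          have := (abs_lt.1 hy).2
          simp [sideKernel, not_lt.2 this.le]
        · simp only [if_true] at hx
          rw [abs_of_nonpos hx, abs_lt] at hy
          simp [sideKernel, not_lt.2 (show x ≤ y by linarith [hy.1])]
      simp [this]
  refine (mul_le_mul_of_nonneg_left h0 (hw0 x)).trans ?_
  rw [← integral_const_mul]
  refine integral_mono ((hu.norm.indicator hS).const_mul _) (hwu.indicator hS) fun y => ?_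
  by_cases hy : |x| ≤ |y|
  · simp only [Set.indicator_of_mem (show y ∈ {y : ℝ | |x| ≤ |y|} from hy)]
    exact mul_le_mul_of_nonneg_right (hw x y hy) (norm_nonneg _)
  · simp [Set.indicator_of_notMem (show y ∉ {y : ℝ | |x| ≤ |y|} from hy)]

/-- A solution `φ` of `-i φ' - q C₊ (q̄ φ) = t φ` which vanishes at both ends, with
`f = C₊ (q̄ φ)`. -/
structure BoundState (q : L2) (t : ℝ) (φ : ℝ → ℂ) (f : L2) : Prop where
  exists_szego_eq : ∃ g : L2, (g =ᵐ[volume] fun x => conj (q x) * φ x) ∧ szego g = f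
  freeEq : FreeEq t φ (fun x => q x * f x)
  tendsto_atBot : Tendsto φ atBot (𝓝 0)
  tendsto_atTop : Tendsto φ atTop (𝓝 0)

/-- The even weight `(1 + x²)^{s/2}`. -/
def japanese (s x : ℝ) : ℝ := (1 + x ^ 2) ^ (s / 2)

theorem japanese_nonneg (s x : ℝ) : 0 ≤ japanese s x := by unfold japanese; positivity

theorem japanese_mono {s : ℝ} (hs : 0 ≤ s) {x y : ℝ} (h : |x| ≤ |y|) :
    japanese s x ≤ japanese s y := by
  unfold japanese
  have := sq_le_sq.2 h
  gcongr

theorem abs_le_japanese_mul {s : ℝ} (hs : 1 / 2 < s) (x : ℝ) :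
    |x| ≤ japanese s x * japanese s x := by
  unfold japanese
  have h1 : (0 : ℝ) < 1 + x ^ 2 := by positivity
  rw [← Real.rpow_add h1, add_halves]
  calc |x| = Real.sqrt (x ^ 2) := (Real.sqrt_sq_eq_abs x).symm
    _ ≤ Real.sqrt (1 + x ^ 2) := Real.sqrt_le_sqrt (by linarith)
    _ = (1 + x ^ 2) ^ (1 / 2 : ℝ) := Real.sqrt_eq_rpow _
    _ ≤ _ := Real.rpow_le_rpow_of_exponent_le (by nlinarith [sq_nonneg x]) hs.le

namespace BoundState

variable {q : L2} {t : ℝ} {φ : ℝ → ℂ} {f : L2}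

theorem mem_hardy (h : BoundState q t φ f) : f ∈ hardySpace := by
  obtain ⟨g, -, rfl⟩ := h.exists_szego_eq
  exact szego_mem g

theorem eq_sideConv (h : BoundState q t φ f) (b : Bool) :
    φ = sideConv b t (fun x => q x * f x) := by
  refine h.freeEq.eq_sideConv_real (integrable_mul_L2 q f) ?_
  cases b
  · exact h.tendsto_atTop
  · exact h.tendsto_atBot

theorem continuous (h : BoundState q t φ f) : Continuous φ :=
  h.freeEq.continuous (integrable_mul_L2 q f).locallyIntegrable

theorem add {φ' : ℝ → ℂ} {f' : L2} (h : BoundState q t φ f) (h' : BoundState q t φ' f') :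
    BoundState q t (fun x => φ x + φ' x) (f + f') where
  exists_szego_eq := by
    obtain ⟨g, hg, rfl⟩ := h.exists_szego_eq
    obtain ⟨g', hg', rfl⟩ := h'.exists_szego_eq
    refine ⟨g + g', ?_, map_add _ _ _⟩
    filter_upwards [hg, hg', Lp.coeFn_add g g'] with x h1 h2 h3
    rw [h3, Pi.add_apply, h1, h2, mul_add]
  freeEq := by
    have e := h.freeEq.add h'.freeEq (integrable_mul_L2 q f).locallyIntegrable
      (integrable_mul_L2 q f').locallyIntegrable
    refine e.congr ?_
    filter_upwards [Lp.coeFn_add f f'] with x hx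
    rw [hx, Pi.add_apply, mul_add]
  tendsto_atBot := by simpa using h.tendsto_atBot.add h'.tendsto_atBot
  tendsto_atTop := by simpa using h.tendsto_atTop.add h'.tendsto_atTop

theorem const_mul (h : BoundState q t φ f) (c : ℂ) :
    BoundState q t (fun x => c * φ x) (c • f) where
  exists_szego_eq := by
    obtain ⟨g, hg, rfl⟩ := h.exists_szego_eq
    refine ⟨c • g, ?_, map_smul _ _ _⟩
    filter_upwards [hg, Lp.coeFn_smul c g] with x h1 h3
    rw [h3, Pi.smul_apply, h1, smul_eq_mul]; ring
  freeEq := by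
    refine (h.freeEq.const_mul c).congr ?_
    filter_upwards [Lp.coeFn_smul c f] with x hx
    rw [hx, Pi.smul_apply, smul_eq_mul]; ring
  tendsto_atBot := by simpa using h.tendsto_atBot.const_mul c
  tendsto_atTop := by simpa using h.tendsto_atTop.const_mul c

/-- A bound state is both a forward and a backward solution; using the backward formula for `x ≥ 0`
and the forward one for `x ≤ 0` converts tails of `qf` into decay of `φ` at both ends. -/
theorem mul_norm_le (h : BoundState q t φ f) {w : ℝ → ℝ} (hw0 : ∀ x, 0 ≤ w x)
    (hw : ∀ x y, |x| ≤ |y| → w x ≤ w y) (hwu : Integrable fun y => w y * ‖q y * f y‖) (x : ℝ) :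
    w x * ‖φ x‖ ≤ ∫ y in {y | |x| ≤ |y|}, w y * ‖q y * f y‖ := by
  rcases le_total 0 x with hx | hx
  · rw [h.eq_sideConv false]
    exact mul_norm_sideConv_le (integrable_mul_L2 q f) hw0 hw hwu (by simpa using hx)
  · rw [h.eq_sideConv true]
    exact mul_norm_sideConv_le (integrable_mul_L2 q f) hw0 hw hwu (by simpa using hx)

theorem norm_le (h : BoundState q t φ f) (x : ℝ) : ‖φ x‖ ≤ ∫ y, ‖q y * f y‖ := by
  rw [h.eq_sideConv true]
  exact norm_sideConv_le (ofReal_mem_halfPlane _ _) (integrable_mul_L2 q f) x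

variable {s : ℝ}

theorem exists_japanese_mul_le (h : BoundState q t φ f) (hq : IsWeightedHardy s q) (hs : 1 / 2 < s) :
    ∃ C, 0 ≤ C ∧ ∀ x, japanese s x * ‖φ x‖ ≤ C := by
  have hs0 : 0 ≤ s := by linarith
  have hi : Integrable fun y => japanese s y * ‖q y * f y‖ := by
    refine (integrable_mul_of_memLp_two hq.weighted (Lp.memLp f)).norm.congr
      (Eventually.of_forall fun x => ?_)
    simp only [norm_mul, Complex.norm_real, Real.norm_eq_abs]
    rw [← japanese, abs_of_nonneg (japanese_nonneg s x), mul_assoc]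
  have h0 : ∀ y, 0 ≤ japanese s y * ‖q y * f y‖ := fun y =>
    mul_nonneg (japanese_nonneg _ _) (norm_nonneg _)
  exact ⟨∫ y, japanese s y * ‖q y * f y‖, integral_nonneg h0, fun x =>
    (h.mul_norm_le (japanese_nonneg s) (fun x y => japanese_mono hs0) hi x).trans
      (setIntegral_le_integral hi (Eventually.of_forall h0))⟩

/-- The function `x q̄ φ` is square integrable, and `x f` is the sum of its projection and a
constant. -/
theorem exists_mul_szego (h : BoundState q t φ f) (hq : IsWeightedHardy s q) (hs : 1 / 2 < s) :
    ∃ G : L2, (G =ᵐ[volume] fun x => x * (conj (q x) * φ x)) ∧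
      ∀ᵐ x : ℝ, (x : ℂ) * f x = szego G x + I / (2 * Real.pi) * ∫ y, conj (q y) * φ y := by
  obtain ⟨C, hC, hφ⟩ := h.exists_japanese_mul_le hq hs
  obtain ⟨g, hg, rfl⟩ := h.exists_szego_eq
  have hqi : Integrable q := memLp_one_iff_integrable.1 (hq.memLp_one hs)
  have hgi : Integrable g := by
    refine Integrable.congr ?_ hg.symm
    refine Integrable.mul_bdd (c := ∫ y, ‖q y * szego g y‖) (integrable_conj hqi)
      h.continuous.aestronglyMeasurable (Eventually.of_forall h.norm_le)
  have hG : MemLp (fun x : ℝ => (x : ℂ) * g x) 2 volume := by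
    refine MemLp.of_le_mul (c := C) hq.weighted
      ((Complex.continuous_ofReal.aestronglyMeasurable).mul (Lp.aestronglyMeasurable g)) ?_
    filter_upwards [hg] with x hx
    rw [hx]
    simp only [norm_mul, Complex.norm_real, Real.norm_eq_abs, RCLike.norm_conj]
    rw [← japanese, abs_of_nonneg (japanese_nonneg s x)]
    have h1 := abs_le_japanese_mul hs x
    have h2 := hφ x
    have h3 := japanese_nonneg s x
    -- The factor `|x|` is shared: one power of the weight goes to the decay of `φ` just obtained,
    -- the other to the hypothesis on `q`. Two powers suffice because `s > 1/2`.
    calc |x| * (‖q x‖ * ‖φ x‖) ≤ japanese s x * japanese s x * (‖q x‖ * ‖φ x‖) := by gcongr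
      _ = japanese s x * ‖φ x‖ * (japanese s x * ‖q x‖) := by ring
      _ ≤ C * (japanese s x * ‖q x‖) := by gcongr
  refine ⟨hG.toLp, ?_, ?_⟩
  · filter_upwards [hG.coeFn_toLp, hg] with x h1 h2
    rw [h1, h2]
  · have := mul_szego hG.coeFn_toLp hgi
    rwa [integral_congr_ae hg] at this

/-- The commutator formula writes `xf` as an `L²` function plus a constant; times `q` this is a
product of two `L²` functions plus a multiple of `q ∈ L¹`. The decay thereby gains a full factor
`x`. -/
theorem integrable_mul_id (h : BoundState q t φ f) (hq : IsWeightedHardy s q) (hs : 1 / 2 < s) :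
    Integrable fun x : ℝ => (x : ℂ) * (q x * f x) := by
  obtain ⟨G, -, hG⟩ := h.exists_mul_szego hq hs
  have hqi : Integrable q := memLp_one_iff_integrable.1 (hq.memLp_one hs)
  refine ((integrable_mul_L2 q (szego G)).add
    (hqi.mul_const (I / (2 * Real.pi) * ∫ y, conj (q y) * φ y))).congr ?_
  filter_upwards [hG] with x hx
  simp only [Pi.add_apply]
  linear_combination -(q x) * hx

theorem exists_norm_mul_id_le (h : BoundState q t φ f) (hq : IsWeightedHardy s q)
    (hs : 1 / 2 < s) : ∃ C, ∀ x : ℝ, ‖(x : ℂ) * φ x‖ ≤ C := by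
  have hi : Integrable fun y : ℝ => |y| * ‖q y * f y‖ := by
    refine (h.integrable_mul_id hq hs).norm.congr (Eventually.of_forall fun y => ?_)
    simp only
    rw [norm_mul (y : ℂ), Complex.norm_real, Real.norm_eq_abs]
  refine ⟨∫ y : ℝ, |y| * ‖q y * f y‖, fun x => ?_⟩
  rw [norm_mul, Complex.norm_real, Real.norm_eq_abs]
  exact (h.mul_norm_le abs_nonneg (fun _ _ h => h) hi x).trans
    (setIntegral_le_integral hi (Eventually.of_forall fun y => by positivity))

/-- Tonelli applied to `|φ(x)| ≤ ∫_{|y| ≥ |x|} |qf|`: each `y` is counted over an interval of length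
`2|y|`. -/
theorem integrable (h : BoundState q t φ f) (hq : IsWeightedHardy s q) (hs : 1 / 2 < s) :
    Integrable φ := by
  have hu := integrable_mul_L2 q f
  have hxu := h.integrable_mul_id hq hs
  refine ⟨h.continuous.aestronglyMeasurable, ?_⟩
  have h1 : ∀ x, ‖φ x‖ₑ ≤ ∫⁻ y, {p : ℝ × ℝ | |p.1| ≤ |p.2|}.indicator
      (fun p => ‖q p.2 * f p.2‖ₑ) (x, y) := by
    intro x
    have := h.mul_norm_le (w := fun _ => 1) (fun _ => zero_le_one) (fun _ _ _ => le_rfl)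
      (by simpa using hu.norm) x
    simp only [one_mul] at this
    rw [← ofReal_norm]
    refine (ENNReal.ofReal_le_ofReal this).trans ?_
    have hS : MeasurableSet {y : ℝ | |x| ≤ |y|} :=
      measurableSet_le measurable_const (by fun_prop)
    rw [ofReal_integral_norm_eq_lintegral_enorm hu.integrableOn, ← lintegral_indicator hS]
    exact le_of_eq rfl
  have hm : AEMeasurable ({p : ℝ × ℝ | |p.1| ≤ |p.2|}.indicator
      (fun p => ‖q p.2 * f p.2‖ₑ)) ((volume : Measure ℝ).prod volume) := by
    refine AEMeasurable.indicator ?_ (measurableSet_le (by fun_prop) (by fun_prop))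
    exact (((Lp.stronglyMeasurable q).measurable.comp measurable_snd).mul
      ((Lp.stronglyMeasurable f).measurable.comp measurable_snd)).enorm.aemeasurable
  refine (lintegral_mono h1).trans_lt ?_
  rw [lintegral_lintegral_swap (f := fun x y => {p : ℝ × ℝ | |p.1| ≤ |p.2|}.indicator
    (fun p => ‖q p.2 * f p.2‖ₑ) (x, y)) hm]
  have h2 : ∀ y : ℝ, ∫⁻ x, {p : ℝ × ℝ | |p.1| ≤ |p.2|}.indicator
      (fun p => ‖q p.2 * f p.2‖ₑ) (x, y) = 2 * ‖(y : ℂ) * (q y * f y)‖ₑ := by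
    intro y
    have : ∀ x, {p : ℝ × ℝ | |p.1| ≤ |p.2|}.indicator (fun p => ‖q p.2 * f p.2‖ₑ) (x, y) =
        (Set.Icc (-|y|) |y|).indicator (fun _ => ‖q y * f y‖ₑ) x := by
      intro x
      by_cases hx : |x| ≤ |y|
      · rw [Set.indicator_of_mem (by exact hx), Set.indicator_of_mem (by exact abs_le.1 hx)]
      · rw [Set.indicator_of_notMem (by exact hx),
          Set.indicator_of_notMem (by exact fun h => hx (abs_le.2 h))]
    simp_rw [this]
    rw [lintegral_indicator measurableSet_Icc, setLIntegral_const, Real.volume_Icc,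
      enorm_mul (y : ℂ), ← ofReal_norm (y : ℂ), Complex.norm_real, Real.norm_eq_abs,
      show |y| - -|y| = 2 * |y| by ring, ENNReal.ofReal_mul zero_le_two]
    simp only [ENNReal.ofReal_ofNat]
    ring
  simp_rw [h2]
  rw [lintegral_const_mul' _ _ (by norm_num)]
  exact ENNReal.mul_lt_top (by norm_num) hxu.2

theorem memLp_two (h : BoundState q t φ f) (hq : IsWeightedHardy s q) (hs : 1 / 2 < s) :
    MemLp φ 2 volume :=
  memLp_two_of_integrable_of_bound (h.integrable hq hs) h.norm_le

theorem tendsto_mul_id (h : BoundState q t φ f) (hq : IsWeightedHardy s q) (hs : 1 / 2 < s)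
    {l : Filter ℝ} [l.IsCountablyGenerated] (hl : Tendsto (fun x : ℝ => |x|) l atTop) :
    Tendsto (fun x : ℝ => (x : ℂ) * φ x) l (𝓝 0) := by
  have hxu := h.integrable_mul_id hq hs
  have hi : Integrable fun y : ℝ => |y| * ‖q y * f y‖ := by
    refine hxu.norm.congr (Eventually.of_forall fun y => ?_)
    simp only
    rw [norm_mul (y : ℂ), Complex.norm_real, Real.norm_eq_abs]
  have hS : ∀ x : ℝ, MeasurableSet {y : ℝ | |x| ≤ |y|} := fun x =>
    measurableSet_le measurable_const (by fun_prop)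
  have hlim : Tendsto (fun x : ℝ => ∫ y in {y : ℝ | |x| ≤ |y|}, |y| * ‖q y * f y‖) l (𝓝 0) := by
    have := tendsto_integral_filter_of_dominated_convergence (μ := volume) (l := l)
      (F := fun x y => {y : ℝ | |x| ≤ |y|}.indicator (fun y => |y| * ‖q y * f y‖) y)
      (f := fun _ => 0) (fun y => |y| * ‖q y * f y‖)
      (Eventually.of_forall fun x => (hi.indicator (hS x)).aestronglyMeasurable)
      (Eventually.of_forall fun x => Eventually.of_forall fun y => by
        have h0 : 0 ≤ |y| * ‖q y * f y‖ := by positivity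
        by_cases hy : |x| ≤ |y|
        · rw [Set.indicator_of_mem (by exact hy), Real.norm_of_nonneg h0]
        · rw [Set.indicator_of_notMem (by exact hy)]; simpa using h0) hi
      (Eventually.of_forall fun y => by
        refine tendsto_const_nhds.congr' ?_
        filter_upwards [hl.eventually_gt_atTop |y|] with x hx
        rw [Set.indicator_of_notMem (by exact not_le.2 hx)])
    rw [integral_zero] at this
    refine this.congr fun x => ?_
    rw [integral_indicator (hS x)]
  refine squeeze_zero_norm (fun x => ?_) hlim
  rw [norm_mul, Complex.norm_real, Real.norm_eq_abs]
  exact h.mul_norm_le abs_nonneg (fun _ _ h => h) hi x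

/-- On the Fourier side the equation multiplies the transform of `φ` by `2πξ - t` and equates it
with that of `qf`, a product of Hardy functions without negative frequencies. The single frequency
`t / 2π` where division fails is null. -/
theorem toLp_mem_hardySpace (h : BoundState q t φ f) (hq : IsWeightedHardy s q) (hs : 1 / 2 < s) :
    (h.memLp_two hq hs).toLp φ ∈ hardySpace := by
  have hi := h.integrable hq hs
  refine mem_hardySpace_of_integral (hi.congr (h.memLp_two hq hs).coeFn_toLp.symm) ?_
  filter_upwards [compl_mem_ae_iff.2 (measure_singleton (μ := volume) (t / (2 * Real.pi)))]
    with ξ hξ hneg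
  have h1 := h.freeEq.fourierIntegral_mul (integrable_mul_L2 q f) hi ξ
  have h2 := integral_exp_mul_mul_eq_zero h.mem_hardy hq.mem_hardy
    (t := 2 * Real.pi * ξ) (by nlinarith [Real.pi_pos])
  have h3 : ∫ x : ℝ, exp (-(2 * Real.pi * I * ξ * x)) * (q x * f x) = 0 := by
    rw [← h2]
    congr 1; funext x
    congr 2
    push_cast; ring
  rw [h3, mul_eq_zero] at h1
  rcases h1 with h1 | h1
  · exfalso
    apply hξ
    have : 2 * Real.pi * ξ - t = 0 := by exact_mod_cast h1
    rw [Set.mem_singleton_iff, eq_div_iff (by positivity)]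
    linarith
  · rw [← h1]
    refine integral_congr_ae ?_
    filter_upwards [(h.memLp_two hq hs).coeFn_toLp] with x hx
    rw [hx]

end BoundState

/-! ### Pairings with bound states -/

theorem tendsto_exp_mul_zero_of_mem_halfPlane {b : Bool} {z : ℂ} (hz : z ∈ halfPlane b)
    {φ : ℝ → ℂ} {l : Filter ℝ} (hl : l ≤ sideEnd b) (h : Tendsto φ l (𝓝 0)) :
    Tendsto (fun a : ℝ => exp (-(I * z * a)) * φ a) l (𝓝 0) := by
  rw [tendsto_zero_iff_norm_tendsto_zero] at h
  refine squeeze_zero_norm' ?_ h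
  have key : ∀ᶠ a : ℝ in sideEnd b, z.im * a ≤ 0 := by
    cases b
    · filter_upwards [(eventually_ge_atTop 0 : ∀ᶠ x in sideEnd false, (0 : ℝ) ≤ x)] with a ha
      exact mul_nonpos_of_nonpos_of_nonneg (by simpa [halfPlane] using hz) ha
    · filter_upwards [(eventually_le_atBot 0 : ∀ᶠ x in sideEnd true, x ≤ (0 : ℝ))] with a ha
      exact mul_nonpos_of_nonneg_of_nonpos (by simpa [halfPlane] using hz) ha
  filter_upwards [hl key] with a ha
  rw [norm_mul]
  refine mul_le_of_le_one_left (norm_nonneg _) ?_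
  rw [Complex.norm_exp, Real.exp_le_one_iff]
  simpa using ha

/-- `∫ h conj (q f) = ⟪f, q̄ h⟫`. -/
theorem integral_mul_conj_mul {q f g : L2} {h : ℝ → ℂ} (hg : g =ᵐ[volume] fun x => conj (q x) * h x) :
    ∫ x, h x * conj (q x * f x) = inner ℂ f g := by
  rw [inner_eq_integral]
  refine integral_congr_ae ?_
  filter_upwards [hg] with x hx
  rw [hx, map_mul]; ring

namespace BoundState

variable {q : L2} {t t' s : ℝ} {φ φ' : ℝ → ℂ} {f f' : L2}

theorem tendsto_sideEnd (h : BoundState q t φ f) (b : Bool) : Tendsto φ (sideEnd b) (𝓝 0) := by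
  cases b
  · exact h.tendsto_atTop
  · exact h.tendsto_atBot

theorem eq_sideConv_shift (h : BoundState q t φ f) (hq : IsWeightedHardy s q) (hs : 1 / 2 < s)
    {b : Bool} {z : ℂ} (hz : z ∈ halfPlane b) :
    φ = sideConv b z (fun x => q x * f x + (t - z) * φ x) := by
  have hu := integrable_mul_L2 q f
  refine (h.freeEq.shift hu.locallyIntegrable z).eq_sideConv hz
    (hu.add ((h.integrable hq hs).const_mul _)) le_rfl ?_
  exact tendsto_exp_mul_zero_of_mem_halfPlane hz le_rfl (h.tendsto_sideEnd b)

/-- Represent `φ` by the opposite resolvent at `conj z` and move that resolvent onto `u`. The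
orthogonality relations and the coefficient equation of the regularised problem are instances. -/
theorem integral_mul_conj (h : BoundState q t φ f) (hq : IsWeightedHardy s q) (hs : 1 / 2 < s)
    {b : Bool} {z : ℂ} (hz : z ∈ halfPlane b) {u : ℝ → ℂ} (hu : Integrable u) :
    ∫ x, u x * conj (φ x) = (∫ x, sideConv b z u x * conj (q x * f x)) +
      (t - z) * ∫ x, sideConv b z u x * conj (φ x) := by
  have hv := integrable_mul_L2 q f
  have hφ := h.integrable hq hs
  have hbd : ∀ {w : ℝ → ℂ}, Integrable w → Integrable fun x => sideConv b z u x * conj (w x) := by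
    intro w hw
    exact (integrable_conj hw).bdd_mul
      ((freeEq_sideConv hz hu).continuous hu.locallyIntegrable).aestronglyMeasurable
      (Eventually.of_forall (norm_sideConv_le hz hu))
  have h1 := integral_sideConv_mul_conj hz hu (hv.add (hφ.const_mul (t - conj z)))
  simp only [Pi.add_apply] at h1
  have h2 : sideConv (!b) (conj z) ((fun x => q x * f x) + fun x => (↑t - conj z) * φ x) = φ :=
    (h.eq_sideConv_shift hq hs (conj_mem_halfPlane hz)).symm
  rw [h2] at h1
  rw [← h1, ← integral_const_mul, ← integral_add (hbd hv) ((hbd hφ).const_mul _)]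
  refine integral_congr_ae (Eventually.of_forall fun x => ?_)
  simp only [map_add, map_mul, map_sub, conj_ofReal, conj_conj]
  ring

theorem integral_mul_self (h : BoundState q t φ f) {f' : L2} (hf' : f' ∈ hardySpace) :
    ∫ x, φ x * conj (q x * f' x) = inner ℂ f' f := by
  obtain ⟨g, hg, rfl⟩ := h.exists_szego_eq
  rw [integral_mul_conj_mul hg, ← inner_szego_left, szego_of_mem hf']

theorem integral_self_mul (h : BoundState q t φ f) (hf' : f' ∈ hardySpace) :
    ∫ x, q x * f' x * conj (φ x) = inner ℂ f f' := by
  rw [← inner_conj_symm, ← h.integral_mul_self hf', ← integral_conj]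
  simp [mul_comm]

/-- Symmetry of `L_q`, obtained without reference to its domain: both potential terms equal `⟨f',
f⟩`, and what remains is `(t' - t) ∫ φ conj φ'`. -/
theorem orthogonal (h : BoundState q t φ f) (h' : BoundState q t' φ' f') (hne : t ≠ t')
    (hq : IsWeightedHardy s q) (hs : 1 / 2 < s) : ∫ x, φ x * conj (φ' x) = 0 := by
  have h1 := h'.integral_mul_conj hq hs (ofReal_mem_halfPlane true t) (integrable_mul_L2 q f)
  rw [← h.eq_sideConv, h'.integral_self_mul h.mem_hardy, h.integral_mul_self h'.mem_hardy,
    left_eq_add, mul_eq_zero, sub_eq_zero] at h1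
  rcases h1 with h1 | h1
  · exact (hne (by exact_mod_cast h1.symm)).elim
  · exact h1

/-- The trace identity `|∫ q̄ φ|² = 2π ‖φ‖²`. -/
theorem integral_mul_conj_integral (h : BoundState q t φ f) (hq : IsWeightedHardy s q)
    (hs : 1 / 2 < s) :
    (∫ x, conj (q x) * φ x) * conj (∫ x, conj (q x) * φ x) =
      2 * Real.pi * ∫ x, φ x * conj (φ x) := by
  have hu := integrable_mul_L2 q f
  have hxu := h.integrable_mul_id hq hs
  have hφ := h.integrable hq hs
  have hF : Integrable fun x : ℝ => (x : ℂ) * (q x * f x) - I * φ x := hxu.sub (hφ.const_mul I)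
  -- The identity comes from the commutator of `L_q` with `x`. Since `xφ` vanishes at the lower end,
  -- it is the resolvent of its source `x q f - iφ`. Pairing with `qf` and moving the resolvent
  -- over, the terms `⟨f, G⟩` on the two sides cancel, and `-i‖φ‖²` is left against the rank one
  -- term of `mul_szego`.
  have e1 : (fun x : ℝ => (x : ℂ) * φ x) =
      sideConv true t (fun x => (x : ℂ) * (q x * f x) - I * φ x) := by
    refine (h.freeEq.mul_id hu.locallyIntegrable).eq_sideConv_real hF ?_
    exact h.tendsto_mul_id hq hs (l := atBot) tendsto_abs_atBot_atTop
  obtain ⟨G, hG, hxf⟩ := h.exists_mul_szego hq hs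
  set c := ∫ y, conj (q y) * φ y with hc
  have h1 := integral_sideConv_mul_conj (ofReal_mem_halfPlane true t) hF hu
  rw [← e1, conj_ofReal, Bool.not_true, ← h.eq_sideConv false] at h1
  have l1 : ∫ x : ℝ, (x : ℂ) * φ x * conj (q x * f x) = inner ℂ f G :=
    integral_mul_conj_mul (hG.trans (Eventually.of_forall fun x => by ring))
  have i1 : Integrable fun x : ℝ => (x : ℂ) * (q x * f x) * conj (φ x) :=
    hxu.mul_bdd h.continuous.star.aestronglyMeasurable
      (Eventually.of_forall fun x => (by simpa using h.norm_le x))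
  have i2 : Integrable fun x : ℝ => φ x * conj (φ x) :=
    hφ.mul_bdd h.continuous.star.aestronglyMeasurable
      (Eventually.of_forall fun x => (by simpa using h.norm_le x))
  have r0 : ∫ x : ℝ, ((x : ℂ) * (q x * f x) - I * φ x) * conj (φ x) =
      (∫ x : ℝ, (x : ℂ) * (q x * f x) * conj (φ x)) - I * ∫ x, φ x * conj (φ x) := by
    rw [← integral_const_mul, ← integral_sub i1 (i2.const_mul I)]
    refine integral_congr_ae (Eventually.of_forall fun x => ?_)
    simp only; ring
  have r1 : ∫ x : ℝ, (x : ℂ) * (q x * f x) * conj (φ x) =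
      inner ℂ f G + I / (2 * Real.pi) * c * conj c := by
    obtain ⟨g, hg, hgf⟩ := h.exists_szego_eq
    have hgi : Integrable fun x => q x * conj (φ x) := by
      have hqi : Integrable q := memLp_one_iff_integrable.1 (hq.memLp_one hs)
      exact hqi.mul_bdd h.continuous.star.aestronglyMeasurable
        (Eventually.of_forall fun x => (by simpa using h.norm_le x))
    have hcc : conj c = ∫ x, q x * conj (φ x) := by
      rw [hc, ← integral_conj]; simp
    have e2 : (inner ℂ f G : ℂ) = ∫ x, conj (g x) * szego G x := by
      rw [← inner_eq_integral, ← hgf, inner_szego_left]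
    rw [e2, hcc, ← integral_const_mul, ← integral_add _ (hgi.const_mul _)]
    · refine integral_congr_ae ?_
      filter_upwards [hg, hxf] with x hx1 hx2
      rw [hx1, map_mul, conj_conj]
      linear_combination (q x * conj (φ x)) * hx2
    · exact integrable_mul_of_memLp_two (memLp_conj (Lp.memLp g)) (Lp.memLp _)
  rw [l1, r0, r1] at h1
  have hpi : (Real.pi : ℂ) ≠ 0 := by exact_mod_cast Real.pi_ne_zero
  have h2 : I / (2 * Real.pi) * c * conj c = I * ∫ x, φ x * conj (φ x) := by
    linear_combination -h1
  have h3 := congrArg (fun w => -I * (2 * Real.pi) * w) h2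
  calc c * conj c = -I * (2 * Real.pi) * (I / (2 * Real.pi) * c * conj c) := by
        field_simp
        linear_combination (c * conj c) * I_sq
    _ = _ := by
        rw [h3]
        linear_combination (-(2 * Real.pi) * ∫ x, φ x * conj (φ x)) * I_sq

theorem eq_zero_of_integral_sq (h : BoundState q t φ f) (hq : IsWeightedHardy s q) (hs : 1 / 2 < s)
    (h0 : ∫ x, φ x * conj (φ x) = 0) : φ = 0 := by
  have h2 := h.memLp_two hq hs
  have h1 : inner ℂ (h2.toLp φ) (h2.toLp φ) = (0 : ℂ) := by
    rw [inner_eq_integral, ← h0]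
    refine integral_congr_ae ?_
    filter_upwards [h2.coeFn_toLp] with x hx
    rw [hx, mul_comm]
  rw [inner_self_eq_zero] at h1
  have h3 : φ =ᵐ[volume] 0 := h2.coeFn_toLp.symm.trans (by rw [h1]; exact Lp.coeFn_zero ℂ 2 _)
  exact (Continuous.ae_eq_iff_eq volume h.continuous continuous_const).1 h3

theorem eq_zero_of_integral (h : BoundState q t φ f) (hq : IsWeightedHardy s q) (hs : 1 / 2 < s)
    (h0 : ∫ x, conj (q x) * φ x = 0) : φ = 0 := by
  refine h.eq_zero_of_integral_sq hq hs ?_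
  have := h.integral_mul_conj_integral hq hs
  rw [h0, zero_mul, eq_comm, mul_eq_zero] at this
  exact this.resolve_left (by simp [Real.pi_ne_zero])

theorem integral_conj_mul_ne_zero (h : BoundState q t φ f) (hq : IsWeightedHardy s q)
    (hs : 1 / 2 < s) (hφ : φ ≠ 0) : ∫ x, conj (q x) * φ x ≠ 0 :=
  fun h0 => hφ (h.eq_zero_of_integral hq hs h0)

/-- Bound states at the same energy are proportional. -/
theorem proportional (h : BoundState q t φ f) (h' : BoundState q t φ' f')
    (hq : IsWeightedHardy s q) (hs : 1 / 2 < s) :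
    ∀ x, (∫ x, conj (q x) * φ x) * φ' x = (∫ x, conj (q x) * φ' x) * φ x := by
  have hqi : Integrable q := memLp_one_iff_integrable.1 (hq.memLp_one hs)
  have hi : ∀ {φ : ℝ → ℂ} {f : L2}, BoundState q t φ f → Integrable fun x => conj (q x) * φ x :=
    fun h => (integrable_conj hqi).mul_bdd h.continuous.aestronglyMeasurable
      (Eventually.of_forall h.norm_le)
  -- This combination is a bound state whose pairing with `q̄` is zero, so the trace identity
  -- annihilates it.
  have hd := (h'.const_mul (∫ x, conj (q x) * φ x)).add (h.const_mul (-∫ x, conj (q x) * φ' x))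
  have := hd.eq_zero_of_integral hq hs (by
    have : ∀ x, conj (q x) * ((∫ x, conj (q x) * φ x) * φ' x + -(∫ x, conj (q x) * φ' x) * φ x) =
        (∫ x, conj (q x) * φ x) * (conj (q x) * φ' x) +
          -(∫ x, conj (q x) * φ' x) * (conj (q x) * φ x) := fun x => by ring
    simp_rw [this]
    rw [integral_add ((hi h').const_mul _) ((hi h).const_mul _), integral_const_mul,
      integral_const_mul]
    ring)
  intro x
  have := congrFun this x
  simp only [Pi.zero_apply] at this
  linear_combination this

theorem szego_eq_zero (h : BoundState q t φ f) (hφ : φ = 0) : f = 0 := by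
  obtain ⟨g, hg, rfl⟩ := h.exists_szego_eq
  have : g = 0 := by
    refine Lp.ext (hg.trans (EventuallyEq.trans ?_ (Lp.coeFn_zero ℂ 2 _).symm))
    exact Eventually.of_forall fun x => by simp [hφ]
  rw [this, map_zero]

theorem szego_ne_zero (h : BoundState q t φ f) (hφ : φ ≠ 0) : f ≠ 0 := by
  rintro rfl
  apply hφ
  rw [h.eq_sideConv true, sideConv_congr (G := fun _ => 0)]
  · funext x; simp [sideConv]
  · filter_upwards [Lp.coeFn_zero ℂ 2 (volume : Measure ℝ)] with x hx
    rw [hx]; simp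

end BoundState

/-! ### The kernel of `1 - C₊ q̄ R₀(z) q C₊` -/

variable {q : L2}

theorem coeFn_conjMul_sideRes (q : L2) {b : Bool} {z : ℂ} (hz : z ∈ halfPlane b) {u : L1}
    {F : ℝ → ℂ} (hF : u =ᵐ[volume] F) :
    conjMulToL2 q (sideRes b z u) =ᵐ[volume] fun x => conj (q x) * sideConv b z F x := by
  filter_upwards [coeFn_conjMulToL2 q (sideRes b z u), coeFn_sideRes hz u] with x h1 h2
  rw [h1, h2, sideConv_congr hF]

theorem sideOp_apply (q : L2) (b : Bool) (z : ℂ) (v : L2) :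
    sideOp q b z v = szego (conjMulToL2 q (sideRes b z (mulToL1 q (szego v)))) := rfl

theorem sideOp_mem (q : L2) (b : Bool) (z : ℂ) (v : L2) : sideOp q b z v ∈ hardySpace :=
  szego_mem _

theorem exists_of_sideOp_eq_self {b : Bool} {z : ℂ} (hz : z ∈ halfPlane b) {f : L2}
    (hf : sideOp q b z f = f) : f ∈ hardySpace ∧
      ∃ g : L2, (g =ᵐ[volume] fun x => conj (q x) * sideConv b z (fun x => q x * f x) x) ∧
        szego g = f := by
  have hm : f ∈ hardySpace := hf ▸ sideOp_mem q b z f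
  refine ⟨hm, conjMulToL2 q (sideRes b z (mulToL1 q (szego f))), ?_, hf⟩
  rw [szego_of_mem hm]
  exact coeFn_conjMul_sideRes q hz (coeFn_mulToL1 q f)

theorem sideOp_eq_self_of_szego {b : Bool} {z : ℂ} (hz : z ∈ halfPlane b) {f g : L2}
    (hg : g =ᵐ[volume] fun x => conj (q x) * sideConv b z (fun x => q x * f x) x)
    (hf : szego g = f) : sideOp q b z f = f := by
  have hm : f ∈ hardySpace := hf ▸ szego_mem g
  rw [sideOp_apply, szego_of_mem hm]
  conv_rhs => rw [← hf]
  congr 1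
  exact Lp.ext ((coeFn_conjMul_sideRes q hz (coeFn_mulToL1 q f)).trans hg.symm)

theorem BoundState.sideOp_eq_self {t : ℝ} {φ : ℝ → ℂ} {f : L2} (h : BoundState q t φ f)
    (b : Bool) : sideOp q b t f = f := by
  obtain ⟨g, hg, hf⟩ := h.exists_szego_eq
  refine sideOp_eq_self_of_szego (ofReal_mem_halfPlane b t) ?_ hf
  rwa [← h.eq_sideConv b]

theorem integral_sideConv_mul_of_szego {b : Bool} {z : ℂ} {f g : L2} (hfm : f ∈ hardySpace)
    (hg : g =ᵐ[volume] fun x => conj (q x) * sideConv b z (fun x => q x * f x) x)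
    (hf : szego g = f) :
    ∫ x, sideConv b z (fun x => q x * f x) x * conj (q x * f x) = inner ℂ f f := by
  rw [integral_mul_conj_mul hg]
  conv_rhs => rw [← hf, ← inner_szego_left, hf, szego_of_mem hfm]

/-- The kernel is trivial off the real axis. -/
theorem eq_zero_of_sideOp_eq_self {b : Bool} {z : ℂ} (hz : z ∈ halfPlane b) (hz' : z.im ≠ 0)
    {f : L2} (hf : sideOp q b z f = f) : f = 0 := by
  obtain ⟨hfm, g, hg, hgf⟩ := exists_of_sideOp_eq_self hz hf
  set u : ℝ → ℂ := fun x => q x * f x with hu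
  have hui : Integrable u := integrable_mul_L2 q f
  set φ := sideConv b z u with hφ
  have hφi : Integrable φ := integrable_sideConv_of_im hz hz' hui
  have hfree : FreeEq z φ u := freeEq_sideConv hz hui
  have hφc : Continuous φ := hfree.continuous hui.locallyIntegrable
  have hφb : ∀ x, ‖φ x‖ ≤ ∫ y, ‖u y‖ := norm_sideConv_le hz hui
  have hFi : Integrable (u + fun x => (z - conj z) * φ x) := hui.add (hφi.const_mul _)
  -- At the end opposite to the one where `φ` starts, the exponential at energy `conj z` decays, so
  -- boundedness of `φ` alone permits the second representation. Comparing the two leaves `(conj z -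
  -- z)‖φ‖² = 0`.
  have hshift : φ = sideConv (!b) (conj z) (u + fun x => (z - conj z) * φ x) := by
    refine (hfree.shift hui.locallyIntegrable (conj z)).eq_sideConv (conj_mem_halfPlane hz)
      hFi le_rfl ?_
    have hexp : Tendsto (fun a : ℝ => exp (-(I * conj z * a))) (sideEnd (!b)) (𝓝 0) := by
      rw [tendsto_zero_iff_norm_tendsto_zero]
      have e : ∀ a : ℝ, ‖exp (-(I * conj z * a))‖ = Real.exp (-(z.im * a)) := by
        intro a; rw [Complex.norm_exp]; simp
      simp_rw [e]
      refine Real.tendsto_exp_neg_atTop_nhds_zero.comp ?_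
      cases b
      · have : z.im < 0 := lt_of_le_of_ne (by simpa [halfPlane] using hz) hz'
        exact tendsto_id.const_mul_atBot_of_neg this
      · have : 0 < z.im := lt_of_le_of_ne (by simpa [halfPlane] using hz) hz'.symm
        exact tendsto_id.const_mul_atTop this
    rw [tendsto_zero_iff_norm_tendsto_zero] at hexp ⊢
    refine squeeze_zero (fun _ => norm_nonneg _) (fun a => ?_)
      (by simpa using hexp.mul_const (∫ y, ‖u y‖))
    rw [norm_mul]
    exact mul_le_mul_of_nonneg_left (hφb a) (norm_nonneg _)
  have h1 := integral_sideConv_mul_of_szego hfm hg hgf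
  rw [← hu, ← hφ] at h1
  have h2 := integral_sideConv_mul_conj hz hui hFi
  rw [← hshift, ← hφ] at h2
  have i1 : Integrable fun x => φ x * conj (u x) := (integrable_conj hui).bdd_mul
    hφc.aestronglyMeasurable (Eventually.of_forall hφb)
  have i2 : Integrable fun x => φ x * conj (φ x) := (integrable_conj hφi).bdd_mul
    hφc.aestronglyMeasurable (Eventually.of_forall hφb)
  have h3 : ∫ x, φ x * conj ((u + fun x => (z - conj z) * φ x) x) =
      inner ℂ f f + (conj z - z) * ∫ x, φ x * conj (φ x) := by
    rw [← h1, ← integral_const_mul, ← integral_add i1 (i2.const_mul _)]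
    refine integral_congr_ae (Eventually.of_forall fun x => ?_)
    simp only [Pi.add_apply, map_add, map_mul, map_sub, conj_conj]
    ring
  have h4 : ∫ x, u x * conj (φ x) = inner ℂ f f := by
    rw [← inner_conj_symm, ← h1, ← integral_conj]
    simp [mul_comm, hu]
  rw [h3, h4, add_eq_left, mul_eq_zero] at h2
  have h5 : ∫ x, φ x * conj (φ x) = 0 := by
    refine h2.resolve_left fun h => hz' ?_
    have := congrArg Complex.im h
    simp at this
    linarith
  have h6 : φ = 0 := by
    have hm := memLp_two_of_integrable_of_bound hφi hφb
    have h1 : inner ℂ (hm.toLp φ) (hm.toLp φ) = (0 : ℂ) := by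
      rw [inner_eq_integral, ← h5]
      refine integral_congr_ae ?_
      filter_upwards [hm.coeFn_toLp] with x hx
      rw [hx, mul_comm]
    rw [inner_self_eq_zero] at h1
    have h3 : φ =ᵐ[volume] 0 := hm.coeFn_toLp.symm.trans (by rw [h1]; exact Lp.coeFn_zero ℂ 2 _)
    exact (Continuous.ae_eq_iff_eq volume hφc continuous_const).1 h3
  rw [h6] at h1
  simpa using h1.symm

/-- On the real axis, the kernel consists of bound states. -/
theorem boundState_of_sideOp_eq_self {b : Bool} {t : ℝ} {f : L2} (hf : sideOp q b t f = f) :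
    BoundState q t (sideConv b t (fun x => q x * f x)) f := by
  have ht := ofReal_mem_halfPlane
  obtain ⟨hfm, g, hg, hgf⟩ := exists_of_sideOp_eq_self (ht b t) hf
  set u : ℝ → ℂ := fun x => q x * f x with hu
  have hui : Integrable u := integrable_mul_L2 q f
  have h1 := integral_sideConv_mul_of_szego hfm hg hgf
  rw [← hu] at h1
  -- The form of the other resolvent is the conjugate of the first, which is real. Hence the form of
  -- the jump, `i|c|²` with `c` the transform of `u` at `t`, vanishes, and the two solutions
  -- coincide.
  have h2 : ∫ x, sideConv (!b) t u x * conj (u x) = inner ℂ f f := by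
    have h3 := integral_sideConv_mul_conj (ht b t) hui hui
    rw [conj_ofReal] at h3
    rw [← inner_conj_symm, ← h1, h3, ← integral_conj]
    simp [mul_comm]
  have hi : ∀ b, Integrable fun x => sideConv b t u x * conj (u x) := fun b =>
    (integrable_conj hui).bdd_mul
      ((freeEq_sideConv (ht b t) hui).continuous hui.locallyIntegrable).aestronglyMeasurable
      (Eventually.of_forall (norm_sideConv_le (ht b t) hui))
  have h3 : ∫ x, (sideConv true t u x - sideConv false t u x) * conj (u x) = 0 := by
    simp_rw [sub_mul]
    rw [integral_sub (hi true) (hi false)]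
    cases b
    · rw [h1, show (true : Bool) = !false from rfl, h2, sub_self]
    · rw [h1, show (false : Bool) = !true from rfl, h2, sub_self]
  set c := ∫ y : ℝ, exp (-(I * t * y)) * u y with hc
  have h4 : I * c * conj c = 0 := by
    rw [← h3]
    simp_rw [sideConv_true_sub_false hui]
    rw [← hc]
    have : ∀ x : ℝ, I * exp (I * t * x) * c * conj (u x) =
        I * c * conj (exp (-(I * t * x)) * u x) := by
      intro x
      rw [map_mul _ (exp _) (u x), ← Complex.exp_conj]
      simp only [map_neg, map_mul, conj_I, conj_ofReal]
      rw [show -(-I * (t : ℂ) * x) = I * t * x by ring]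
      ring
    simp_rw [this]
    rw [integral_const_mul, integral_conj]
  have hc0 : c = 0 := by simpa using h4
  have h5 : sideConv true t u = sideConv false t u := by
    funext x
    have := sideConv_true_sub_false (t := t) hui x
    rw [← hc, hc0, mul_zero] at this
    exact sub_eq_zero.1 this
  have h6 : ∀ b', sideConv b t u = sideConv b' t u := by
    intro b'
    cases b <;> cases b' <;> simp [h5]
  refine ⟨⟨g, hg, hgf⟩, freeEq_sideConv (ht b t) hui, ?_, ?_⟩
  · rw [h6 true]
    exact tendsto_sideConv_real (b := true) hui
  · rw [h6 false]
    exact tendsto_sideConv_real (b := false) hui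

/-! ### Weak derivatives -/

theorem integrable_mul_of_hasCompactSupport {η F : ℝ → ℂ} (hη : Continuous η)
    (hc : HasCompactSupport η) (hF : LocallyIntegrable F) : Integrable fun x => η x * F x := by
  have h1 : IntegrableOn (fun x => η x * F x) (tsupport η) :=
    (hF.integrableOn_isCompact hc).continuousOn_mul hη.continuousOn hc
  refine (integrableOn_iff_integrable_of_support_subset fun x hx => ?_).1 h1
  refine subset_tsupport η fun h => hx ?_
  simp [h]

theorem tendsto_zero_of_hasCompactSupport {η : ℝ → ℂ} (hc : HasCompactSupport η) :
    Tendsto η atBot (𝓝 0) ∧ Tendsto η atTop (𝓝 0) := by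
  obtain ⟨R, hR⟩ := hc.isCompact.isBounded.subset_ball 0
  have h0 : ∀ x : ℝ, R ≤ |x| → η x = 0 := fun x hx =>
    image_eq_zero_of_notMem_tsupport fun h => by
      have := hR h
      rw [mem_ball_zero_iff, Real.norm_eq_abs] at this
      linarith
  constructor
  · refine tendsto_const_nhds.congr' ?_
    filter_upwards [tendsto_abs_atBot_atTop.eventually_ge_atTop R] with x hx
    exact (h0 x hx).symm
  · refine tendsto_const_nhds.congr' ?_
    filter_upwards [tendsto_abs_atTop_atTop.eventually_ge_atTop R] with x hx
    exact (h0 x hx).symm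

theorem FreeEq.integral_deriv_mul {φ F η : ℝ → ℂ} (h : FreeEq 0 φ F) (hF : LocallyIntegrable F)
    (hη : ContDiff ℝ ∞ η) (hc : HasCompactSupport η) :
    ∫ x, deriv η x * φ x = -∫ x, η x * (I * F x) := by
  have hφ : LocallyIntegrable φ := (h.continuous hF).locallyIntegrable
  have hd : Continuous (deriv η) := hη.continuous_deriv (by norm_num)
  have i1 := integrable_mul_of_hasCompactSupport hη.continuous hc hF
  have i2 := integrable_mul_of_hasCompactSupport hd hc.deriv hφ
  have i3 : Integrable fun x => η x * F x - I * (deriv η x * φ x) := i1.sub (i2.const_mul I)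
  have h1 := h.mul hF (g := η) (g' := deriv η)
    (fun x => (hη.differentiable (by norm_num) x).hasDerivAt) hd
  have hc' : HasCompactSupport fun x => η x * φ x := hc.mul_right
  have h2 := FreeEq.integral_eq_zero (t := 0) (φ := fun x => η x * φ x)
    (F := fun x => η x * F x - I * deriv η x * φ x) (by simpa using h1)
    (by simpa [mul_assoc] using i3)
    (tendsto_zero_of_hasCompactSupport hc').1 (tendsto_zero_of_hasCompactSupport hc').2
  simp only [ofReal_zero, mul_zero, zero_mul, neg_zero, Complex.exp_zero, one_mul, mul_assoc] at h2
  rw [integral_sub i1 (i2.const_mul I), integral_const_mul] at h2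
  have : ∀ x, η x * (I * F x) = I * (η x * F x) := fun x => by ring
  simp_rw [this]
  rw [integral_const_mul]
  linear_combination I * h2 + (∫ x, deriv η x * φ x) * I_sq

theorem exists_deriv_eq {ρ : ℝ → ℝ} (hρ : ContDiff ℝ ∞ ρ) (hc : HasCompactSupport ρ)
    (h0 : ∫ x, ρ x = 0) :
    ∃ θ : ℝ → ℝ, ContDiff ℝ ∞ θ ∧ HasCompactSupport θ ∧ ∀ x, HasDerivAt θ (ρ x) x := by
  obtain ⟨R, hR⟩ := hc.isCompact.isBounded.subset_ball 0
  have hz : ∀ x : ℝ, R ≤ |x| → ρ x = 0 := fun x hx =>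
    image_eq_zero_of_notMem_tsupport fun h => by
      have := hR h
      rw [mem_ball_zero_iff, Real.norm_eq_abs] at this
      linarith
  have hd : ∀ x, HasDerivAt (fun x => ∫ y in (-|R|)..x, ρ y) (ρ x) x := fun x =>
    (hρ.continuous.integral_hasStrictDerivAt _ x).hasDerivAt
  -- `R` may be negative if `ρ` vanishes identically, hence the absolute value.
  refine ⟨fun x => ∫ y in (-|R|)..x, ρ y, ?_, ?_, hd⟩
  · rw [contDiff_infty_iff_deriv]
    refine ⟨fun x => (hd x).differentiableAt, ?_⟩
    rwa [show deriv (fun x => ∫ y in (-|R|)..x, ρ y) = ρ from funext fun x => (hd x).deriv]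
  · refine HasCompactSupport.intro (K := Set.Icc (-|R|) |R|) isCompact_Icc fun x hx => ?_
    have hRR := le_abs_self R
    rcases lt_or_ge x (-|R|) with h | h
    · rw [intervalIntegral.integral_congr (g := fun _ => 0), intervalIntegral.integral_zero]
      intro y hy
      rw [Set.uIcc_of_ge h.le] at hy
      refine hz y (hRR.trans ?_)
      rw [abs_of_nonpos (hy.2.trans (neg_nonpos.2 (abs_nonneg R)))]
      linarith [hy.2]
    · have h2 : |R| < x := by
        by_contra hn
        exact hx ⟨h, not_lt.1 hn⟩
      rw [intervalIntegral.integral_eq_integral_of_support_subset, h0]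
      intro y hy
      by_contra hn
      refine hy (hz y ?_)
      rw [Set.mem_Ioc, not_and_or, not_lt, not_le] at hn
      rcases hn with hn | hn
      · exact hRR.trans (by rw [abs_of_nonpos (hn.trans (neg_nonpos.2 (abs_nonneg R)))]; linarith)
      · exact hRR.trans ((h2.trans hn).le.trans (le_abs_self y))

/-- The lemma of du Bois-Reymond. -/
theorem ae_eq_const_of_forall_deriv {ψ : ℝ → ℂ} (hψ : LocallyIntegrable ψ)
    (h : ∀ η : ℝ → ℂ, ContDiff ℝ ∞ η → HasCompactSupport η → ∫ x, deriv η x * ψ x = 0) :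
    ∃ c : ℂ, ψ =ᵐ[volume] fun _ => c := by
  set χ : ℝ → ℝ := (default : ContDiffBump (0 : ℝ)).normed volume with hχ
  have hχs : ContDiff ℝ ∞ χ := ContDiffBump.contDiff_normed _
  have hχc : HasCompactSupport χ := ContDiffBump.hasCompactSupport_normed _
  have hχ1 : ∫ x, χ x = 1 := ContDiffBump.integral_normed _
  have hint : ∀ g : ℝ → ℝ, Continuous g → HasCompactSupport g →
      Integrable fun x => (g x : ℂ) * ψ x := fun g hg hc =>
    integrable_mul_of_hasCompactSupport (Complex.continuous_ofReal.comp hg)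
      (hc.comp_left Complex.ofReal_zero) hψ
  refine ⟨∫ x, (χ x : ℂ) * ψ x, ae_eq_of_integral_contDiff_smul_eq hψ
    (locallyIntegrable_const _) fun g hg hgc => ?_⟩
  set m := ∫ x, g x with hm
  have hgi : Integrable g := hg.continuous.integrable_of_hasCompactSupport hgc
  have hχi : Integrable χ := hχs.continuous.integrable_of_hasCompactSupport hχc
  have hρc : HasCompactSupport fun x => m * χ x := hχc.mul_left
  -- Subtracting the multiple of the bump `χ` with the same integral makes the test function the
  -- derivative of a test function.
  obtain ⟨θ, hθ, hθc, hθd⟩ := exists_deriv_eq (ρ := fun x => g x - m * χ x)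
    (hg.sub (contDiff_const.mul hχs)) (hgc.sub hρc) (by
      rw [integral_sub hgi (hχi.const_mul m), integral_const_mul, hχ1]; simp [hm])
  have h1 := h (fun x => (θ x : ℂ)) (Complex.ofRealCLM.contDiff.comp hθ)
    (hθc.comp_left Complex.ofReal_zero)
  have h2 : ∀ x, deriv (fun x => (θ x : ℂ)) x = ((g x - m * χ x : ℝ) : ℂ) := fun x =>
    (hθd x).ofReal_comp.deriv
  simp_rw [h2] at h1
  have h3 : ∀ x, ((g x - m * χ x : ℝ) : ℂ) * ψ x = g x * ψ x - m * (χ x * ψ x) := by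
    intro x; push_cast; ring
  simp_rw [h3] at h1
  rw [integral_sub (hint g hg.continuous hgc) ((hint χ hχs.continuous hχc).const_mul _),
    integral_const_mul, sub_eq_zero] at h1
  simp_rw [Complex.real_smul]
  rw [h1, integral_mul_const, hm, integral_complex_ofReal]

/-! ### Eigenfunctions are bound states -/

variable {q : L2} {s : ℝ}

/-- The eigenvalue equation makes the weak derivative locally integrable and known; `φ` minus a
primitive of it has zero weak derivative, so it is constant, and the primitive plus this constant is
the continuous representative. -/
theorem LaxGraph.exists_freeEq {z : ℂ} {φ : L2} (h : LaxGraph q φ (z • φ)) :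
    ∃ (φ' : ℝ → ℂ) (f : L2), φ =ᵐ[volume] φ' ∧ FreeEq z φ' (fun x => q x * f x) ∧
      ∃ g : L2, (g =ᵐ[volume] fun x => conj (q x) * φ' x) ∧ szego g = f := by
  obtain ⟨-, dφ, g, hw, hg, hψ⟩ := h
  set u : ℝ → ℂ := fun x => q x * szego g x with hu
  have hui : Integrable u := integrable_mul_L2 q _
  set F : ℝ → ℂ := fun x => u x + z * φ x with hF
  have hFl : LocallyIntegrable F :=
    hui.locallyIntegrable.add ((locallyIntegrable_L2 φ).smul z)
  have hFi : ∀ a b, IntervalIntegrable F volume a b := intervalIntegrable_of_locallyIntegrable hFl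
  set Φ : ℝ → ℂ := fun x => I * ∫ y in (0 : ℝ)..x, F y with hΦ
  have hΦF : FreeEq 0 Φ F := by
    intro a b
    simp only [mul_zero, zero_mul, neg_zero, Complex.exp_zero, one_mul, hΦ]
    rw [← mul_sub, intervalIntegral.integral_interval_sub_left (hFi _ _) (hFi _ _)]
  have hΦc : Continuous Φ := hΦF.continuous hFl
  have hdφ : dφ =ᵐ[volume] fun x => I * F x := by
    filter_upwards [hψ, Lp.coeFn_smul z φ] with x h1 h2
    rw [h2, Pi.smul_apply, smul_eq_mul] at h1
    simp only [hF, hu]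
    linear_combination -I * h1 + dφ x * I_sq
  obtain ⟨c, hc⟩ := ae_eq_const_of_forall_deriv (ψ := fun x => φ x - Φ x)
    ((locallyIntegrable_L2 φ).sub hΦc.locallyIntegrable) (by
      intro η hη hηc
      have hd : Continuous (deriv η) := hη.continuous_deriv (by norm_num)
      simp_rw [mul_sub]
      rw [integral_sub (integrable_mul_of_hasCompactSupport hd hηc.deriv (locallyIntegrable_L2 φ))
        (integrable_mul_of_hasCompactSupport hd hηc.deriv hΦc.locallyIntegrable),
        hw η hη hηc, hΦF.integral_deriv_mul hFl hη hηc, sub_neg_eq_add, neg_add_eq_zero]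
      refine integral_congr_ae ?_
      filter_upwards [hdφ] with x hx
      rw [hx])
  have hφΦ : φ =ᵐ[volume] fun x => Φ x + c := by
    filter_upwards [hc] with x hx
    rw [← hx]; ring
  have h1 : FreeEq 0 (fun x => Φ x + c) (fun x => u x + z * (Φ x + c)) := by
    have : FreeEq 0 (fun x => Φ x + c) F := by
      intro a b
      rw [← hΦF a b]
      simp
    refine this.congr ?_
    filter_upwards [hφΦ] with x hx
    simp only [hF]
    rw [hx]
  refine ⟨fun x => Φ x + c, szego g, hφΦ, ?_, g, ?_, rfl⟩
  · have hl : LocallyIntegrable fun x => u x + z * (Φ x + c) :=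
      hui.locallyIntegrable.add
        ((hΦc.add continuous_const).const_smul z).locallyIntegrable
    refine (h1.shift hl z).congr (Eventually.of_forall fun x => ?_)
    simp only [hu]; ring
  · filter_upwards [hg, hφΦ] with x h2 h3
    rw [h2, h3]

/-- A square integrable function need not tend to zero, but it cannot stay away from zero near an
end of the line. Convergence along this finer filter is all that `FreeEq.eq_sideConv` asks for. -/
theorem exists_filter_tendsto_zero {φ : ℝ → ℂ} (hφ : MemLp φ 2 volume) (b : Bool) :
    (sideEnd b ⊓ comap φ (𝓝 0)).NeBot := by
  have hbasis : ∀ S ∈ sideEnd b, volume S = ⊤ := by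
    intro S hS
    cases b
    · obtain ⟨a, ha⟩ := mem_atTop_sets.1 (show S ∈ atTop from hS)
      exact top_unique (Real.volume_Ici (a := a) ▸ measure_mono ha)
    · obtain ⟨a, ha⟩ := mem_atBot_sets.1 (show S ∈ atBot from hS)
      exact top_unique (Real.volume_Iic (a := a) ▸ measure_mono ha)
  rw [inf_neBot_iff]
  rintro S hS U ⟨V, hV, hVU⟩
  obtain ⟨ε, hε, hεV⟩ := Metric.mem_nhds_iff.1 hV
  by_contra hne
  rw [Set.not_nonempty_iff_eq_empty, ← Set.disjoint_iff_inter_eq_empty] at hne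
  have h1 : S ⊆ {x | (⟨ε, hε.le⟩ : NNReal) ≤ ‖φ x‖₊} := by
    intro x hx
    by_contra hlt
    refine Set.disjoint_left.1 hne hx (hVU (hεV ?_))
    rw [mem_ball_zero_iff]
    exact not_le.1 hlt
  have h2 := hφ.meas_ge_lt_top (by norm_num) (by norm_num) (ε := ⟨ε, hε.le⟩)
    (fun h => hε.ne' (congrArg NNReal.toReal h))
  exact absurd (hbasis S hS) ((measure_mono h1).trans_lt h2).ne

/-- The eigenvalues are real, and the eigenfunctions are bound states. -/
theorem LaxGraph.exists_boundState {z : ℂ} {φ : L2} (h : LaxGraph q φ (z • φ)) (hφ : φ ≠ 0) :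
    ∃ (t : ℝ) (φ' : ℝ → ℂ) (f : L2), z = t ∧ φ =ᵐ[volume] φ' ∧ BoundState q t φ' f := by
  obtain ⟨φ', f, hφφ, hfree, g, hg, hgf⟩ := h.exists_freeEq
  have hu := integrable_mul_L2 q f
  have h2 : MemLp φ' 2 volume := (memLp_congr_ae hφφ).1 (Lp.memLp φ)
  by_cases hz : z.im = 0
  · obtain ⟨t, rfl⟩ : ∃ t : ℝ, z = t := ⟨z.re, by apply Complex.ext <;> simp [hz]⟩
    obtain ⟨hb, ht⟩ := hfree.tendsto_zero hu (by norm_num) (by norm_num) h2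
    exact ⟨t, φ', f, rfl, hφφ, ⟨g, hg, hgf⟩, hfree, hb, ht⟩
  · exfalso
    obtain ⟨b, hb⟩ : ∃ b, z ∈ halfPlane b := by
      rcases le_total 0 z.im with h | h
      · exact ⟨true, by simpa [halfPlane] using h⟩
      · exact ⟨false, by simpa [halfPlane] using h⟩
    -- At nonreal energy the solution is then the free resolvent of its source, so `f` lies in a
    -- kernel already known to be trivial.
    have := exists_filter_tendsto_zero h2 b
    have e : φ' = sideConv b z fun x => q x * f x :=
      hfree.eq_sideConv hb hu (l := sideEnd b ⊓ comap φ' (𝓝 0)) inf_le_left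
        (tendsto_exp_mul_zero_of_mem_halfPlane hb inf_le_left
          (tendsto_comap.mono_left inf_le_right))
    have hf0 : f = 0 := eq_zero_of_sideOp_eq_self hb hz
      (sideOp_eq_self_of_szego hb (by rwa [← e]) hgf)
    apply hφ
    refine Lp.ext (hφφ.trans ?_)
    rw [e, sideConv_congr (G := fun _ => 0)]
    · filter_upwards [Lp.coeFn_zero ℂ 2 (volume : Measure ℝ)] with x hx
      rw [hx]; simp [sideConv]
    · rw [hf0]
      filter_upwards [Lp.coeFn_zero ℂ 2 (volume : Measure ℝ)] with x hx
      rw [hx]; simp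

/-! ### Bound states are eigenfunctions -/

namespace BoundState

variable {t : ℝ} {φ : ℝ → ℂ} {f : L2}

/-- This is what puts bound states in `H¹`; it is not automatic, as `q` and `f` are only square
integrable. Rewritten at energy `iκ` with `κ` large, the equation makes `f` the `L²` limit of a
Picard iteration. Hardy's inequality bounds `q` times the iterates uniformly in `L²`, and Fatou's
lemma along an almost everywhere convergent subsequence transfers the bound to `qf`. -/
theorem memLp_mul (h : BoundState q t φ f) (hq : IsWeightedHardy s q) (hs : 1 / 2 < s) :
    MemLp (fun x => q x * f x) 2 volume := by
  obtain ⟨κ, ⟨hκ0, hκ⟩, hκ1⟩ := ((eventually_eLpNorm_le hq.mem_hardy).and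
    ((tendsto_sideOp_imaginary q).norm.eventually
      (gt_mem_nhds (show ‖(0 : L2 →L[ℂ] L2)‖ < 1 by simp)))).exists
  have hmem : I * (κ : ℂ) ∈ halfPlane true := by simpa [halfPlane] using hκ0.le
  set T := sideOp q true (I * κ) with hT
  have hφ1 := h.integrable hq hs
  have hφ2 := h.memLp_two hq hs
  set χ₀ : ℝ → ℂ := fun x => (t - I * κ) * φ x with hχ₀
  have hχ1 : Integrable χ₀ := hφ1.const_mul _
  have hχ2 : MemLp χ₀ 2 volume := hφ2.const_mul _
  set D := eLpNorm χ₀ 2 volume with hD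
  have hDt : D ≠ ⊤ := hχ2.2.ne
  have hχL1 : MemLp χ₀ 1 volume := memLp_one_iff_integrable.2 hχ1
  set b₀ : L2 := szego (conjMulToL2 q (sideRes true (I * κ) hχL1.toLp)) with hb₀
  have step : ∀ v ∈ hardySpace, ∃ g : L2,
      (g =ᵐ[volume] fun x => conj (q x) * sideConv true (I * κ) (fun x => q x * v x + χ₀ x) x) ∧
        szego g = T v + b₀ := by
    intro v hv
    refine ⟨conjMulToL2 q (sideRes true (I * κ) (mulToL1 q v + hχL1.toLp)), ?_, ?_⟩
    · refine coeFn_conjMul_sideRes q hmem ?_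
      filter_upwards [Lp.coeFn_add (mulToL1 q v) hχL1.toLp, coeFn_mulToL1 q v,
        hχL1.coeFn_toLp] with x h1 h2 h3
      rw [h1, Pi.add_apply, h2, h3]
    · rw [map_add, map_add, map_add, hT, sideOp_apply, szego_of_mem hv]
  have hfix : T f + b₀ = f := by
    obtain ⟨g, hg, hgf⟩ := step f h.mem_hardy
    obtain ⟨g', hg', hgf'⟩ := h.exists_szego_eq
    have e : φ = sideConv true (I * κ) (fun x => q x * f x + χ₀ x) :=
      h.eq_sideConv_shift hq hs hmem
    rw [← e] at hg
    rw [← hgf, Lp.ext (hg.trans hg'.symm), hgf']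
  let F : ℕ → L2 := fun n => (fun v => T v + b₀)^[n] 0
  have hF : ∀ n, F (n + 1) = T (F n) + b₀ := fun n => Function.iterate_succ_apply' _ n 0
  have hFm : ∀ n, F n ∈ hardySpace := by
    intro n
    cases n with
    | zero => exact hardySpace.zero_mem
    | succ n =>
      rw [hF]
      exact hardySpace.add_mem (sideOp_mem _ _ _ _) (szego_mem _)
  -- The contraction constant `1/2` reproduces the bound: `(D + D) / 2 = D`.
  have hbound : ∀ n, eLpNorm (fun x => q x * F n x) 2 volume ≤ D := by
    intro n
    induction n with
    | zero =>
      have : (fun x => q x * F 0 x) =ᵐ[volume] 0 := by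
        filter_upwards [Lp.coeFn_zero ℂ 2 (volume : Measure ℝ)] with x hx
        change q x * (0 : L2) x = 0
        rw [hx]; simp
      rw [eLpNorm_congr_ae this]; simp
    | succ n ih =>
      obtain ⟨g, hg, hgf⟩ := step (F n) (hFm n)
      have hm : MemLp (fun x => q x * F n x) 2 volume :=
        ⟨(integrable_mul_L2 q (F n)).aestronglyMeasurable, ih.trans_lt hDt.lt_top⟩
      rw [hF, ← hgf]
      refine (hκ _ ((integrable_mul_L2 q (F n)).add hχ1) (hm.add hχ2) g hg).trans ?_
      calc (2 : ℝ≥0∞)⁻¹ * eLpNorm ((fun x => q x * F n x) + χ₀) 2 volume ≤ 2⁻¹ * (D + D) := by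
            gcongr
            exact (eLpNorm_add_le hm.1 hχ2.1 (by norm_num)).trans (by gcongr)
        _ = D := by
            rw [← two_mul, ← mul_assoc, ENNReal.inv_mul_cancel (by norm_num) (by norm_num), one_mul]
  have hconv : Tendsto F atTop (𝓝 f) := by
    have hle : ∀ n, ‖F n - f‖ ≤ ‖T‖ ^ n * ‖f‖ := by
      intro n
      induction n with
      | zero => simp [F]
      | succ n ih =>
        have : F (n + 1) - f = T (F n - f) := by
          rw [hF, map_sub]
          nth_rewrite 1 [← hfix]
          abel
        rw [this, pow_succ', mul_assoc]
        exact (T.le_opNorm _).trans (mul_le_mul_of_nonneg_left ih (norm_nonneg _))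
    rw [tendsto_iff_norm_sub_tendsto_zero]
    refine squeeze_zero (fun _ => norm_nonneg _) hle ?_
    simpa using (tendsto_pow_atTop_nhds_zero_of_lt_one (norm_nonneg T) hκ1).mul_const ‖f‖
  obtain ⟨ns, -, hns⟩ := (tendstoInMeasure_of_tendsto_Lp hconv).exists_seq_tendsto_ae
  refine ⟨(integrable_mul_L2 q f).aestronglyMeasurable, ?_⟩
  refine (Lp.eLpNorm_lim_le_liminf_eLpNorm (f := fun n x => q x * F (ns n) x)
    (fun n => (integrable_mul_L2 q (F (ns n))).aestronglyMeasurable) _ ?_).trans_lt ?_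
  · filter_upwards [hns] with x hx
    exact hx.const_mul _
  · refine lt_of_le_of_lt ?_ hDt.lt_top
    exact liminf_le_of_le (by isBoundedDefault) fun b hb => by
      obtain ⟨n, hn⟩ := hb.exists
      exact hn.trans (hbound _)

theorem laxGraph (h : BoundState q t φ f) (hq : IsWeightedHardy s q) (hs : 1 / 2 < s) :
    LaxGraph q ((h.memLp_two hq hs).toLp φ) ((t : ℂ) • (h.memLp_two hq hs).toLp φ) := by
  have h2 := h.memLp_two hq hs
  have hu := integrable_mul_L2 q f
  have hD : MemLp (fun x => I * (q x * f x + t * φ x)) 2 volume :=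
    ((h.memLp_mul hq hs).add (h2.const_mul (t : ℂ))).const_mul I
  obtain ⟨g, hg, hgf⟩ := h.exists_szego_eq
  refine ⟨h.toLp_mem_hardySpace hq hs, hD.toLp, g, ?_, ?_, ?_⟩
  · intro η hη hc
    have hF : LocallyIntegrable fun x => q x * f x + (t - 0) * φ x :=
      (hu.add ((h.integrable hq hs).const_mul _)).locallyIntegrable
    have h1 := (h.freeEq.shift hu.locallyIntegrable 0).integral_deriv_mul hF hη hc
    have e1 : ∫ x, deriv η x * (h2.toLp φ : L2) x = ∫ x, deriv η x * φ x := by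
      refine integral_congr_ae ?_
      filter_upwards [h2.coeFn_toLp] with x hx
      rw [hx]
    have e2 : ∫ x, η x * (hD.toLp _ : L2) x = ∫ x, η x * (I * (q x * f x + (t - 0) * φ x)) := by
      refine integral_congr_ae ?_
      filter_upwards [hD.coeFn_toLp] with x hx
      rw [hx, sub_zero]
    rw [e1, h1, e2]
  · filter_upwards [hg, h2.coeFn_toLp] with x h3 h4
    rw [h3, h4]
  · filter_upwards [Lp.coeFn_smul (t : ℂ) (h2.toLp φ), h2.coeFn_toLp, hD.coeFn_toLp]
      with x h3 h4 h5
    rw [h3, Pi.smul_apply, h4, h5, hgf, smul_eq_mul]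
    linear_combination (q x * f x + t * φ x) * I_sq

theorem mem_pointSpectrum (h : BoundState q t φ f) (hq : IsWeightedHardy s q) (hs : 1 / 2 < s)
    (hφ : φ ≠ 0) : (t : ℂ) ∈ pointSpectrum q := by
  refine ⟨_, fun h0 => hφ ?_, h.laxGraph hq hs⟩
  have h3 : φ =ᵐ[volume] 0 :=
    (h.memLp_two hq hs).coeFn_toLp.symm.trans (by rw [h0]; exact Lp.coeFn_zero ℂ 2 _)
  exact (Continuous.ae_eq_iff_eq volume h.continuous continuous_const).1 h3

end BoundState

/-! ### Finiteness of the point spectrum -/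

variable {q : L2} {s : ℝ}

theorem pointSpectrum_eq (hq : IsWeightedHardy s q) (hs : 1 / 2 < s) :
    pointSpectrum q = Complex.ofReal '' {t | ∃ φ f, BoundState q t φ f ∧ φ ≠ 0} := by
  ext z
  constructor
  · rintro ⟨φ, hφ, h⟩
    obtain ⟨t, φ', f, rfl, he, hb⟩ := h.exists_boundState hφ
    refine ⟨t, ⟨φ', f, hb, ?_⟩, rfl⟩
    rintro rfl
    exact hφ (Lp.ext (he.trans (Lp.coeFn_zero ℂ 2 _).symm))
  · rintro ⟨t, ⟨φ, f, hb, hφ⟩, rfl⟩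
    exact hb.mem_pointSpectrum hq hs hφ

theorem integral_mul_conj_eq_conj (q φ : ℝ → ℂ) :
    ∫ x, q x * conj (φ x) = conj (∫ x, conj (q x) * φ x) := by
  rw [← integral_conj]; simp

theorem BoundState.exists_normalised {t : ℝ} {φ : ℝ → ℂ} {f : L2} (h : BoundState q t φ f)
    (hφ : φ ≠ 0) (hq : IsWeightedHardy s q) (hs : 1 / 2 < s) :
    ∃ φ' f', BoundState q t φ' f' ∧ ∫ x, q x * conj (φ' x) = 2 * Real.pi * I := by
  have hc := h.integral_conj_mul_ne_zero hq hs hφ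
  refine ⟨_, _, h.const_mul (-(2 * Real.pi * I) / ∫ x, conj (q x) * φ x), ?_⟩
  rw [integral_mul_conj_eq_conj]
  have : ∀ x, conj (q x) * (-(2 * Real.pi * I) / (∫ x, conj (q x) * φ x) * φ x) =
      -(2 * Real.pi * I) / (∫ x, conj (q x) * φ x) * (conj (q x) * φ x) := fun x => by ring
  simp_rw [this]
  rw [integral_const_mul, div_mul_cancel₀ _ hc]
  simp [map_ofNat]

/-- The normalisation `∫ q conj φ = 2πi` fixes the norm of a bound state. -/
theorem BoundState.integral_sq {t : ℝ} {φ : ℝ → ℂ} {f : L2} (h : BoundState q t φ f)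
    (hn : ∫ x, q x * conj (φ x) = 2 * Real.pi * I) (hq : IsWeightedHardy s q) (hs : 1 / 2 < s) :
    ∫ x, φ x * conj (φ x) = 2 * Real.pi := by
  have h1 := h.integral_mul_conj_integral hq hs
  rw [integral_mul_conj_eq_conj] at hn
  have h2 : ∫ x, conj (q x) * φ x = -(2 * Real.pi * I) := by
    rw [← conj_conj (∫ x, conj (q x) * φ x), hn]; simp [map_ofNat]
  rw [hn, h2] at h1
  have hpi : (2 * Real.pi : ℂ) ≠ 0 := by simp [Real.pi_ne_zero]
  refine mul_left_cancel₀ hpi ?_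
  rw [← h1]
  linear_combination (-(2 * Real.pi) ^ 2 : ℂ) * I_sq

/-- Bessel's inequality for `q`: after division by `√(2π)` the bound states are orthonormal, and by
the trace identity each accounts for exactly `2π` of `‖q‖²`. -/
theorem finite_boundState (hq : IsWeightedHardy s q) (hs : 1 / 2 < s) :
    {t | ∃ φ f, BoundState q t φ f ∧ φ ≠ 0}.Finite := by
  set S := {t | ∃ φ f, BoundState q t φ f ∧ φ ≠ 0}
  have hex : ∀ t : S, ∃ φ f, BoundState q t φ f ∧ ∫ x, q x * conj (φ x) = 2 * Real.pi * I := by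
    rintro ⟨t, φ, f, h, hφ⟩
    exact h.exists_normalised hφ hq hs
  choose φ f hb hn using hex
  set c : ℝ := (Real.sqrt (2 * Real.pi))⁻¹ with hc
  have hcc : c * c * (2 * Real.pi) = 1 := by
    rw [hc, ← mul_inv, Real.mul_self_sqrt (by positivity)]
    exact inv_mul_cancel₀ (by positivity)
  set Φ : S → L2 := fun t => ((hb t).memLp_two hq hs).toLp (φ t) with hΦ
  have hΦe : ∀ t, Φ t =ᵐ[volume] φ t := fun t => MemLp.coeFn_toLp _
  have hin : ∀ t t', inner ℂ (Φ t) (Φ t') = if t = t' then (2 * Real.pi : ℂ) else 0 := by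
    intro t t'
    have : inner ℂ (Φ t) (Φ t') = ∫ x, φ t' x * conj (φ t x) := by
      rw [inner_eq_integral]
      refine integral_congr_ae ?_
      filter_upwards [hΦe t, hΦe t'] with x h1 h2
      rw [h1, h2, mul_comm]
    rw [this]
    split_ifs with h
    · subst h
      exact (hb t).integral_sq (hn t) hq hs
    · exact (hb t').orthogonal (hb t) (fun e => h (Subtype.ext e.symm)) hq hs
  have hon : Orthonormal ℂ fun t => (c : ℂ) • Φ t := by
    classical
    rw [orthonormal_iff_ite]
    intro t t'
    rw [inner_smul_left, inner_smul_right, hin, conj_ofReal]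
    split_ifs
    · rw [← mul_assoc]; exact_mod_cast hcc
    · simp
  have hq' : ∀ t, ‖inner ℂ ((c : ℂ) • Φ t) q‖ ^ 2 = 2 * Real.pi := by
    intro t
    have : inner ℂ (Φ t) q = 2 * Real.pi * I := by
      rw [inner_eq_integral, ← hn t]
      refine integral_congr_ae ?_
      filter_upwards [hΦe t] with x h1
      rw [h1, mul_comm]
    rw [inner_smul_left, this, conj_ofReal]
    simp only [norm_mul, Complex.norm_real, Complex.norm_I, Real.norm_eq_abs, mul_one,
      Complex.norm_ofNat, abs_of_pos Real.pi_pos]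
    rw [mul_pow, sq_abs]
    linear_combination (2 * Real.pi) * hcc
  by_contra hinf
  have : Infinite S := Set.infinite_coe_iff.2 hinf
  obtain ⟨n, hn⟩ := exists_nat_gt (‖q‖ ^ 2 / (2 * Real.pi))
  obtain ⟨A, hA⟩ := Infinite.exists_subset_card_eq S n
  have h1 := hon.sum_inner_products_le (x := q) (s := A)
  simp_rw [hq'] at h1
  rw [Finset.sum_const, hA, nsmul_eq_mul] at h1
  rw [div_lt_iff₀ (by positivity)] at hn
  linarith

theorem exists_eigenSystem (hq : IsWeightedHardy s q) (hs : 1 / 2 < s) :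
    ∃ (N : ℕ) (ev : Fin N → ℝ) (φ : Fin N → L2), IsEigenSystem q ev φ := by
  have hfin := finite_boundState hq hs
  set e := hfin.toFinset.equivFin
  have hmem : ∀ j, ((e.symm j : ℝ)) ∈ {t | ∃ φ f, BoundState q t φ f ∧ φ ≠ 0} := fun j =>
    hfin.mem_toFinset.1 (e.symm j).2
  have hex : ∀ j, ∃ φ f, BoundState q (e.symm j : ℝ) φ f ∧
      ∫ x, q x * conj (φ x) = 2 * Real.pi * I := by
    intro j
    obtain ⟨φ, f, h, hφ⟩ := hmem j
    exact h.exists_normalised hφ hq hs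
  choose φ f hb hn using hex
  refine ⟨hfin.toFinset.card, fun j => e.symm j, fun j => ((hb j).memLp_two hq hs).toLp (φ j),
    ?_, ?_, fun j => (hb j).laxGraph hq hs, fun j => ?_⟩
  · exact Subtype.val_injective.comp e.symm.injective
  · rw [pointSpectrum_eq hq hs]
    ext z
    constructor
    · rintro ⟨j, rfl⟩
      exact ⟨_, hmem j, rfl⟩
    · rintro ⟨t, ht, rfl⟩
      exact ⟨e ⟨t, hfin.mem_toFinset.2 ht⟩, by simp⟩
  · rw [← hn j]
    refine integral_congr_ae ?_
    filter_upwards [((hb j).memLp_two hq hs).coeFn_toLp] with x hx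
    rw [hx]

/-- A complete system of normalised bound states. -/
structure BoundSystem (q : L2) {N : ℕ} (ev : Fin N → ℝ) (φ : Fin N → ℝ → ℂ) (f : Fin N → L2) :
    Prop where
  injective : Function.Injective ev
  boundState : ∀ j, BoundState q (ev j) (φ j) (f j)
  normalised : ∀ j, ∫ x, q x * conj (φ j x) = 2 * Real.pi * I
  complete : ∀ {t ψ g}, BoundState q t ψ g → ψ ≠ 0 → ∃ j, ev j = t

theorem IsEigenSystem.exists_boundSystem {N : ℕ} {ev : Fin N → ℝ} {Φ : Fin N → L2}
    (h : IsEigenSystem q ev Φ) (hq : IsWeightedHardy s q) (hs : 1 / 2 < s) :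
    ∃ φ f, BoundSystem q ev φ f ∧ ∀ j, Φ j =ᵐ[volume] φ j := by
  have hex : ∀ j, ∃ φ f, BoundState q (ev j) φ f ∧ Φ j =ᵐ[volume] φ := by
    intro j
    have hne : Φ j ≠ 0 := by
      intro h0
      have h1 := h.normalised j
      have h2 : ∫ x, q x * conj (Φ j x) = 0 := by
        rw [← integral_zero ℝ ℂ]
        refine integral_congr_ae ?_
        filter_upwards [Lp.coeFn_zero ℂ 2 (volume : Measure ℝ)] with x hx
        rw [h0, hx]; simp
      rw [h2] at h1
      simp [Real.pi_ne_zero] at h1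
    obtain ⟨t, φ, f, ht, he, hb⟩ := (h.eigen j).exists_boundState hne
    obtain rfl : ev j = t := by exact_mod_cast ht
    exact ⟨φ, f, hb, he⟩
  choose φ f hb he using hex
  refine ⟨φ, f, ⟨h.injective, hb, fun j => ?_, fun {t ψ g} hψ hne => ?_⟩, he⟩
  · rw [← h.normalised j]
    refine integral_congr_ae ?_
    filter_upwards [he j] with x hx
    rw [hx]
  · have := hψ.mem_pointSpectrum hq hs hne
    rw [← h.range_eq] at this
    obtain ⟨j, hj⟩ := this
    exact ⟨j, Complex.ofReal_injective hj⟩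

/-! ### The regularised equation -/

theorem integrable_mul_LInf (h : LInf) {g : ℝ → ℂ} (hg : Integrable g) :
    Integrable fun x => h x * g x :=
  memLp_one_iff_integrable.1 ((memLp_one_iff_integrable.2 hg).mul (Lp.memLp h))

theorem norm_integral_mul_le (h : LInf) (g : L1) : ‖∫ x, h x * g x‖ ≤ ‖g‖ * ‖h‖ := by
  rw [L1.norm_eq_integral_norm, ← integral_mul_const]
  refine norm_integral_le_of_norm_le ((L1.integrable_coeFn g).norm.mul_const _) ?_
  have h1 : ∀ᵐ x, ‖h x‖ ≤ ‖h‖ := by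
    filter_upwards [ae_le_eLpNormEssSup (f := h) (μ := volume)] with x hx
    rw [Lp.norm_def, eLpNorm_exponent_top, ← toReal_enorm]
    refine ENNReal.toReal_mono ?_ hx
    rw [← eLpNorm_exponent_top]
    exact Lp.eLpNorm_ne_top h
  filter_upwards [h1] with x hx
  rw [norm_mul, mul_comm]
  exact mul_le_mul_of_nonneg_left hx (norm_nonneg _)

/-- The functional `h ↦ ∫ h g` on `L^∞`. -/
def pairing (g : L1) : LInf →L[ℂ] ℂ :=
  LinearMap.mkContinuous
    { toFun := fun h => ∫ x, h x * g x
      map_add' := by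
        intro h k
        rw [← integral_add (integrable_mul_LInf h (L1.integrable_coeFn g))
          (integrable_mul_LInf k (L1.integrable_coeFn g))]
        refine integral_congr_ae ?_
        filter_upwards [Lp.coeFn_add h k] with x hx
        rw [hx, Pi.add_apply, add_mul]
      map_smul' := by
        intro c h
        rw [RingHom.id_apply, smul_eq_mul, ← integral_const_mul]
        refine integral_congr_ae ?_
        filter_upwards [Lp.coeFn_smul c h] with x hx
        rw [hx, Pi.smul_apply, smul_eq_mul, mul_assoc] }
    ‖g‖ fun h => norm_integral_mul_le h g

theorem pairing_apply (g : L1) (h : LInf) : pairing g h = ∫ x, h x * g x := rfl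

/-- The operator `q C₊`. -/
def mulSzego (q : L2) : L2 →L[ℂ] L1 := mulToL1 q ∘L szego

theorem coeFn_mulSzego {q v : L2} (hv : v ∈ hardySpace) :
    mulSzego q v =ᵐ[volume] fun x => q x * v x := by
  have := coeFn_mulToL1 q (szego v)
  rw [szego_of_mem hv] at this
  simpa [mulSzego, szego_of_mem hv] using this

/-- The sign `∓i` used on the two sides. -/
def sideSign (b : Bool) : ℂ := if b then -I else I

section

variable {q : L2} {s : ℝ} {N : ℕ} {ev : Fin N → ℝ} {φ : Fin N → ℝ → ℂ} {f : Fin N → L2}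

theorem BoundSystem.memLp_conj (hB : BoundSystem q ev φ f) (hq : IsWeightedHardy s q)
    (hs : 1 / 2 < s) (j : Fin N) : MemLp (fun x => conj (φ j x)) 1 volume :=
  memLp_one_iff_integrable.2 (integrable_conj ((hB.boundState j).integrable hq hs))

/-- The functional `u ↦ ∫ R₀(z) u conj φⱼ`. -/
def coeffFunctional (w : L1) (b : Bool) (z : ℂ) : L1 →L[ℂ] ℂ := pairing w ∘L sideRes b z

/-- The operator `C₊ q̄ R₀(z)` regularised by a finite rank term. -/
def regularOp (q : L2) (w : Fin N → L1) (f : Fin N → L2) (b : Bool) (z : ℂ) : L1 →L[ℂ] L2 :=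
  szego ∘L conjMulToL2 q ∘L sideRes b z -
    ∑ j, (sideSign b • coeffFunctional (w j) b z).smulRight (f j)

theorem regularOp_apply (q : L2) (w : Fin N → L1) (f : Fin N → L2) (b : Bool) (z : ℂ) (u : L1) :
    regularOp q w f b z u = szego (conjMulToL2 q (sideRes b z u)) -
      ∑ j, (sideSign b * pairing (w j) (sideRes b z u)) • f j := by
  simp [regularOp, coeffFunctional]

theorem continuousOn_regularOp_apply (q : L2) (w : Fin N → L1) (f : Fin N → L2) (b : Bool)
    (u : L1) : ContinuousOn (fun z => regularOp q w f b z u) (halfPlane b) := by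
  simp_rw [regularOp_apply]
  refine (szego.continuous.comp_continuousOn (continuousOn_conjMul_sideRes q b u)).sub
    (continuousOn_finsetSum _ fun j _ => ?_)
  have h : ContinuousOn (fun z => pairing (w j) (sideRes b z u)) (halfPlane b) :=
    continuousOn_integral_sideRes_mul b u (L1.integrable_coeFn (w j))
  exact (h.const_smul (sideSign b)).smul (continuousOn_const (c := f j))

theorem isCompactOperator_regularOp (q : L2) (w : Fin N → L1) (f : Fin N → L2) {b : Bool} {z : ℂ}
    (hz : z ∈ halfPlane b) : IsCompactOperator (regularOp q w f b z ∘L mulSzego q) := by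
  have e : regularOp q w f b z ∘L mulSzego q = sideOp q b z -
      ∑ j, (sideSign b • (coeffFunctional (w j) b z ∘L mulSzego q)).smulRight (f j) := by
    ext1 v
    simp only [ContinuousLinearMap.comp_apply, regularOp_apply, _root_.sub_apply,
      _root_.sum_apply, ContinuousLinearMap.smulRight_apply, _root_.smul_apply,
      coeffFunctional, smul_eq_mul]
    rfl
  rw [e]
  exact (isCompactOperator_sideOp q hz).sub
    (isCompactOperator_sum _ fun j _ => isCompactOperator_smulRight _ _)

/-- The functional `u ↦ ∫ R₀(z) (q C₊ v) conj φⱼ` depends continuously on `z`, in norm. -/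
theorem continuousOn_coeffFunctional {q : L2} {w : L1} (b : Bool) :
    ContinuousOn (fun z => coeffFunctional w b z ∘L mulSzego q) (halfPlane b) := by
  have hwc : MemLp (fun x => conj (w x)) 1 volume :=
    memLp_conj (Lp.memLp w)
  -- Moving the resolvent onto `w` exhibits the functional as an inner product with a vector that
  -- depends continuously on `z`, so pointwise continuity becomes continuity in norm.
  have hmap : ∀ z ∈ halfPlane b, coeffFunctional w b z ∘L mulSzego q =
      (innerSL ℂ (conjMulToL2 q (sideRes (!b) (conj z) hwc.toLp))) ∘L szego := by
    intro z hz
    have hz' := conj_mem_halfPlane hz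
    ext1 v
    have hu := integrable_mul_L2 q (szego v)
    have hw := L1.integrable_coeFn w
    have h1 := integral_sideConv_mul_conj hz hu (integrable_conj hw)
    simp only [conj_conj] at h1
    rw [ContinuousLinearMap.comp_apply, ContinuousLinearMap.comp_apply, innerSL_apply_apply,
      inner_eq_integral, coeffFunctional, ContinuousLinearMap.comp_apply, pairing_apply]
    have h2 : ∫ x, sideRes b z (mulSzego q v) x * w x =
        ∫ x, sideConv b z (fun x => q x * szego v x) x * w x := by
      refine integral_congr_ae ?_
      have hc : sideConv b z (mulSzego q v) = sideConv b z (fun x => q x * szego v x) :=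
        sideConv_congr (coeFn_mulToL1 q (szego v))
      filter_upwards [coeFn_sideRes hz (mulSzego q v)] with x hx
      rw [hx, hc]
    rw [h2, h1]
    refine integral_congr_ae ?_
    filter_upwards [coeFn_conjMul_sideRes q hz' hwc.coeFn_toLp] with x hx
    rw [hx, map_mul, conj_conj]; ring
  refine ContinuousOn.congr ?_ hmap
  have hc : ContinuousOn (fun z => conjMulToL2 q (sideRes (!b) (conj z) hwc.toLp))
      (halfPlane b) :=
    (continuousOn_conjMul_sideRes q (!b) hwc.toLp).comp Complex.continuous_conj.continuousOn
      fun z hz => conj_mem_halfPlane hz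
  exact ((innerSL ℂ (E := L2)).continuous.comp_continuousOn hc).clm_comp continuousOn_const

theorem continuousOn_regularOp (q : L2) (w : Fin N → L1) (f : Fin N → L2) (b : Bool) :
    ContinuousOn (fun z => regularOp q w f b z ∘L mulSzego q) (halfPlane b) := by
  have e : ∀ z, regularOp q w f b z ∘L mulSzego q = sideOp q b z -
      ∑ j, (sideSign b • (coeffFunctional (w j) b z ∘L mulSzego q)).smulRight (f j) := by
    intro z
    ext1 v
    simp only [ContinuousLinearMap.comp_apply, regularOp_apply, _root_.sub_apply,
      _root_.sum_apply, ContinuousLinearMap.smulRight_apply, _root_.smul_apply,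
      coeffFunctional, smul_eq_mul]
    rfl
  simp_rw [e]
  refine (continuousOn_sideOp q b).sub (continuousOn_finsetSum _ fun j _ => ?_)
  have h1 := (continuousOn_coeffFunctional (q := q) (w := w j) b).const_smul (sideSign b)
  have h2 : Continuous fun ℓ : L2 →L[ℂ] ℂ => ℓ.smulRight (f j) :=
    ((ContinuousLinearMap.smulRightL ℂ L2 L2).flip (f j)).continuous
  exact h2.comp_continuousOn h1

/-! ### Solvability -/

/-- The source term `q - i ∑ⱼ φⱼ`. -/
def source (q : L2) (φ : Fin N → ℝ → ℂ) (x : ℝ) : ℂ := q x - I * ∑ j, φ j x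

namespace BoundSystem

theorem integrable_source (hB : BoundSystem q ev φ f) (hq : IsWeightedHardy s q)
    (hs : 1 / 2 < s) : Integrable (source q φ) := by
  have hqi : Integrable q := memLp_one_iff_integrable.1 (hq.memLp_one hs)
  exact hqi.sub ((integrable_finsetSum _ fun j _ =>
    (hB.boundState j).integrable hq hs).const_mul I)

theorem integral_mul_conj_eq (hB : BoundSystem q ev φ f) (hq : IsWeightedHardy s q)
    (hs : 1 / 2 < s) (i j : Fin N) :
    ∫ x, φ i x * conj (φ j x) = if i = j then (2 * Real.pi : ℂ) else 0 := by
  split_ifs with h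
  · subst h
    exact (hB.boundState i).integral_sq (hB.normalised i) hq hs
  · exact (hB.boundState i).orthogonal (hB.boundState j) (fun e => h (hB.injective e)) hq hs

theorem integrable_mul_conj (hB : BoundSystem q ev φ f) {u : ℝ → ℂ} (hu : Integrable u) (j : Fin N) :
    Integrable fun x => u x * conj (φ j x) :=
  hu.mul_bdd (hB.boundState j).continuous.star.aestronglyMeasurable
    (Eventually.of_forall fun x => (by simpa using (hB.boundState j).norm_le x))

/-- This is the solvability condition at the eigenvalues. The normalisation makes it hold: `2πi -
i‖φᵢ‖² = 0`, with `‖φᵢ‖² = 2π` by the trace identity. -/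
theorem integral_source_mul_conj (hB : BoundSystem q ev φ f) (hq : IsWeightedHardy s q)
    (hs : 1 / 2 < s) (i : Fin N) : ∫ x, source q φ x * conj (φ i x) = 0 := by
  have hqi : Integrable q := memLp_one_iff_integrable.1 (hq.memLp_one hs)
  have e : ∀ x, source q φ x * conj (φ i x) =
      q x * conj (φ i x) - I * ∑ j, φ j x * conj (φ i x) := by
    intro x
    rw [source, sub_mul, mul_assoc, Finset.sum_mul]
  have hi : ∀ j, Integrable fun x => φ j x * conj (φ i x) := fun j =>
    hB.integrable_mul_conj ((hB.boundState j).integrable hq hs) i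
  simp_rw [e]
  rw [integral_sub (hB.integrable_mul_conj hqi i)
    ((integrable_finsetSum _ fun j _ => hi j).const_mul I), integral_const_mul,
    integral_finsetSum _ fun j _ => hi j, hB.normalised]
  simp_rw [hB.integral_mul_conj_eq hq hs]
  simp only [Finset.sum_ite_eq', Finset.mem_univ, if_true]
  ring

theorem ne_zero (hB : BoundSystem q ev φ f) (hq : IsWeightedHardy s q)
    (hs : 1 / 2 < s) (j : Fin N) : φ j ≠ 0 := by
  intro h
  have := hB.integral_mul_conj_eq hq hs j j
  simp [h, Real.pi_ne_zero] at this

/-- Pairing the equation with `φᵢ` eliminates the source, so the coefficient along `φᵢ` only feels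
the defect `v - C₊g` in the equation for `v`. -/
theorem sub_mul_coeff (hB : BoundSystem q ev φ f) (hq : IsWeightedHardy s q)
    (hs : 1 / 2 < s) {b : Bool} {z : ℂ} (hz : z ∈ halfPlane b) {v g : L2} (hv : v ∈ hardySpace)
    {F : ℝ → ℂ} (hF : Integrable F) {c : ℂ}
    (hFe : F =ᵐ[volume] fun x => q x * v x + c * source q φ x)
    (hg : g =ᵐ[volume] fun x => conj (q x) * sideConv b z F x) (i : Fin N) :
    (ev i - z) * ∫ x, sideConv b z F x * conj (φ i x) = inner ℂ (f i) (v - szego g) := by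
  have h1 := (hB.boundState i).integral_mul_conj hq hs hz hF
  rw [integral_mul_conj_mul hg] at h1
  have h2 : ∫ x, F x * conj (φ i x) = inner ℂ (f i) v := by
    rw [← (hB.boundState i).integral_self_mul hv]
    have e1 : ∫ x, F x * conj (φ i x) =
        ∫ x, (q x * v x * conj (φ i x) + c * (source q φ x * conj (φ i x))) := by
      refine integral_congr_ae ?_
      filter_upwards [hFe] with x hx
      rw [hx]; ring
    rw [e1, integral_add (hB.integrable_mul_conj (integrable_mul_L2 q v) i)
      ((hB.integrable_mul_conj (hB.integrable_source hq hs) i).const_mul c), integral_const_mul,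
      hB.integral_source_mul_conj hq hs, mul_zero, add_zero]
  have h3 : inner ℂ (f i) g = (inner ℂ (f i) (szego g) : ℂ) := by
    rw [← inner_szego_left, szego_of_mem (hB.boundState i).mem_hardy]
  rw [h2, h3] at h1
  rw [inner_sub_right]
  linear_combination -h1

/-- The coefficients of a solution of the regularised equation vanish. -/
theorem coeff_eq_zero (hB : BoundSystem q ev φ f) (hq : IsWeightedHardy s q)
    (hs : 1 / 2 < s) {b : Bool} {z : ℂ} (hz : z ∈ halfPlane b) {v g : L2} (hv : v ∈ hardySpace)
    {F : ℝ → ℂ} (hF : Integrable F) {c : ℂ}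
    (hFe : F =ᵐ[volume] fun x => q x * v x + c * source q φ x)
    (hg : g =ᵐ[volume] fun x => conj (q x) * sideConv b z F x) {e : Fin N → ℂ}
    (he : ∀ j, e j = ∫ x, sideConv b z F x * conj (φ j x))
    (hvg : v = szego g - ∑ j, (sideSign b * e j) • f j) : ∀ j, e j = 0 := by
  have key : ∀ i, -sideSign b * inner ℂ (f i) (∑ j, e j • f j) = (ev i - z) * e i := by
    intro i
    have h4 : v - szego g = -(sideSign b • ∑ j, e j • f j) := by
      rw [hvg, Finset.smul_sum]
      simp_rw [smul_smul]
      abel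
    rw [he i, hB.sub_mul_coeff hq hs hz hv hF hFe hg, h4, inner_neg_right, inner_smul_right]
    ring
  set w := ∑ j, e j • f j with hw
  -- In the upper half-plane the left side is `i‖w‖²` while the right side has imaginary part at
  -- most zero; in the lower one both signs are reversed. This is the reason for the sign in the
  -- finite rank term, and it forces `w = 0` up to the real axis.
  have h1 : -sideSign b * inner ℂ w w = ∑ i, (ev i - z) * (e i * conj (e i)) := by
    nth_rewrite 1 [hw]
    rw [sum_inner, Finset.mul_sum]
    refine Finset.sum_congr rfl fun i _ => ?_
    rw [inner_smul_left]
    linear_combination conj (e i) * key i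
  have hw0 : w = 0 := by
    have h2 := congrArg Complex.im h1
    rw [Complex.im_sum] at h2
    have h3 : ∀ i, ((ev i - z) * (e i * conj (e i))).im = -z.im * Complex.normSq (e i) := by
      intro i
      rw [Complex.mul_conj, Complex.im_mul_ofReal]
      simp
    simp_rw [h3] at h2
    rw [← Finset.mul_sum] at h2
    have h4 : 0 ≤ ∑ i, Complex.normSq (e i) := Finset.sum_nonneg fun i _ => Complex.normSq_nonneg _
    rw [inner_self_eq_norm_sq_to_K] at h2
    have h5 : ‖w‖ ^ 2 ≤ 0 := by
      cases b
      · have h6 : z.im ≤ 0 := by simpa [halfPlane] using hz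
        have h7 : (-sideSign false * ((‖w‖ : ℝ) : ℂ) ^ 2).im = -‖w‖ ^ 2 := by
          rw [← Complex.ofReal_pow, Complex.im_mul_ofReal]; simp [sideSign]
        have h8 := h7.symm.trans h2
        nlinarith
      · have h6 : 0 ≤ z.im := by simpa [halfPlane] using hz
        have h7 : (-sideSign true * ((‖w‖ : ℝ) : ℂ) ^ 2).im = ‖w‖ ^ 2 := by
          rw [← Complex.ofReal_pow, Complex.im_mul_ofReal]; simp [sideSign]
        have h8 := h7.symm.trans h2
        nlinarith
    exact norm_eq_zero.1 (pow_eq_zero_iff (two_ne_zero) |>.1 (le_antisymm h5 (sq_nonneg _)))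
  have h2 : ∀ i, (ev i - z) * e i = 0 := fun i => by
    rw [← key i, hw0, inner_zero_right, mul_zero]
  intro i
  by_contra hi
  -- Now each `(λᵢ - z)eᵢ` vanishes. As the eigenvalues are distinct, at most one coefficient
  -- survives, and then `w` is a multiple of a single nonzero `fᵢ`.
  have hzi : z = ev i := by
    have := (mul_eq_zero.1 (h2 i)).resolve_right hi
    linear_combination -this
  have hj : ∀ j, j ≠ i → e j = 0 := by
    intro j hji
    refine (mul_eq_zero.1 (h2 j)).resolve_left ?_
    rw [hzi, sub_eq_zero]
    exact fun h => hji (hB.injective (Complex.ofReal_injective h))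
  have h3 : w = e i • f i := by
    rw [hw]
    refine Finset.sum_eq_single i (fun j _ hji => ?_) (by simp)
    rw [hj j hji, zero_smul]
  rw [hw0, eq_comm, smul_eq_zero] at h3
  rcases h3 with h3 | h3
  · exact hi h3
  · exact (hB.boundState i).szego_ne_zero (hB.ne_zero hq hs i) h3

/-- The kernel of `1 - C₊ q̄ R₀(z) q C₊` contains no function whose free resolvent is orthogonal to
all bound states. -/
theorem eq_zero_of_orthogonal (hB : BoundSystem q ev φ f) (hq : IsWeightedHardy s q)
    (hs : 1 / 2 < s) {b : Bool} {z : ℂ} (hz : z ∈ halfPlane b) {v : L2}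
    (hv : sideOp q b z v = v)
    (h0 : ∀ j, ∫ x, sideConv b z (fun x => q x * v x) x * conj (φ j x) = 0) : v = 0 := by
  by_cases him : z.im = 0
  · obtain ⟨t, rfl⟩ : ∃ t : ℝ, z = t := ⟨z.re, by apply Complex.ext <;> simp [him]⟩
    have hb := boundState_of_sideOp_eq_self hv
    by_contra hne
    have hne' : sideConv b t (fun x => q x * v x) ≠ 0 := fun h => hne (hb.szego_eq_zero h)
    obtain ⟨j, rfl⟩ := hB.complete hb hne'
    have hp := (hB.boundState j).proportional hb hq hs
    have h1 := h0 j
    have hc := hb.integral_conj_mul_ne_zero hq hs hne'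
    -- The solution is proportional to `φⱼ`, and orthogonality to `φⱼ` contradicts `‖φⱼ‖² = 2π`.
    have h2 : (∫ x, conj (q x) * sideConv b (ev j) (fun x => q x * v x) x) *
        ∫ x, φ j x * conj (φ j x) = 0 := by
      rw [← integral_const_mul]
      have : ∀ x, (∫ x, conj (q x) * sideConv b (ev j) (fun x => q x * v x) x) *
          (φ j x * conj (φ j x)) = (∫ x, conj (q x) * φ j x) *
            (sideConv b (ev j) (fun x => q x * v x) x * conj (φ j x)) := by
        intro x
        linear_combination -conj (φ j x) * hp x
      simp_rw [this]
      rw [integral_const_mul, h1, mul_zero]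
    rw [hB.integral_mul_conj_eq hq hs, if_pos rfl] at h2
    simp [hc, Real.pi_ne_zero] at h2
  · exact eq_zero_of_sideOp_eq_self hz him hv

end BoundSystem

end

/-! ### The regular part of the Jost solution -/

section

variable {q : L2} {s : ℝ} {N : ℕ} {ev : Fin N → ℝ} {φ : Fin N → ℝ → ℂ} {f : Fin N → L2}

/-- The density `F` of the regular part `R₀(z) F` of the Jost solution, for a given `v`. -/
def density (q : L2) (P : L1) (v : L2) : L1 := mulSzego q v + P

theorem coeFn_density {P : L1} {v : L2} (hv : v ∈ hardySpace) (hP : P =ᵐ[volume] source q φ) :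
    density q P v =ᵐ[volume] fun x => q x * v x + source q φ x := by
  filter_upwards [Lp.coeFn_add (mulSzego q v) P, coeFn_mulSzego (q := q) hv, hP] with x h1 h2 h3
  rw [density, h1, Pi.add_apply, h2, h3]

/-- The solution of the regularised equation. -/
def regularSol (q : L2) (P : L1) (w : Fin N → L1) (f : Fin N → L2) (b : Bool) (z : ℂ) : L2 :=
  Ring.inverse (1 - regularOp q w f b z ∘L mulSzego q) (regularOp q w f b z P)

namespace BoundSystem

variable {P : L1} {w : Fin N → L1}

theorem pairing_sideRes (hw : ∀ j, w j =ᵐ[volume] fun x => conj (φ j x)) {b : Bool} {z : ℂ}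
    (hz : z ∈ halfPlane b) (u : L1) (j : Fin N) :
    pairing (w j) (sideRes b z u) = ∫ x, sideConv b z u x * conj (φ j x) := by
  rw [pairing_apply]
  refine integral_congr_ae ?_
  filter_upwards [coeFn_sideRes hz u, hw j] with x h1 h2
  rw [h1, h2]

theorem regularOp_mem (hB : BoundSystem q ev φ f) (b : Bool) (z : ℂ) (u : L1) :
    regularOp q w f b z u ∈ hardySpace := by
  rw [regularOp_apply]
  exact hardySpace.sub_mem (szego_mem _) (hardySpace.sum_mem fun j _ =>
    hardySpace.smul_mem _ (hB.boundState j).mem_hardy)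

/-- For a kernel element the finite rank coefficients vanish, so it lies in the kernel of the
unperturbed operator with its resolvent orthogonal to all bound states, and is zero. Eigenvalues are
not excluded, which is the purpose of the regularisation. -/
theorem isUnit_regular (hB : BoundSystem q ev φ f) (hq : IsWeightedHardy s q) (hs : 1 / 2 < s)
    (hw : ∀ j, w j =ᵐ[volume] fun x => conj (φ j x)) {b : Bool} {z : ℂ} (hz : z ∈ halfPlane b) :
    IsUnit (1 - regularOp q w f b z ∘L mulSzego q) := by
  refine isUnit_one_sub_of_injective (isCompactOperator_regularOp q w f hz) fun v hv => ?_
  have hvm : v ∈ hardySpace := by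
    rw [← hv]
    exact hB.regularOp_mem b z _
  have hu := coeFn_mulSzego (q := q) hvm
  have hv' : v = szego (conjMulToL2 q (sideRes b z (mulSzego q v))) -
      ∑ j, (sideSign b * pairing (w j) (sideRes b z (mulSzego q v))) • f j := by
    rw [← regularOp_apply]
    exact hv.symm
  have he := hB.coeff_eq_zero hq hs hz hvm (L1.integrable_coeFn (mulSzego q v)) (c := 0)
    (hu.trans (Eventually.of_forall fun x => by simp))
    (coeFn_conjMul_sideRes q hz EventuallyEq.rfl) (pairing_sideRes hw hz _) hv'
  have hv2 : sideOp q b z v = v := by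
    conv_rhs => rw [hv']
    simp only [he, mul_zero, zero_smul, Finset.sum_const_zero, sub_zero]
    rfl
  refine hB.eq_zero_of_orthogonal hq hs hz hv2 fun j => ?_
  rw [← he j, pairing_sideRes hw hz, sideConv_congr hu]

theorem regularSol_eq (hB : BoundSystem q ev φ f) (hq : IsWeightedHardy s q) (hs : 1 / 2 < s)
    (hw : ∀ j, w j =ᵐ[volume] fun x => conj (φ j x)) {b : Bool} {z : ℂ} (hz : z ∈ halfPlane b)
    {v : L2} : v = regularSol q P w f b z ↔ regularOp q w f b z (density q P v) = v := by
  have hu := hB.isUnit_regular hq hs hw hz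
  have h1 : regularOp q w f b z (density q P v) = v ↔
      (1 - regularOp q w f b z ∘L mulSzego q) v = regularOp q w f b z P := by
    rw [density, map_add, _root_.sub_apply, one_apply_eq_self,
      ContinuousLinearMap.comp_apply, sub_eq_iff_eq_add, add_comm, eq_comm]
  rw [h1, regularSol]
  constructor
  · intro h
    rw [h, ← mul_apply_eq_comp, Ring.mul_inverse_cancel _ hu,
      one_apply_eq_self]
  · intro h
    rw [← h, ← mul_apply_eq_comp, Ring.inverse_mul_cancel _ hu,
      one_apply_eq_self]

/-- The solution of the regularised equation is characterised by the unperturbed equation and the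
orthogonality to the bound states. -/
theorem regularSol_iff (hB : BoundSystem q ev φ f) (hq : IsWeightedHardy s q) (hs : 1 / 2 < s)
    (hw : ∀ j, w j =ᵐ[volume] fun x => conj (φ j x)) (hP : P =ᵐ[volume] source q φ)
    {b : Bool} {z : ℂ} (hz : z ∈ halfPlane b) {v : L2} :
    v = regularSol q P w f b z ↔ v = szego (conjMulToL2 q (sideRes b z (density q P v))) ∧
      ∀ j, ∫ x, sideConv b z (density q P v) x * conj (φ j x) = 0 := by
  rw [hB.regularSol_eq hq hs hw hz]
  constructor
  · intro hv
    have hvm : v ∈ hardySpace := by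
      rw [← hv]
      exact hB.regularOp_mem b z _
    have hv' : v = szego (conjMulToL2 q (sideRes b z (density q P v))) -
        ∑ j, (sideSign b * pairing (w j) (sideRes b z (density q P v))) • f j := by
      rw [← regularOp_apply]
      exact hv.symm
    have he := hB.coeff_eq_zero hq hs hz hvm (L1.integrable_coeFn (density q P v)) (c := 1)
      ((coeFn_density hvm hP).trans (Eventually.of_forall fun x => by simp))
      (coeFn_conjMul_sideRes q hz EventuallyEq.rfl) (pairing_sideRes hw hz _) hv'
    simp only [he, mul_zero, zero_smul, Finset.sum_const_zero, sub_zero] at hv'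
    exact ⟨hv', fun j => by rw [← pairing_sideRes hw hz]; exact he j⟩
  · rintro ⟨h1, h2⟩
    rw [regularOp_apply]
    simp only [pairing_sideRes hw hz, h2, mul_zero, zero_smul, Finset.sum_const_zero, sub_zero]
    exact h1.symm

theorem regularSol_mem (hB : BoundSystem q ev φ f) (hq : IsWeightedHardy s q) (hs : 1 / 2 < s)
    (hw : ∀ j, w j =ᵐ[volume] fun x => conj (φ j x)) {b : Bool} {z : ℂ} (hz : z ∈ halfPlane b) :
    regularSol q P w f b z ∈ hardySpace := by
  rw [← (hB.regularSol_eq hq hs hw hz (P := P)).1 rfl]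
  exact hB.regularOp_mem b z _

theorem continuousOn_regularSol (hB : BoundSystem q ev φ f) (hq : IsWeightedHardy s q)
    (hs : 1 / 2 < s) (hw : ∀ j, w j =ᵐ[volume] fun x => conj (φ j x)) (P : L1) (b : Bool) :
    ContinuousOn (regularSol q P w f b) (halfPlane b) := by
  have h1 : ContinuousOn (fun z => Ring.inverse (1 - regularOp q w f b z ∘L mulSzego q))
      (halfPlane b) := by
    intro z hz
    obtain ⟨U, hU⟩ := hB.isUnit_regular hq hs hw hz
    have h2 : ContinuousAt Ring.inverse (1 - regularOp q w f b z ∘L mulSzego q) := by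
      rw [← hU]
      exact NormedRing.inverse_continuousAt U
    have h3 : ContinuousWithinAt (fun z => 1 - regularOp q w f b z ∘L mulSzego q) (halfPlane b) z :=
      continuousWithinAt_const.sub (continuousOn_regularOp q w f b z hz)
    exact ContinuousAt.comp_continuousWithinAt
      (f := fun z => 1 - regularOp q w f b z ∘L mulSzego q) h2 h3
  exact h1.clm_apply (continuousOn_regularOp_apply q w f b P)

/-- The density of the regular part depends continuously on the spectral parameter. -/
theorem continuousOn_density (hB : BoundSystem q ev φ f) (hq : IsWeightedHardy s q)
    (hs : 1 / 2 < s) (hw : ∀ j, w j =ᵐ[volume] fun x => conj (φ j x)) (P : L1) (b : Bool) :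
    ContinuousOn (fun z => density q P (regularSol q P w f b z)) (halfPlane b) :=
  ((mulSzego q).continuous.comp_continuousOn (hB.continuousOn_regularSol hq hs hw P b)).add
    continuousOn_const

end BoundSystem

/-- The free resolvent is jointly continuous, for the weak-* topology on `L^∞`. -/
theorem continuousOn_integral_sideRes {b : Bool} {F : ℂ → L1} (hF : ContinuousOn F (halfPlane b))
    (g : L1) : ContinuousOn (fun z => ∫ x, sideRes b z (F z) x * g x) (halfPlane b) := by
  intro z₀ hz₀
  have h1 : Tendsto (fun z => pairing g (sideRes b z (F z₀))) (𝓝[halfPlane b] z₀)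
      (𝓝 (pairing g (sideRes b z₀ (F z₀)))) :=
    continuousOn_integral_sideRes_mul b (F z₀) (L1.integrable_coeFn g) z₀ hz₀
  -- The change of density is handled by the uniform bound on `R₀(z)`, the change of `z` by weak-*
  -- continuity at the fixed density `F z₀`.
  have h2 : Tendsto (fun z => pairing g (sideRes b z (F z - F z₀))) (𝓝[halfPlane b] z₀)
      (𝓝 0) := by
    have h3 : Tendsto (fun z => ‖g‖ * ‖F z - F z₀‖) (𝓝[halfPlane b] z₀) (𝓝 0) := by
      have := ((tendsto_iff_norm_sub_tendsto_zero.1 (hF z₀ hz₀)).const_mul ‖g‖)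
      simpa using this
    refine squeeze_zero_norm (fun z => (norm_integral_mul_le _ g).trans ?_) h3
    exact mul_le_mul_of_nonneg_left (norm_sideRes_le b z _) (norm_nonneg g)
  have h3 := h2.add h1
  rw [zero_add] at h3
  refine h3.congr fun z => ?_
  rw [← map_add, ← map_add, sub_add_cancel, pairing_apply]

/-! ### Agreement of the two sides -/

namespace BoundSystem

variable {P : L1} {w : Fin N → L1}

theorem integral_exp_mul_bound (h : BoundSystem q ev φ f) (hq : IsWeightedHardy s q)
    (hs : 1 / 2 < s) (j : Fin N) {t : ℝ} (ht : t ≤ 0) :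
    ∫ x : ℝ, exp (-(I * t * x)) * φ j x = 0 := by
  have hb := h.boundState j
  have h2 := (hb.memLp_two hq hs).coeFn_toLp
  rw [← integral_exp_mul_eq_zero (hb.toLp_mem_hardySpace hq hs)
    ((hb.integrable hq hs).congr h2.symm) ht]
  refine integral_congr_ae ?_
  filter_upwards [h2] with x hx
  rw [hx]

theorem integrable_exp_mul {F : ℝ → ℂ} (hF : Integrable F) (t : ℝ) :
    Integrable fun x : ℝ => exp (-(I * t * x)) * F x := by
  refine hF.bdd_mul (c := 1) (by fun_prop) (Eventually.of_forall fun y => ?_)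
  simp [Complex.norm_exp]

/-- Each summand is Hardy: `q`, the bound states, and `qv` as a product of two Hardy functions. -/
theorem integral_exp_mul_density (hB : BoundSystem q ev φ f) (hq : IsWeightedHardy s q)
    (hs : 1 / 2 < s) (hP : P =ᵐ[volume] source q φ) {v : L2} (hv : v ∈ hardySpace) {t : ℝ}
    (ht : t ≤ 0) : ∫ x : ℝ, exp (-(I * t * x)) * density q P v x = 0 := by
  have hqi : Integrable q := memLp_one_iff_integrable.1 (hq.memLp_one hs)
  have hφi := fun j => integrable_exp_mul ((hB.boundState j).integrable hq hs) t
  have e : ∫ x : ℝ, exp (-(I * t * x)) * density q P v x =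
      ∫ x : ℝ, (exp (-(I * t * x)) * (q x * v x) + (exp (-(I * t * x)) * q x -
        I * ∑ j, exp (-(I * t * x)) * φ j x)) := by
    refine integral_congr_ae ?_
    filter_upwards [coeFn_density hv hP] with x hx
    rw [hx, source, ← Finset.mul_sum]; ring
  have i1 := integrable_exp_mul (integrable_mul_L2 q v) t
  have i2 := integrable_exp_mul hqi t
  have i3 : Integrable fun x : ℝ => I * ∑ j, exp (-(I * t * x)) * φ j x :=
    (integrable_finsetSum _ fun j _ => hφi j).const_mul I
  have i4 : Integrable fun x : ℝ => exp (-(I * t * x)) * q x - I * ∑ j, exp (-(I * t * x)) * φ j x :=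
    i2.sub i3
  rw [e, integral_add i1 i4, integral_sub i2 i3, integral_const_mul,
    integral_finsetSum _ fun j _ => hφi j, integral_exp_mul_mul_eq_zero hv hq.mem_hardy ht,
    integral_exp_mul_eq_zero hq.mem_hardy hqi ht]
  simp [hB.integral_exp_mul_bound hq hs _ ht]

/-- The finite rank terms on the two sides carry opposite signs, so the regularised equations cannot
be compared directly. The characterisation `regularSol_iff` does not involve the sign, and there the
forward and backward resolvents of the density agree. -/
theorem regularSol_true_eq_false (hB : BoundSystem q ev φ f) (hq : IsWeightedHardy s q)
    (hs : 1 / 2 < s) (hw : ∀ j, w j =ᵐ[volume] fun x => conj (φ j x))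
    (hP : P =ᵐ[volume] source q φ) {t : ℝ} (ht : t ≤ 0) :
    regularSol q P w f true t = regularSol q P w f false t ∧
      sideRes true t (density q P (regularSol q P w f true t)) =
        sideRes false t (density q P (regularSol q P w f false t)) := by
  have hm := ofReal_mem_halfPlane
  set v := regularSol q P w f true t with hv
  have hvm : v ∈ hardySpace := hB.regularSol_mem hq hs hw (hm true t)
  have hFi := L1.integrable_coeFn (density q P v)
  have hconv : sideConv true t (density q P v) = sideConv false t (density q P v) := by
    funext x
    have := sideConv_true_sub_false (t := t) hFi x
    rw [hB.integral_exp_mul_density hq hs hP hvm ht, mul_zero] at this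
    exact sub_eq_zero.1 this
  have hres : sideRes true t (density q P v) = sideRes false t (density q P v) := by
    refine Lp.ext ((coeFn_sideRes (hm true t) _).trans ?_)
    rw [hconv]
    exact (coeFn_sideRes (hm false t) _).symm
  have h1 := (hB.regularSol_iff hq hs hw hP (hm true t)).1 hv
  rw [hres, hconv] at h1
  have h2 := (hB.regularSol_iff hq hs hw hP (hm false t)).2 h1
  exact ⟨h2, by rw [← h2, hres]⟩

end BoundSystem

end

/-! ### The regular part at the eigenvalues -/

theorem FreeEq.sum {ι : Type*} (S : Finset ι) {k : ℂ} {φ F : ι → ℝ → ℂ}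
    (h : ∀ i ∈ S, FreeEq k (φ i) (F i)) (hF : ∀ i ∈ S, LocallyIntegrable (F i)) :
    FreeEq k (fun x => ∑ i ∈ S, φ i x) (fun x => ∑ i ∈ S, F i x) := by
  classical
  induction S using Finset.induction_on with
  | empty => intro a b; simp
  | insert a S ha ih =>
    have h1 := ih (fun i hi => h i (Finset.mem_insert_of_mem hi))
      (fun i hi => hF i (Finset.mem_insert_of_mem hi))
    have h2 : LocallyIntegrable fun x => ∑ i ∈ S, F i x :=
      locallyIntegrable_finsetSum S fun i hi => hF i (Finset.mem_insert_of_mem hi)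
    simp_rw [Finset.sum_insert ha]
    exact (h a (Finset.mem_insert_self a S)).add h1 (hF a (Finset.mem_insert_self a S)) h2

section

variable {q : L2} {s : ℝ} {N : ℕ} {ev : Fin N → ℝ} {φ : Fin N → ℝ → ℂ} {f : Fin N → L2}

/-- The regular part at the eigenvalue `ev j`. -/
def eigenPart (ev : Fin N → ℝ) (φ : Fin N → ℝ → ℂ) (j : Fin N) (γ : ℂ) (x : ℝ) : ℂ :=
  (γ + x) * φ j x + I * ∑ i ∈ Finset.univ.erase j, φ i x / ((ev j : ℂ) - (ev i : ℂ))

namespace BoundSystem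

variable {P : L1} {w : Fin N → L1}

theorem ev_sub_ne_zero (hB : BoundSystem q ev φ f) {i j : Fin N} (h : i ≠ j) :
    (ev i : ℂ) - ev j ≠ 0 := by
  rw [sub_ne_zero]
  exact fun e => h (hB.injective (Complex.ofReal_injective e))

theorem tendsto_eigenPart (hB : BoundSystem q ev φ f) (hq : IsWeightedHardy s q) (hs : 1 / 2 < s)
    (j : Fin N) (γ : ℂ) :
    Tendsto (eigenPart ev φ j γ) atBot (𝓝 0) ∧ Tendsto (eigenPart ev φ j γ) atTop (𝓝 0) := by
  have key : ∀ l : Filter ℝ, l.IsCountablyGenerated → Tendsto (fun x : ℝ => |x|) l atTop →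
      (∀ i, Tendsto (φ i) l (𝓝 0)) → Tendsto (eigenPart ev φ j γ) l (𝓝 0) := by
    intro l hl habs h
    have h1 := (hB.boundState j).tendsto_mul_id hq hs habs
    have h2 : Tendsto (fun x => ∑ i ∈ Finset.univ.erase j, φ i x / ((ev j : ℂ) - (ev i : ℂ))) l
        (𝓝 (∑ i ∈ Finset.univ.erase j, 0 / ((ev j : ℂ) - (ev i : ℂ)))) :=
      tendsto_finsetSum _ fun i _ => (h i).div_const _
    have h3 := (((h j).const_mul γ).add h1).add (h2.const_mul I)
    simp only [mul_zero, zero_div, Finset.sum_const_zero, add_zero] at h3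
    refine h3.congr fun x => ?_
    rw [eigenPart]; ring
  exact ⟨key _ inferInstance tendsto_abs_atBot_atTop fun i => (hB.boundState i).tendsto_atBot,
    key _ inferInstance tendsto_abs_atTop_atTop fun i => (hB.boundState i).tendsto_atTop⟩

/-- The solution of the regularised equation at an eigenvalue. -/
theorem exists_eigenPart (hB : BoundSystem q ev φ f) (hq : IsWeightedHardy s q) (hs : 1 / 2 < s)
    (hw : ∀ j, w j =ᵐ[volume] fun x => conj (φ j x)) (hP : P =ᵐ[volume] source q φ) (j : Fin N) :
    ∃ γ : ℂ, ∀ b, FreeEq (ev j) (eigenPart ev φ j γ)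
        (density q P (regularSol q P w f b (ev j))) ∧
      sideConv b (ev j) (density q P (regularSol q P w f b (ev j))) = eigenPart ev φ j γ := by
  have hm := fun b => ofReal_mem_halfPlane b (ev j)
  obtain ⟨G, hG, hxf⟩ := (hB.boundState j).exists_mul_szego hq hs
  -- With `∫ q conj φⱼ = 2πi` the commutator constant is exactly `1`; thus `x q fⱼ` contains the
  -- summand `q` of the source.
  have hone : I / (2 * Real.pi) * ∫ y, conj (q y) * φ j y = 1 := by
    have h1 := hB.normalised j
    rw [integral_mul_conj_eq_conj] at h1
    have h2 : ∫ x, conj (q x) * φ j x = -(2 * Real.pi * I) := by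
      rw [← conj_conj (∫ x, conj (q x) * φ j x), h1]; simp [map_ofNat]
    rw [h2]
    have : (Real.pi : ℂ) ≠ 0 := by exact_mod_cast Real.pi_ne_zero
    field_simp
    linear_combination -I_sq
  rw [hone] at hxf
  choose g hg hgf using fun i => (hB.boundState i).exists_szego_eq
  have hiw : ∀ i, Integrable fun x => φ i x * conj (φ j x) := fun i =>
    hB.integrable_mul_conj ((hB.boundState i).integrable hq hs) j
  -- The equation determines the solution only up to a multiple of `φⱼ`; this value makes it
  -- orthogonal to `φⱼ`.
  set γ : ℂ := -(∫ x : ℝ, (x : ℂ) * (φ j x * conj (φ j x))) / (2 * Real.pi) with hγ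
  set S := Finset.univ.erase j with hS
  -- At energy `λⱼ` the function `aᵢφᵢ` contributes `(λᵢ - λⱼ)aᵢφᵢ = -iφᵢ` to the source.
  set a : Fin N → ℂ := fun i => I / ((ev j : ℂ) - ev i) with ha
  have haS : ∀ i ∈ S, (ev i - ev j) * a i = -I := by
    intro i hi
    have := hB.ev_sub_ne_zero (Finset.ne_of_mem_erase hi).symm
    simp only [ha]
    field_simp
    ring
  have heig : ∀ x, eigenPart ev φ j γ x = x * φ j x + γ * φ j x + ∑ i ∈ S, a i * φ i x := by
    intro x
    rw [eigenPart, Finset.mul_sum]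
    have : ∀ i, I * (φ i x / ((ev j : ℂ) - ev i)) = a i * φ i x := fun i => by
      simp only [ha]; ring
    simp_rw [this]
    ring
  set v : L2 := szego G + γ • f j + ∑ i ∈ S, a i • f i with hv
  have hvm : v ∈ hardySpace := hardySpace.add_mem (hardySpace.add_mem (szego_mem G)
    (hardySpace.smul_mem _ (hB.boundState j).mem_hardy))
    (hardySpace.sum_mem fun i _ => hardySpace.smul_mem _ (hB.boundState i).mem_hardy)
  have hvx : ∀ᵐ x, v x = szego G x + γ * f j x + ∑ i ∈ S, a i * f i x := by
    have h3 : ∀ᵐ x, ∀ i ∈ S, (a i • f i) x = a i * f i x :=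
      (ae_ball_iff S.countable_toSet).2 fun i _ => Lp.coeFn_smul (a i) (f i)
    filter_upwards [Lp.coeFn_add (szego G + γ • f j) (∑ i ∈ S, a i • f i),
      Lp.coeFn_add (szego G) (γ • f j), Lp.coeFn_smul γ (f j),
      Lp.coeFn_finsetSum S fun i => a i • f i, h3] with x e1 e2 e3 e4 e5
    rw [hv, e1, Pi.add_apply, e2, Pi.add_apply, e3, e4, Pi.smul_apply, smul_eq_mul,
      Finset.sum_apply]
    congr 1
    exact Finset.sum_congr rfl e5
  have hdens := coeFn_density hvm hP
  have hul := fun i => (integrable_mul_L2 q (f i)).locallyIntegrable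
  have hφl := fun i => ((hB.boundState i).integrable hq hs).locallyIntegrable
  have hfree : FreeEq (ev j) (eigenPart ev φ j γ) (density q P v) := by
    have l1 : LocallyIntegrable fun x : ℝ => (x : ℂ) * (q x * f j x) - I * φ j x :=
      (((hB.boundState j).integrable_mul_id hq hs).sub
        (((hB.boundState j).integrable hq hs).const_mul I)).locallyIntegrable
    have l2 : LocallyIntegrable fun x : ℝ => γ * (q x * f j x) := (hul j).smul γ
    have l3 : ∀ i ∈ S, LocallyIntegrable fun x : ℝ =>
        a i * (q x * f i x + (ev i - ev j) * φ i x) := fun i _ =>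
      ((hul i).add ((hφl i).smul ((ev i : ℂ) - ev j))).smul (a i)
    have e3 := FreeEq.sum S (fun i _ =>
      ((hB.boundState i).freeEq.shift (hul i) (ev j)).const_mul (a i)) l3
    have e := (((hB.boundState j).freeEq.mul_id (hul j)).add
      ((hB.boundState j).freeEq.const_mul γ) l1 l2).add e3 (l1.add l2)
      (locallyIntegrable_finsetSum S l3)
    rw [show eigenPart ev φ j γ = _ from funext heig]
    refine e.congr ?_
    filter_upwards [hdens, hvx, hxf] with x h1 h2 h3
    rw [h1, h2, source, ← Finset.add_sum_erase _ _ (Finset.mem_univ j), ← hS]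
    have h4 : ∑ i ∈ S, a i * (q x * f i x + (ev i - ev j) * φ i x) =
        q x * ∑ i ∈ S, a i * f i x - I * ∑ i ∈ S, φ i x := by
      rw [Finset.mul_sum, Finset.mul_sum, ← Finset.sum_sub_distrib]
      refine Finset.sum_congr rfl fun i hi => ?_
      linear_combination φ i x * haS i hi
    rw [h4]
    linear_combination (q x) * h3
  obtain ⟨hbot, htop⟩ := hB.tendsto_eigenPart hq hs j γ
  have hF := L1.integrable_coeFn (density q P v)
  -- The explicit solution vanishes at both ends, so both resolvents produce it; this is why one `γ`
  -- serves both sides of the cut.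
  have hconv : ∀ b, eigenPart ev φ j γ = sideConv b (ev j) (density q P v) := by
    intro b
    refine hfree.eq_sideConv_real hF ?_
    cases b
    · exact htop
    · exact hbot
  have hsz : ∀ b, v = szego (conjMulToL2 q (sideRes b (ev j) (density q P v))) := by
    intro b
    have : conjMulToL2 q (sideRes b (ev j) (density q P v)) =
        G + γ • g j + ∑ i ∈ S, a i • g i := by
      refine Lp.ext ((coeFn_conjMul_sideRes q (hm b) EventuallyEq.rfl).trans ?_)
      rw [← hconv b]
      have h3 : ∀ᵐ x, ∀ i ∈ S, (a i • g i) x = a i * (conj (q x) * φ i x) := by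
        refine (ae_ball_iff S.countable_toSet).2 fun i _ => ?_
        filter_upwards [Lp.coeFn_smul (a i) (g i), hg i] with x h1 h2
        rw [h1, Pi.smul_apply, h2, smul_eq_mul]
      filter_upwards [Lp.coeFn_add (G + γ • g j) (∑ i ∈ S, a i • g i),
        Lp.coeFn_add G (γ • g j), Lp.coeFn_smul γ (g j),
        Lp.coeFn_finsetSum S fun i => a i • g i, h3, hG, hg j] with x e1 e2 e3 e4 e5 e6 e7
      rw [e1, Pi.add_apply, e2, Pi.add_apply, e3, e4, Pi.smul_apply, smul_eq_mul,
        Finset.sum_apply, e6, e7, heig, Finset.sum_congr rfl e5, mul_add, Finset.mul_sum]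
      congr 1
      · ring
      · exact Finset.sum_congr rfl fun i _ => by ring
    rw [this, map_add, map_add, map_smul, hgf, map_sum]
    simp_rw [map_smul, hgf]
    rfl
  have horth : ∀ b i, ∫ x, sideConv b (ev j) (density q P v) x * conj (φ i x) = 0 := by
    intro b i
    by_cases hij : i = j
    · subst hij
      rw [← hconv b]
      have hxx : Integrable fun x : ℝ => (x : ℂ) * (φ i x * conj (φ i x)) := by
        obtain ⟨C, hC⟩ := (hB.boundState i).exists_norm_mul_id_le hq hs
        refine (((integrable_conj ((hB.boundState i).integrable hq hs)).bdd_mul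
          (Complex.continuous_ofReal.mul (hB.boundState i).continuous).aestronglyMeasurable
          (Eventually.of_forall hC))).congr (Eventually.of_forall fun x => ?_)
        exact mul_assoc _ _ _
      have e1 : ∫ x, eigenPart ev φ i γ x * conj (φ i x) =
          ∫ x : ℝ, ((x : ℂ) * (φ i x * conj (φ i x)) + (γ * (φ i x * conj (φ i x)) +
            ∑ k ∈ S, a k * (φ k x * conj (φ i x)))) := by
        congr 1; funext x
        rw [heig, add_mul, add_mul, Finset.sum_mul]
        have : ∀ k, a k * φ k x * conj (φ i x) = a k * (φ k x * conj (φ i x)) := fun k => by ring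
        simp_rw [this]
        ring
      have i3 : Integrable fun x => ∑ k ∈ S, a k * (φ k x * conj (φ i x)) :=
        integrable_finsetSum _ fun k _ => (hiw k).const_mul _
      have i4 : Integrable fun x => γ * (φ i x * conj (φ i x)) +
          ∑ k ∈ S, a k * (φ k x * conj (φ i x)) := ((hiw i).const_mul γ).add i3
      rw [e1, integral_add hxx i4, integral_add ((hiw i).const_mul γ) i3, integral_const_mul,
        integral_finsetSum _ fun k _ => (hiw k).const_mul _,
        Finset.sum_eq_zero, hB.integral_mul_conj_eq hq hs, if_pos rfl, hγ]
      · have : (Real.pi : ℂ) ≠ 0 := by exact_mod_cast Real.pi_ne_zero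
        field_simp
        ring
      · intro k hk
        rw [integral_const_mul, hB.integral_mul_conj_eq hq hs,
          if_neg (Finset.ne_of_mem_erase hk), mul_zero]
    · have h1 := hB.sub_mul_coeff hq hs (hm b) hvm hF (c := 1)
        (hdens.trans (Eventually.of_forall fun x => by simp))
        (coeFn_conjMul_sideRes q (hm b) EventuallyEq.rfl) i
      rw [← hsz b, sub_self, inner_zero_right, mul_eq_zero] at h1
      exact h1.resolve_left (hB.ev_sub_ne_zero hij)
  refine ⟨γ, fun b => ?_⟩
  rw [← (hB.regularSol_iff hq hs hw hP (hm b)).2 ⟨hsz b, horth b⟩]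
  exact ⟨hfree, (hconv b).symm⟩

/-! ### The Jost solution away from the eigenvalues -/

theorem isUnit_one_sub_sideOp (hB : BoundSystem q ev φ f) {b : Bool} {z : ℂ}
    (hz : z ∈ halfPlane b) (hne : ∀ j, z ≠ ev j) : IsUnit (1 - sideOp q b z) := by
  refine isUnit_one_sub_of_injective (isCompactOperator_sideOp q hz) fun v hv => ?_
  by_cases him : z.im = 0
  · obtain ⟨t, rfl⟩ : ∃ t : ℝ, z = t := ⟨z.re, by apply Complex.ext <;> simp [him]⟩
    have hb := boundState_of_sideOp_eq_self hv
    by_contra hv0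
    obtain ⟨j, hj⟩ := hB.complete hb fun h => hv0 (hb.szego_eq_zero h)
    exact hne j (by rw [hj])
  · exact eq_zero_of_sideOp_eq_self hz him hv

/-- The density of the Jost solution `m₀`. -/
theorem exists_jost (hB : BoundSystem q ev φ f) (hq : IsWeightedHardy s q) (hs : 1 / 2 < s)
    (hw : ∀ j, w j =ᵐ[volume] fun x => conj (φ j x)) (hP : P =ᵐ[volume] source q φ)
    (Q : L1) (hQ : Q =ᵐ[volume] q) {b : Bool} {z : ℂ} (hz : z ∈ halfPlane b)
    (hne : ∀ j, z ≠ ev j) :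
    ∃ v : L2, ∃ U : Fin N → L1,
      (∀ j, U j =ᵐ[volume] fun x => q x * f j x + (ev j - z) * φ j x) ∧
      mulToL1 q v + Q = density q P (regularSol q P w f b z) - ∑ j, (I / (z - ev j)) • U j ∧
      Ring.inverse (1 - sideOp q b z) (szego (conjMulToL2 q (sideRes b z Q))) = v ∧
      v ∈ hardySpace ∧ szego (conjMulToL2 q (sideRes b z (mulToL1 q v + Q))) = v ∧
      sideRes b z (mulToL1 q v + Q) =ᵐ[volume] fun x =>
        -I * ∑ j, φ j x / (z - ev j) +
          sideRes b z (density q P (regularSol q P w f b z)) x := by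
  set y := regularSol q P w f b z with hy
  have hym : y ∈ hardySpace := hB.regularSol_mem hq hs hw hz
  obtain ⟨hy1, -⟩ := (hB.regularSol_iff hq hs hw hP hz).1 hy
  set a : Fin N → ℂ := fun j => I / (z - ev j) with ha
  have haz : ∀ j, a j * (ev j - z) = -I := fun j => by
    have : z - ev j ≠ 0 := sub_ne_zero.2 (hne j)
    simp only [ha]; field_simp; ring
  have hUi : ∀ j, Integrable fun x => q x * f j x + (ev j - z) * φ j x := fun j =>
    (integrable_mul_L2 q (f j)).add (((hB.boundState j).integrable hq hs).const_mul _)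
  set U : Fin N → L1 := fun j => (memLp_one_iff_integrable.2 (hUi j)).toLp with hUd
  have hU : ∀ j, U j =ᵐ[volume] fun x => q x * f j x + (ev j - z) * φ j x := fun j =>
    MemLp.coeFn_toLp _
  -- `Uⱼ` is the source of `φⱼ` at energy `z`, so subtracting multiples of `Uⱼ` from the density
  -- installs the pole terms in the solution.
  have hRU : ∀ j, sideRes b z (U j) =ᵐ[volume] φ j := by
    intro j
    refine (coeFn_sideRes hz (U j)).trans ?_
    rw [sideConv_congr (hU j), ← (hB.boundState j).eq_sideConv_shift hq hs hz]
  have hfU : ∀ j, szego (conjMulToL2 q (sideRes b z (U j))) = f j := by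
    intro j
    obtain ⟨g, hg, hgf⟩ := (hB.boundState j).exists_szego_eq
    rw [← hgf]
    congr 1
    refine Lp.ext ((coeFn_conjMulToL2 q _).trans ?_)
    filter_upwards [hRU j, hg] with x h1 h2
    rw [h1, h2]
  set v : L2 := y - ∑ j, a j • f j with hv
  have hvm : v ∈ hardySpace := hardySpace.sub_mem hym
    (hardySpace.sum_mem fun i _ => hardySpace.smul_mem _ (hB.boundState i).mem_hardy)
  have hden : mulToL1 q v + Q = density q P y - ∑ j, a j • U j := by
    refine Lp.ext ?_
    have h3 : ∀ᵐ x, ∀ j ∈ Finset.univ, (a j • f j) x = a j * f j x :=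
      (ae_ball_iff Finset.univ.countable_toSet).2 fun i _ => Lp.coeFn_smul (a i) (f i)
    have h4 : ∀ᵐ x, ∀ j ∈ Finset.univ, (a j • U j) x =
        a j * (q x * f j x + (ev j - z) * φ j x) := by
      refine (ae_ball_iff Finset.univ.countable_toSet).2 fun i _ => ?_
      filter_upwards [Lp.coeFn_smul (a i) (U i), hU i] with x h1 h2
      rw [h1, Pi.smul_apply, h2, smul_eq_mul]
    filter_upwards [Lp.coeFn_add (mulToL1 q v) Q, coeFn_mulToL1 q v, hQ,
      Lp.coeFn_sub y (∑ j, a j • f j), Lp.coeFn_finsetSum Finset.univ fun i => a i • f i, h3,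
      Lp.coeFn_sub (density q P y) (∑ j, a j • U j), coeFn_density hym hP,
      Lp.coeFn_finsetSum Finset.univ fun i => a i • U i, h4] with x e1 e2 e3 e4 e5 e6 e7 e8 e9 e10
    rw [e1, Pi.add_apply, e2, e3, e4, Pi.sub_apply, e5, Finset.sum_apply, e7, Pi.sub_apply, e8, e9,
      Finset.sum_apply, Finset.sum_congr rfl e6, Finset.sum_congr rfl e10, source]
    have h5 : ∑ j, a j * (q x * f j x + (ev j - z) * φ j x) =
        q x * ∑ j, a j * f j x - I * ∑ j, φ j x := by
      rw [Finset.mul_sum, Finset.mul_sum, ← Finset.sum_sub_distrib]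
      refine Finset.sum_congr rfl fun j _ => ?_
      linear_combination φ j x * haz j
    rw [h5]; ring
  have hsz : szego (conjMulToL2 q (sideRes b z (mulToL1 q v + Q))) = v := by
    rw [hden]
    simp only [map_sub, map_sum, map_smul, hfU]
    rw [← hy1]
  refine ⟨v, U, hU, hden, ?_, hvm, hsz, ?_⟩
  · have h1 : szego (conjMulToL2 q (sideRes b z Q)) = (1 - sideOp q b z) v := by
      rw [_root_.sub_apply, one_apply_eq_self, sideOp_apply, szego_of_mem hvm]
      conv_rhs => enter [1]; rw [← hsz]
      rw [map_add, map_add, map_add]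
      abel
    rw [h1, ← mul_apply_eq_comp, Ring.inverse_mul_cancel _ (hB.isUnit_one_sub_sideOp hz hne),
      one_apply_eq_self]
  · rw [hden, map_sub, map_sum]
    have h4 : ∀ᵐ x, ∀ j ∈ Finset.univ, (sideRes b z (a j • U j)) x = a j * φ j x := by
      refine (ae_ball_iff Finset.univ.countable_toSet).2 fun i _ => ?_
      filter_upwards [Lp.coeFn_smul (a i) (sideRes b z (U i)), hRU i] with x h1 h2
      rw [map_smul, h1, Pi.smul_apply, h2, smul_eq_mul]
    filter_upwards [Lp.coeFn_sub (sideRes b z (density q P y)) (∑ j, sideRes b z (a j • U j)),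
      Lp.coeFn_finsetSum Finset.univ fun i => sideRes b z (a i • U i), h4] with x e1 e2 e3
    rw [e1, Pi.sub_apply, e2, Finset.sum_apply, Finset.sum_congr rfl e3]
    have : ∑ j, a j * φ j x = I * ∑ j, φ j x / (z - ev j) := by
      rw [Finset.mul_sum]
      refine Finset.sum_congr rfl fun j _ => ?_
      simp only [ha]; ring
    rw [this]; ring

end BoundSystem

end

/-! ### Functions on the slit plane -/

theorem isClosed_halfPlane (b : Bool) : IsClosed (halfPlane b) := by
  cases b
  · simpa [halfPlane] using isClosed_le Complex.continuous_im continuous_const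
  · simpa [halfPlane] using isClosed_le continuous_const Complex.continuous_im

namespace CutPlane

theorem toComplex_plus (t : ℝ) : (plus t).toComplex = t := by
  unfold plus; split_ifs <;> rfl

theorem toComplex_minus (t : ℝ) : (minus t).toComplex = t := by
  unfold minus; split_ifs <;> rfl

theorem side_eq_true {k : CutPlane} : k.side = true ↔ k.OnUpper := by simp [side]

theorem side_plus (t : ℝ) : (plus t).side = true := by
  rw [side_eq_true]; unfold plus; split_ifs <;> simp [OnUpper]

/-- Continuous functions on the two closed half-planes that agree on `(-∞, 0]` give a continuous
function on the slit plane. -/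
theorem continuous_side {X : Type*} [TopologicalSpace X] {G : Bool → ℂ → X}
    (hG : ∀ b, ContinuousOn (G b) (halfPlane b)) (h : ∀ t : ℝ, t ≤ 0 → G true t = G false t) :
    Continuous fun k : CutPlane => G k.side k.toComplex := by
  have hbool : ∀ {z : ℂ}, z.im = 0 → z.re ≤ 0 → ∀ b b', G b z = G b' z := by
    intro z h0 h1 b b'
    have hz : z = (z.re : ℂ) := by apply Complex.ext <;> simp [h0]
    have := h _ h1
    rw [← hz] at this
    cases b <;> cases b' <;> simp [this]
  refine continuous_def.2 fun U hU p hp => ?_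
  -- If `z` is outside the closed half-plane, so are all nearby points and the conclusion is
  -- vacuous; thus interior points and points of `(-∞,0]` are treated alike.
  have hex : ∀ (b : Bool) (z : ℂ), (z ∈ halfPlane b → G b z ∈ U) →
      ∃ ε > 0, ∀ z', dist z' z < ε → z' ∈ halfPlane b → G b z' ∈ U := by
    intro b z hz
    by_cases hm : z ∈ halfPlane b
    · obtain ⟨ε, hε, hsub⟩ := Metric.mem_nhdsWithin_iff.1
        ((hG b z hm).preimage_mem_nhdsWithin (hU.mem_nhds (hz hm)))
      exact ⟨ε, hε, fun z' h1 h2 => hsub ⟨h1, h2⟩⟩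
    · obtain ⟨ε, hε, hsub⟩ := Metric.isOpen_iff.1 (isClosed_halfPlane b).isOpen_compl z hm
      exact ⟨ε, hε, fun z' h1 h2 => (hsub h1 h2).elim⟩
  have hp' : G p.side p.toComplex ∈ U := hp
  cases p with
  | off z hk =>
    have hz : ∀ b, z ∈ halfPlane b → G b z ∈ U := by
      intro b hb
      by_cases hbs : b = (off z hk).side
      · rw [hbs]; exact hp'
      · have h1 := (off z hk).mem_halfPlane_side
        have h0 : z.im = 0 := by
          change z ∈ halfPlane (off z hk).side at h1
          generalize (off z hk).side = b' at h1 hbs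
          cases b <;> cases b' <;> simp [halfPlane] at h1 hb hbs
          · exact le_antisymm hb h1
          · exact le_antisymm h1 hb
        rw [hbool h0 (not_lt.1 fun h2 => hk ⟨h2, h0⟩) b (off z hk).side]
        exact hp'
    obtain ⟨ε, hε, h1⟩ := hex true z (hz true)
    obtain ⟨δ, hδ, h2⟩ := hex false z (hz false)
    refine ⟨min ε δ, lt_min hε hδ, fun p' hp' => ?_⟩
    change G p'.side p'.toComplex ∈ U
    have hd : dist p'.toComplex z < min ε δ := hp'
    have hm := p'.mem_halfPlane_side
    cases hb : p'.side <;> rw [hb] at hm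
    · exact h2 _ (hd.trans_le (min_le_right _ _)) hm
    · exact h1 _ (hd.trans_le (min_le_left _ _)) hm
  | above t ht =>
    have hs : (above t ht).side = true := side_eq_true.2 trivial
    rw [hs] at hp'
    obtain ⟨ε, hε, h1⟩ := hex true t fun _ => hp'
    refine ⟨ε, hε, fun p' hp' => ?_⟩
    change G p'.side p'.toComplex ∈ U
    have hs' : p'.side = true := side_eq_true.2 hp'.2
    have hm := p'.mem_halfPlane_side
    rw [hs'] at hm ⊢
    exact h1 _ hp'.1 hm
  | below t ht =>
    have hs : (below t ht).side = false :=
      Bool.eq_false_iff.2 fun h => side_eq_true.1 h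
    rw [hs] at hp'
    obtain ⟨ε, hε, h1⟩ := hex false t fun _ => hp'
    refine ⟨ε, hε, fun p' hp' => ?_⟩
    change G p'.side p'.toComplex ∈ U
    have hm := p'.mem_halfPlane_side
    cases hb : p'.side
    · rw [hb] at hm
      exact h1 _ hp'.1 hm
    · have hu : p'.OnUpper := side_eq_true.1 hb
      have h2 : p'.OnLower := hp'.2
      -- A large neighbourhood of a point below the cut can reach `(-∞,0]`, whose points are
      -- assigned to the upper side; there the two functions agree.
      have h3 : p'.toComplex.im = 0 ∧ p'.toComplex.re ≤ 0 := by
        cases p' with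
        | off z hk =>
          have h0 : z.im = 0 := le_antisymm h2 hu
          exact ⟨h0, not_lt.1 fun h3 => hk ⟨h3, h0⟩⟩
        | above t ht => exact h2.elim
        | below t ht => exact hu.elim
      rw [hbool h3.1 h3.2 true false]
      exact h1 _ hp'.1 (by simp [halfPlane, h3.1])

/-- Eigenvalues and exceptional points are real, so `m₀` is defined off the real axis. Density of
these points gives uniqueness of the regular part. -/
theorem dense_im_ne_zero : Dense {k : CutPlane | k.toComplex.im ≠ 0} := by
  rw [dense_iff_inter_open]
  rintro U hU ⟨p, hp⟩
  obtain ⟨ε, hε, h⟩ := hU p hp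
  have hd : ∀ (z : ℂ) (c : ℝ), |c| < ε → dist (z + c * I) z < ε := by
    intro z c hc
    simpa [dist_eq] using hc
  have hpos : |ε / 2| < ε := by rw [abs_of_pos (half_pos hε)]; linarith
  have hneg : |-(ε / 2)| < ε := by rwa [abs_neg]
  have him : ∀ (z : ℂ) (c : ℝ), (z + c * I).im = z.im + c := by intro z c; simp
  have hoff : ∀ z : ℂ, z.im ≠ 0 → ¬(0 < z.re ∧ z.im = 0) := fun z hz h => hz h.2
  cases p with
  | off z hk =>
    rcases le_or_gt 0 z.im with hz | hz
    · have h1 : (z + (ε / 2 : ℝ) * I).im ≠ 0 := by rw [him]; linarith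
      exact ⟨off _ (hoff _ h1), h _ (hd _ _ hpos), h1⟩
    · have h1 : (z + (-(ε / 2) : ℝ) * I).im ≠ 0 := by rw [him]; linarith
      exact ⟨off _ (hoff _ h1), h _ (hd _ _ hneg), h1⟩
  | above t ht =>
    have h0 : 0 < ((t : ℂ) + (ε / 2 : ℝ) * I).im := by rw [him, ofReal_im]; linarith
    exact ⟨off _ (hoff _ h0.ne'), h _ ⟨hd _ _ hpos, h0.le⟩, h0.ne'⟩
  | below t ht =>
    have h0 : ((t : ℂ) + (-(ε / 2) : ℝ) * I).im < 0 := by rw [him, ofReal_im]; linarith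
    exact ⟨off _ (hoff _ h0.ne), h _ ⟨hd _ _ hneg, h0.le⟩, h0.ne⟩

end CutPlane

theorem LInf.ext_integral {g h : LInf} (H : ∀ u : L1, ∫ x, g x * u x = ∫ x, h x * u x) :
    g = h := by
  have hi : ∀ (g : LInf) (A : Set ℝ), MeasurableSet A → volume A < ⊤ → IntegrableOn g A := by
    intro g A hA hAf
    have : IsFiniteMeasure ((volume : Measure ℝ).restrict A) := ⟨by simpa using hAf⟩
    exact ((Lp.memLp g).restrict A).integrable le_top
  refine Lp.ext (ae_eq_of_forall_setIntegral_eq_of_sigmaFinite (hi g) (hi h) fun A hA hAf => ?_)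
  have h1 : ∀ g : LInf, ∫ x in A, g x =
      ∫ x, g x * (indicatorConstLp 1 hA hAf.ne (1 : ℂ) : L1) x := by
    intro g
    rw [← integral_indicator hA]
    refine integral_congr_ae ?_
    filter_upwards [indicatorConstLp_coeFn (p := 1) (hs := hA) (hμs := hAf.ne) (c := (1 : ℂ))]
      with x hx
    rw [hx]
    by_cases hxA : x ∈ A <;> simp [hxA]
  rw [h1, h1, H]

/-- Joint continuity of the Fourier transform on `L¹`. -/
theorem continuous_integral_exp_mul {X : Type*} [TopologicalSpace X] {F : X → L1} {t : X → ℝ}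
    (hF : Continuous F) (ht : Continuous t) :
    Continuous fun a => ∫ x : ℝ, exp (-(I * t a * x)) * F a x := by
  have hn : ∀ (t x : ℝ), ‖exp (-(I * t * x))‖ = 1 := by intro t x; simp [Complex.norm_exp]
  refine continuous_iff_continuousAt.2 fun a₀ => ?_
  have h1 : Continuous fun a => ∫ x : ℝ, exp (-(I * t a * x)) * F a₀ x := by
    refine (continuous_of_dominated (F := fun (r : ℝ) (x : ℝ) => exp (-(I * r * x)) * F a₀ x)
      (bound := fun x => ‖F a₀ x‖) (fun r => ?_) (fun r => Eventually.of_forall fun x => ?_)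
      (L1.integrable_coeFn _).norm (Eventually.of_forall fun x => by fun_prop)).comp ht
    · exact (BoundSystem.integrable_exp_mul (L1.integrable_coeFn _) r).aestronglyMeasurable
    · rw [norm_mul, hn, one_mul]
  have h2 : Tendsto (fun a => ∫ x : ℝ, exp (-(I * t a * x)) * (F a - F a₀ : L1) x) (𝓝 a₀)
      (𝓝 0) := by
    have h3 : Tendsto (fun a => ‖F a - F a₀‖) (𝓝 a₀) (𝓝 0) :=
      tendsto_iff_norm_sub_tendsto_zero.1 hF.continuousAt
    refine squeeze_zero_norm (fun a => ?_) h3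
    rw [L1.norm_eq_integral_norm]
    refine norm_integral_le_of_norm_le (L1.integrable_coeFn _).norm
      (Eventually.of_forall fun x => ?_)
    rw [norm_mul, hn, one_mul]
  have h3 := h2.add h1.continuousAt
  rw [zero_add] at h3
  refine h3.congr fun a => ?_
  rw [← integral_add (BoundSystem.integrable_exp_mul (L1.integrable_coeFn _) _)
    (BoundSystem.integrable_exp_mul (L1.integrable_coeFn _) _)]
  refine integral_congr_ae ?_
  filter_upwards [Lp.coeFn_sub (F a) (F a₀)] with x hx
  rw [hx, Pi.sub_apply]; ring

section

variable {q : L2} {s : ℝ} {N : ℕ} {ev : Fin N → ℝ} {φ : Fin N → ℝ → ℂ} {f : Fin N → L2}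

theorem im_eq_zero_of_mem_pointSpectrum (hq : IsWeightedHardy s q) (hs : 1 / 2 < s) {z : ℂ}
    (hz : z ∈ pointSpectrum q) : z.im = 0 := by
  rw [pointSpectrum_eq hq hs] at hz
  obtain ⟨t, -, rfl⟩ := hz
  exact ofReal_im t

/-- The regular part of the Jost solution is unique. -/
theorem IsRegularPart.unique (hq : IsWeightedHardy s q) (hs : 1 / 2 < s)
    {hq1 : MemLp q 1 (volume : Measure ℝ)} {Φ : Fin N → L2} {h h' : CutPlane → LInf}
    (H : IsRegularPart q hq1 ev Φ h) (H' : IsRegularPart q hq1 ev Φ h') : h' = h := by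
  have heq : ∀ u : L1, (fun k => ∫ x, h' k x * u x) = fun k => ∫ x, h k x * u x := by
    intro u
    refine Continuous.ext_on CutPlane.dense_im_ne_zero (H'.weakStar_continuous u)
      (H.weakStar_continuous u) fun k hk => ?_
    have h1 : k.toComplex ∉ pointSpectrum q := fun h =>
      hk (im_eq_zero_of_mem_pointSpectrum hq hs h)
    have h2 : k.toComplex ∉ Complex.ofReal '' exceptionalSet q := by
      rintro ⟨t, -, ht⟩
      exact hk (by rw [← ht, ofReal_im])
    refine integral_congr_ae ?_
    filter_upwards [H.expansion k h1 h2, H'.expansion k h1 h2] with x hx hx'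
    rw [hx] at hx'
    rw [add_left_cancel hx']
  exact funext fun k => LInf.ext_integral fun u => congrFun (heq u) k

namespace BoundSystem

/-- Together with `mem_exceptionalSet` this identifies the exceptional set with the nonnegative
eigenvalues. It is therefore finite, and `β` has at most one continuous extension. -/
theorem exists_of_mem_exceptionalSet (hB : BoundSystem q ev φ f) {t : ℝ}
    (ht : t ∈ exceptionalSet q) : ∃ j, ev j = t := by
  have key : ∀ k : CutPlane, k.toComplex = t → (1 - sandwiched q k).ker ≠ ⊥ → ∃ j, ev j = t := by
    intro k hk hker
    obtain ⟨v, hv, hv0⟩ := (Submodule.ne_bot_iff _).1 hker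
    have hv' : sideOp q k.side t v = v := by
      rw [sandwiched_eq, hk] at hv
      exact (sub_eq_zero.1 hv).symm
    have hb := boundState_of_sideOp_eq_self hv'
    exact hB.complete hb fun h0 => hv0 (hb.szego_eq_zero h0)
  exact ht.2.elim (key _ (CutPlane.toComplex_plus t)) (key _ (CutPlane.toComplex_minus t))

theorem mem_exceptionalSet (hB : BoundSystem q ev φ f) (hq : IsWeightedHardy s q)
    (hs : 1 / 2 < s) {j : Fin N} (hj : 0 ≤ ev j) : ev j ∈ exceptionalSet q := by
  refine ⟨hj, Or.inl ((Submodule.ne_bot_iff _).2 ⟨f j, ?_,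
    (hB.boundState j).szego_ne_zero (hB.ne_zero hq hs j)⟩)⟩
  rw [sandwiched_eq, CutPlane.toComplex_plus]
  exact sub_eq_zero.2 ((hB.boundState j).sideOp_eq_self _).symm

variable {P : L1} {w : Fin N → L1}

/-- The Jost solution in terms of its density. -/
theorem exists_jostInhom_eq (hB : BoundSystem q ev φ f) (hq : IsWeightedHardy s q)
    (hs : 1 / 2 < s) (hw : ∀ j, w j =ᵐ[volume] fun x => conj (φ j x))
    (hP : P =ᵐ[volume] source q φ) (hq1 : MemLp q 1 (volume : Measure ℝ)) (k : CutPlane)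
    (hne : ∀ j, k.toComplex ≠ ev j) :
    (jostInhom q hq1 k =ᵐ[volume] fun x => -I * ∑ j, φ j x / (k.toComplex - ev j) +
        sideRes k.side k.toComplex
          (density q P (regularSol q P w f k.side k.toComplex)) x) ∧
      (fun x => q x * (szego (conjMulToL2 q (jostInhom q hq1 k)) x + 1)) =ᵐ[volume] fun x =>
        density q P (regularSol q P w f k.side k.toComplex) x -
          ∑ j, I / (k.toComplex - ev j) * (q x * f j x + (ev j - k.toComplex) * φ j x) := by
  obtain ⟨v, U, hU, hd, hv, hvm, hv2, he⟩ :=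
    hB.exists_jost hq hs hw hP hq1.toLp hq1.coeFn_toLp k.mem_halfPlane_side hne
  have hj : jostInhom q hq1 k = sideRes k.side k.toComplex (mulToL1 q v + hq1.toLp) := by
    rw [jostInhom, resolvent, freeResolvent_eq, sandwiched_eq]
    simp only [_root_.add_apply, ContinuousLinearMap.comp_apply]
    rw [hv, szego_of_mem hvm, map_add, add_comm]
  rw [hj, hv2]
  refine ⟨he, ?_⟩
  have hsum : (∑ j, (I / (k.toComplex - ev j)) • U j : L1) =ᵐ[volume] fun x =>
      ∑ j, I / (k.toComplex - ev j) * (q x * f j x + (ev j - k.toComplex) * φ j x) := by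
    refine (Lp.coeFn_finsetSum _ _).trans ?_
    filter_upwards [eventually_countable_forall.2 hU, eventually_countable_forall.2 fun j =>
      Lp.coeFn_smul (I / (k.toComplex - ev j)) (U j)] with x h1 h2
    rw [Finset.sum_apply]
    refine Finset.sum_congr rfl fun j _ => ?_
    rw [h2, Pi.smul_apply, h1, smul_eq_mul]
  have h1 : (mulToL1 q v + hq1.toLp : L1) =ᵐ[volume] fun x => q x * (v x + 1) := by
    filter_upwards [Lp.coeFn_add (mulToL1 q v) hq1.toLp, coeFn_mulToL1 q v, hq1.coeFn_toLp]
      with x h1 h2 h3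
    rw [h1, Pi.add_apply, h2, h3]; ring
  rw [hd] at h1
  refine h1.symm.trans ?_
  filter_upwards [Lp.coeFn_sub (density q P (regularSol q P w f k.side k.toComplex))
    (∑ j, (I / (k.toComplex - ev j)) • U j), hsum] with x h2 h3
  rw [h2, Pi.sub_apply, h3]

/-- The regular part of the Jost solution. -/
def regularPart (q : L2) (P : L1) (w : Fin N → L1) (f : Fin N → L2) (k : CutPlane) : LInf :=
  sideRes k.side k.toComplex (density q P (regularSol q P w f k.side k.toComplex))

theorem isRegularPart (hB : BoundSystem q ev φ f) (hq : IsWeightedHardy s q)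
    (hs : 1 / 2 < s) (hw : ∀ j, w j =ᵐ[volume] fun x => conj (φ j x))
    (hP : P =ᵐ[volume] source q φ) {hq1 : MemLp q 1 (volume : Measure ℝ)} {Φ : Fin N → L2}
    (hΦ : ∀ j, Φ j =ᵐ[volume] φ j) :
    IsRegularPart q hq1 ev Φ (regularPart q P w f) := by
  refine ⟨fun u => ?_, fun k hk _ => ?_⟩
  · exact CutPlane.continuous_side
      (G := fun b z => ∫ x, sideRes b z (density q P (regularSol q P w f b z)) x * u x)
      (fun b => continuousOn_integral_sideRes (hB.continuousOn_density hq hs hw P b) u)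
      fun t ht => by rw [(hB.regularSol_true_eq_false hq hs hw hP ht).2]
  · have hne : ∀ j, k.toComplex ≠ ev j := fun j h =>
      hk (h ▸ (hB.boundState j).mem_pointSpectrum hq hs (hB.ne_zero hq hs j))
    filter_upwards [(hB.exists_jostInhom_eq hq hs hw hP hq1 k hne).1,
      eventually_countable_forall.2 hΦ] with x h1 h2
    rw [h1, regularPart]
    simp only [h2]

theorem exists_regularPart_eq (hB : BoundSystem q ev φ f) (hq : IsWeightedHardy s q)
    (hs : 1 / 2 < s) (hw : ∀ j, w j =ᵐ[volume] fun x => conj (φ j x))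
    (hP : P =ᵐ[volume] source q φ) {Φ : Fin N → L2}
    (hΦ : ∀ j, Φ j =ᵐ[volume] φ j) (j : Fin N) :
    ∃ γ : ℂ, ∀ k : CutPlane, k.toComplex = ev j →
      regularPart q P w f k =ᵐ[volume] fun x : ℝ => (γ + x) * Φ j x +
        I * ∑ i ∈ Finset.univ.erase j, Φ i x / ((ev j : ℂ) - (ev i : ℂ)) := by
  obtain ⟨γ, hγ⟩ := hB.exists_eigenPart hq hs hw hP j
  refine ⟨γ, fun k hk => ?_⟩
  have h1 := coeFn_sideRes k.mem_halfPlane_side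
    (density q P (regularSol q P w f k.side k.toComplex))
  rw [regularPart]
  filter_upwards [h1, eventually_countable_forall.2 hΦ] with x h1 h2
  rw [h1, hk, (hγ k.side).2, eigenPart]
  simp only [h2]

/-- The continuous extension of the scattering coefficient. -/
def regularCoeff (q : L2) (P : L1) (w : Fin N → L1) (f : Fin N → L2) (t : ℝ) : ℂ :=
  I * ∫ x : ℝ, exp (-(I * t * x)) * density q P (regularSol q P w f true t) x

theorem continuous_regularCoeff (hB : BoundSystem q ev φ f) (hq : IsWeightedHardy s q)
    (hs : 1 / 2 < s) (hw : ∀ j, w j =ᵐ[volume] fun x => conj (φ j x)) :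
    Continuous (regularCoeff q P w f) := by
  refine continuous_const.mul (continuous_integral_exp_mul ?_ continuous_id)
  exact (hB.continuousOn_density hq hs hw P true).comp_continuous continuous_ofReal
    fun t => ofReal_mem_halfPlane true t

/-- The density is the source of the explicit solution at the eigenvalue, which vanishes at both
ends. -/
theorem regularCoeff_ev (hB : BoundSystem q ev φ f) (hq : IsWeightedHardy s q)
    (hs : 1 / 2 < s) (hw : ∀ j, w j =ᵐ[volume] fun x => conj (φ j x))
    (hP : P =ᵐ[volume] source q φ) (j : Fin N) : regularCoeff q P w f (ev j) = 0 := by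
  obtain ⟨γ, hγ⟩ := hB.exists_eigenPart hq hs hw hP j
  have ht := hB.tendsto_eigenPart hq hs j γ
  rw [regularCoeff, (hγ true).1.integral_eq_zero (L1.integrable_coeFn _) ht.1 ht.2, mul_zero]

/-- The integrand of `β` is the density minus the pole terms. Each pole term is a multiple of the
source of `φⱼ` at energy `t`, and its transform at `t` vanishes because `φⱼ` vanishes at both ends.
-/
theorem scatteringCoeff_eq (hB : BoundSystem q ev φ f) (hq : IsWeightedHardy s q)
    (hs : 1 / 2 < s) (hw : ∀ j, w j =ᵐ[volume] fun x => conj (φ j x))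
    (hP : P =ᵐ[volume] source q φ) (hq1 : MemLp q 1 (volume : Measure ℝ)) {t : ℝ}
    (hne : ∀ j, t ≠ ev j) : scatteringCoeff q hq1 t = regularCoeff q P w f t := by
  have hk := (hB.exists_jostInhom_eq hq hs hw hP hq1 (CutPlane.plus t) fun j h =>
    hne j (ofReal_injective (by rwa [CutPlane.toComplex_plus] at h))).2
  rw [CutPlane.side_plus, CutPlane.toComplex_plus] at hk
  have hi : ∀ j, Integrable fun x => q x * f j x + ((ev j : ℂ) - t) * φ j x := fun j =>
    (integrable_mul_L2 q (f j)).add (((hB.boundState j).integrable hq hs).const_mul _)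
  have hz : ∀ j, ∫ x : ℝ, exp (-(I * t * x)) * (q x * f j x + ((ev j : ℂ) - t) * φ j x) = 0 :=
    fun j => ((hB.boundState j).freeEq.shift (integrable_mul_L2 q (f j)).locallyIntegrable
      t).integral_eq_zero (hi j) (hB.boundState j).tendsto_atBot (hB.boundState j).tendsto_atTop
  have e : ∫ y : ℝ, q y * (szego (conjMulToL2 q (jostInhom q hq1 (CutPlane.plus t))) y + 1) *
      exp (-(I * t * y)) =
      ∫ x : ℝ, (exp (-(I * t * x)) * density q P (regularSol q P w f true t) x -
        ∑ j, I / ((t : ℂ) - ev j) *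
          (exp (-(I * t * x)) * (q x * f j x + ((ev j : ℂ) - t) * φ j x))) := by
    refine integral_congr_ae ?_
    filter_upwards [hk] with x hx
    rw [hx, mul_comm, mul_sub, Finset.mul_sum]
    exact congrArg _ (Finset.sum_congr rfl fun j _ => by ring)
  rw [scatteringCoeff, regularCoeff, e, integral_sub (integrable_exp_mul (L1.integrable_coeFn _) t)
    (integrable_finsetSum _ fun j _ => (integrable_exp_mul (hi j) t).const_mul _),
    integral_finsetSum _ fun j _ => (integrable_exp_mul (hi j) t).const_mul _]
  simp_rw [integral_const_mul, hz]
  simp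

theorem isScatteringExtension_unique (hB : BoundSystem q ev φ f)
    {hq1 : MemLp q 1 (volume : Measure ℝ)} {b b' : C(Set.Ici (0 : ℝ), ℂ)}
    (H : IsScatteringExtension q hq1 b) (H' : IsScatteringExtension q hq1 b') : b' = b := by
  have hc : ConnectedSpace (Set.Ici (0 : ℝ)) := Subtype.connectedSpace isConnected_Ici
  have hnt : Nontrivial (Set.Ici (0 : ℝ)) :=
    ⟨⟨⟨0, Set.self_mem_Ici⟩, ⟨1, Set.mem_Ici.2 zero_le_one⟩, fun h => zero_ne_one (congrArg Subtype.val h)⟩⟩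
  have hfin : {t : Set.Ici (0 : ℝ) | (t : ℝ) ∈ exceptionalSet q}.Finite :=
    ((Set.finite_range ev).subset fun t ht =>
      hB.exists_of_mem_exceptionalSet ht).preimage Subtype.val_injective.injOn
  -- A connected space with more than one point has no isolated points, so the complement of a
  -- finite set is dense.
  have hd := dense_univ.sdiff_finite hfin
  refine ContinuousMap.ext fun t => congrFun (Continuous.ext_on hd b'.continuous b.continuous
    fun t ht => ?_) t
  rw [H t ht.2, H' t ht.2]

end BoundSystem

end

end CalogeroMoser

end

theorem mainTheorem8 (s : ℝ) (hs : 1 / 2 < s) (q : L2) (hq : IsWeightedHardy s q) :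
    (∃ (N : ℕ) (ev : Fin N → ℝ) (φ : Fin N → L2), IsEigenSystem q ev φ) ∧
    ∀ (N : ℕ) (ev : Fin N → ℝ) (φ : Fin N → L2), IsEigenSystem q ev φ →
      (∃ h : CutPlane → LInf,
        IsRegularPart q (hq.memLp_one hs) ev φ h ∧
        (∀ h' : CutPlane → LInf, IsRegularPart q (hq.memLp_one hs) ev φ h' → h' = h) ∧
        ∀ j : Fin N, ∃ γ : ℂ,
          (h (CutPlane.plus (ev j)) =ᵐ[volume] fun x : ℝ => (γ + x) * φ j x +
            Complex.I * ∑ i ∈ Finset.univ.erase j, φ i x / ((ev j : ℂ) - (ev i : ℂ))) ∧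
          (h (CutPlane.minus (ev j)) =ᵐ[volume] fun x : ℝ => (γ + x) * φ j x +
            Complex.I * ∑ i ∈ Finset.univ.erase j, φ i x / ((ev j : ℂ) - (ev i : ℂ)))) ∧
      (∃ b : C(Set.Ici (0 : ℝ), ℂ),
        IsScatteringExtension q (hq.memLp_one hs) b ∧
        (∀ b' : C(Set.Ici (0 : ℝ), ℂ),
          IsScatteringExtension q (hq.memLp_one hs) b' → b' = b) ∧
        ∀ (j : Fin N) (hj : 0 ≤ ev j), b ⟨ev j, hj⟩ = 0) := by
  refine ⟨exists_eigenSystem hq hs, fun N ev Φ hΦ => ?_⟩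
  obtain ⟨φ, f, hB, hae⟩ := hΦ.exists_boundSystem hq hs
  have hw := fun j => (hB.memLp_conj hq hs j).coeFn_toLp
  have hP := (memLp_one_iff_integrable.2 (hB.integrable_source hq hs)).coeFn_toLp
  have hreg := hB.isRegularPart hq hs hw hP (hq1 := hq.memLp_one hs) hae
  have hext := fun t (ht : ∀ j, t ≠ ev j) =>
    hB.scatteringCoeff_eq hq hs hw hP (hq.memLp_one hs) ht
  have hb : IsScatteringExtension q (hq.memLp_one hs)
      ⟨fun t : Set.Ici (0 : ℝ) => BoundSystem.regularCoeff q _ _ f t,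
        (hB.continuous_regularCoeff hq hs hw).comp continuous_subtype_val⟩ := fun t ht =>
    (hext t fun j hj => ht (hj ▸ hB.mem_exceptionalSet hq hs (hj ▸ t.2))).symm
  refine ⟨⟨_, hreg, fun h' H' => hreg.unique hq hs H', fun j => ?_⟩, _, hb,
    fun b' H' => hB.isScatteringExtension_unique hb H', fun j hj =>
      hB.regularCoeff_ev hq hs hw hP j⟩
  obtain ⟨γ, hγ⟩ := hB.exists_regularPart_eq hq hs hw hP hae j
  exact ⟨γ, hγ _ (CutPlane.toComplex_plus _), hγ _ (CutPlane.toComplex_minus _)⟩
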